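/- **Setting.** Let $m\le M$ and let the pressure $p(c,\rho)$ and the viscosity $\mu(c)$ be $\mathcal C^1$ on $[m,M]\times[0,\infty)$, resp. $[m,M]$, with $p\ge 0$, $\mu\ge\mu_{\min}>0$, and, for some $C_0>0$, $p(c,\rho)\le C_0\,(\rho+G(c,\rho))$ for all $\rho\ge 1$ and $c\in[m,M]$, where $G(c,\rho)=\rho\int_1^\rho p(c,s)s^{-2}\,ds$. For $J\ge 1$, consider periodic discrete data on the torus of length $1$: nodes $x_{j+\frac12}$, colors $c_j$, densities $\rho_j$, velocities $u_{j+\frac12}$ ($j\in\mathbb Z$), where $c,\rho,u$ are $J$-periodic in $j$ and $x_{j+J+\frac12}=x_{j+\frac12}+1$. Put $\Delta x_j=x_{j+\frac12}-x_{j-\frac12}$, $\Delta x_{j+\frac12}=\frac12(\Delta x_j+\Delta x_{j+1})$, $\rho_{j+\frac12}=\frac{\rho_j\Delta x_j+\rho_{j+1}\Delta x_{j+1}}{\Delta x_j+\Delta x_{j+1}}$, $x_j=\frac12(x_{j-\frac12}+x_{j+\frac12})$ and $$Z_j=\mu(c_j)\frac{u_{j+\frac12}-u_{j-\frac12}}{\Delta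 x_j}-p(c_j,\rho_j).$$ A global solution is a family of such data, $t\in[0,\infty)$, with $\Delta x_j(t)>0$ and $$\dot x_{j+\frac12}=u_{j+\frac12},\quad \dot c_j=0,\quad \tfrac{d}{dt}(\rho_j\Delta x_j)=0,$$ $$\rho_{j+\frac12}\Delta x_{j+\frac12}\dot u_{j+\frac12}+p(c_{j+1},\rho_{j+1})-p(c_j,\rho_j)=\mu(c_{j+1})\frac{u_{j+\frac32}-u_{j+\frac12}}{\Delta x_{j+1}}-\mu(c_j)\frac{u_{j+\frac12}-u_{j-\frac12}}{\Delta x_j}.$$ The reconstructions are: $\hat c_J=c_j$, $\hat\rho_J=\rho_j$ on $[x_{j-\frac12},x_{j+\frac12})$; $\hat u_J$ continuous, affine on each cell, with the value $u_{j+\frac12}$ at $x_{j+\frac12}$; $\hat Z_J$ continuous, affine on each $[x_j,x_{j+1})$, with the value $Z_j$ at $x_j$. An internal energy density is a function $H(\rho,c)$ with $\rho\,\partial_\rho H-H=p$ for $\rho>0$, $c\in[m,M]$; the initial energy is $$E_0=\tfrac12\sum_{j=0}^{J-1}\rho^0_{j+\frac12}|u^0_{j+\frac12}|^2\Delta x^0_{j+\frac12}+\sum_{j=0}^{J-1}H(\rho_j^0,c_j^0)\Delta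 x_j^0 .$$ **Theorem.** Let $0<\underline\rho\le\overline\rho$ and $K$ be given. There are continuous, strictly positive, increasing functions $C^1_{ini}$, $C$, $C_r$ ($0<r<\frac43$) and $C'_\kappa$ ($\kappa\in\mathbb R$) on $[0,\infty)$, depending only on $p,\mu,m,M,\underline\rho,\overline\rho,K$ (and on the indicated index), such that the following holds for every $J\ge1$, all initial data with $\Delta x_j^0>0$, $c_j^0\in[m,M]$, $\rho_j^0\in[\underline\rho,\overline\rho]$ and $$\sum_{j=0}^{J-1}|u^0_{j+\frac12}|^2\Delta x_j^0+\sum_{j=0}^{J-1}\Big|\frac{u^0_{j+\frac12}-u^0_{j-\frac12}}{\Delta x^0_j}\Big|^2\Delta x_j^0\le K,$$ and every global solution with these initial data. For each $t>0$ the first order partial derivatives of $\hat u_J$ and $\hat Z_J$ exist at $(t,x)$ for a.e. $x$, and for all $t\ge 0$: 1. $\min_j c_j^0\le\hat c_J(t,x)\le\max_j c_j^0$ for all $x$; 2. $1/C^1_{ini}(t)\le\hat\rho_J(t,x)\le C^1_{ini}(t)$ for all $x$; 3. for every internal energy density $H$ with $H(\hat\rho_J(t,x),\hat c_J(t,x))\ge0$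 for all $x$ (in particular if $H\ge 0$), $$\int_0^1\hat\rho_J|\hat u_J|^2(t,x)\,dx+\int_0^1H(\hat\rho_J,\hat c_J)(t,x)\,dx+\int_0^t\!\!\int_0^1\mu(\hat c_J)|\partial_x\hat u_J|^2\,dx\,d\tau\le 2E_0;$$ 4. $\|\partial_x\hat u_J\|_{L^2((0,t)\times(0,1))}+\|\partial_t\hat u_J\|_{L^2((0,t)\times(0,1))}+\min\{1,t\}\,\|\partial_t\hat u_J(t)\|_{L^2(0,1)}\le C(t)$; 5. for every $0<r<\frac43$, $$\int_0^t\!\!\int_0^1|\partial_x\hat Z_J|^2\,dx\,d\tau+\min\{1,t\}\int_0^1|\partial_x\hat Z_J(t,x)|^2\,dx+\int_0^t\Big(\sup_{x\in[0,1]}|\partial_x\hat Z_J(\tau,x)|\Big)^{r}d\tau\le C_r(t)$$ (the supremum being over the points where the derivative exists); 6. for every $\kappa$ such that $\Delta x_j^0\le\kappa\Delta x_{j+1}^0$ and $\Delta x_{j+1}^0\le\kappa\Delta x_j^0$ for all $j$, $$\int_0^t\!\!\int_0^1\min\{1,\tau\}\,|\partial_t\hat Z_J(\tau,x)|^2\,dx\,d\tau\le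 C'_\kappa(t).$$ -/

import Mathlib

open MeasureTheory Set

noncomputable section

namespace SemiDiscrete

/-- A discrete state on the torus of length one with `J` cells, extended to all indices `j : ℤ`
by periodicity. Integer indices of `x` and `u` stand for the left end point of a cell:
`x j` is `x_{j-1/2}`, `u j` is `u_{j-1/2}`, and the cell number `j` is `[x j, x (j + 1))`. -/
structure MeshState (J : ℕ) where
  x : ℤ → ℝ
  c : ℤ → ℝ
  ρ : ℤ → ℝ
  u : ℤ → ℝ
  x_periodic : ∀ j : ℤ, x (j + J) = x j + 1
  c_periodic : ∀ j : ℤ, c (j + J) = c j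
  ρ_periodic : ∀ j : ℤ, ρ (j + J) = ρ j
  u_periodic : ∀ j : ℤ, u (j + J) = u j

namespace MeshState

variable {J : ℕ}

/-- `Δx_j`, the length of cell `j`. -/
def dx (s : MeshState J) (j : ℤ) : ℝ := s.x (j + 1) - s.x j

/-- `Δx_{j-1/2} = (Δx_{j-1} + Δx_j) / 2`. -/
def dxNode (s : MeshState J) (j : ℤ) : ℝ := (s.dx (j - 1) + s.dx j) / 2

/-- `ρ_{j-1/2}`, the density at the node `x_{j-1/2}`. -/
def rhoNode (s : MeshState J) (j : ℤ) : ℝ :=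
  (s.ρ (j - 1) * s.dx (j - 1) + s.ρ j * s.dx j) / (s.dx (j - 1) + s.dx j)

/-- `(u_{j+1/2} - u_{j-1/2}) / Δx_j`. -/
def gradU (s : MeshState J) (j : ℤ) : ℝ := (s.u (j + 1) - s.u j) / s.dx j

/-- The discrete effective flux
`Z_j = μ(c_j) (u_{j+1/2} - u_{j-1/2}) / Δx_j - p(c_j, ρ_j)`. -/
def flux (p : ℝ → ℝ → ℝ) (μ : ℝ → ℝ) (s : MeshState J) (j : ℤ) : ℝ :=
  μ (s.c j) * s.gradU j - p (s.c j) (s.ρ j)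

/-- The centre `x_j` of cell `j`. -/
def center (s : MeshState J) (j : ℤ) : ℝ := (s.x j + s.x (j + 1)) / 2

/-- For an increasing unbounded sequence `a`, the index `j` with `y ∈ [a j, a (j + 1))`. -/
def index (a : ℤ → ℝ) (y : ℝ) : ℤ := sSup {j : ℤ | a j ≤ y}

/-- Piecewise constant reconstruction of `c`. -/
def cHat (s : MeshState J) (y : ℝ) : ℝ := s.c (index s.x y)

/-- Piecewise constant reconstruction of `ρ`. -/
def rhoHat (s : MeshState J) (y : ℝ) : ℝ := s.ρ (index s.x y)

/-- Reconstruction of the velocity, affine on every cell. -/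
def uHat (s : MeshState J) (y : ℝ) : ℝ :=
  let j := index s.x y
  (y - s.x j) / s.dx j * s.u (j + 1) + (s.x (j + 1) - y) / s.dx j * s.u j

/-- Reconstruction of the effective flux, affine between consecutive cell centres. -/
def zHat (p : ℝ → ℝ → ℝ) (μ : ℝ → ℝ) (s : MeshState J) (y : ℝ) : ℝ :=
  let j := index s.center y
  (y - s.center j) / s.dxNode (j + 1) * s.flux p μ (j + 1)
    + (s.center (j + 1) - y) / s.dxNode (j + 1) * s.flux p μ j

/-- The energy of a state, with internal energy density `H(ρ, c)` (no dissipation term). -/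
def energy (H : ℝ → ℝ → ℝ) (s : MeshState J) : ℝ :=
  1 / 2 * ∑ j ∈ Finset.range J,
      s.rhoNode ((j : ℤ) + 1) * |s.u ((j : ℤ) + 1)| ^ 2 * s.dxNode ((j : ℤ) + 1)
    + ∑ j ∈ Finset.range J, H (s.ρ (j : ℤ)) (s.c (j : ℤ)) * s.dx (j : ℤ)

/-- The square of the discrete `H¹` norm of the velocity. -/
def h1Sq (s : MeshState J) : ℝ :=
  ∑ j ∈ Finset.range J, |s.u ((j : ℤ) + 1)| ^ 2 * s.dx (j : ℤ)
    + ∑ j ∈ Finset.range J, |s.gradU (j : ℤ)| ^ 2 * s.dx (j : ℤ)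

/-- The hypothesis on the initial data, with explicit bounds. -/
structure Admissible (s : MeshState J) (cLo cHi ρLo ρHi K : ℝ) : Prop where
  ordered : ∀ j : ℤ, s.x j < s.x (j + 1)
  c_mem : ∀ j : ℤ, s.c j ∈ Icc cLo cHi
  ρ_mem : ∀ j : ℤ, s.ρ j ∈ Icc ρLo ρHi
  h1 : s.h1Sq ≤ K

/-- Lengths of adjacent cells differ at most by the factor `κ`. -/
def MeshRatioLE (s : MeshState J) (κ : ℝ) : Prop :=
  ∀ j : ℤ, s.dx j ≤ κ * s.dx (j + 1) ∧ s.dx (j + 1) ≤ κ * s.dx j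

end MeshState

/-- `G(c, ρ) = ρ ∫_1^ρ p(c, s) / s² ds`. -/
def potential (p : ℝ → ℝ → ℝ) (c ρ : ℝ) : ℝ := ρ * ∫ s in (1 : ℝ)..ρ, p c s / s ^ 2

/-- Assumptions on the pressure law `p(c, ρ)` and on the viscosity law `μ(c)`, for `c` in
`[cLo, cHi]`. On `0 ≤ ρ ≤ 1` the pressure is bounded by continuity, so the growth condition
only matters for `ρ ≥ 1`. -/
structure ConstitutiveLaws (p : ℝ → ℝ → ℝ) (μ : ℝ → ℝ) (cLo cHi : ℝ) : Prop where
  p_smooth : ContDiffOn ℝ 1 (fun z : ℝ × ℝ => p z.1 z.2) (Icc cLo cHi ×ˢ Ici (0 : ℝ))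
  μ_smooth : ContDiffOn ℝ 1 μ (Icc cLo cHi)
  p_nonneg : ∀ c ∈ Icc cLo cHi, ∀ ρ : ℝ, 0 ≤ ρ → 0 ≤ p c ρ
  μ_pos : ∃ μmin : ℝ, 0 < μmin ∧ ∀ c ∈ Icc cLo cHi, μmin ≤ μ c
  growth : ∃ C₀ : ℝ, 0 < C₀ ∧ ∀ c ∈ Icc cLo cHi, ∀ ρ : ℝ, 1 ≤ ρ →
    p c ρ ≤ C₀ * (ρ + potential p c ρ)

/-- `H(ρ, c)` is an internal energy density for the pressure `p(c, ρ)`: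
`ρ ∂_ρ H - H = p` for `ρ > 0`. -/
def IsInternalEnergy (p : ℝ → ℝ → ℝ) (cLo cHi : ℝ) (H : ℝ → ℝ → ℝ) : Prop :=
  ∀ c ∈ Icc cLo cHi, ∀ ρ : ℝ, 0 < ρ →
    ∃ h : ℝ, HasDerivAt (fun r => H r c) h ρ ∧ ρ * h - H ρ c = p c ρ

/-- `S` solves the semi-discrete system on `[0, ∞)` with initial state `s₀`. The momentum
equation is written at the node `x_{j-1/2}`, between the cells `j - 1` and `j`. -/
structure IsGlobalSolution {J : ℕ} (p : ℝ → ℝ → ℝ) (μ : ℝ → ℝ) (s₀ : MeshState J)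
    (S : ℝ → MeshState J) : Prop where
  initial : S 0 = s₀
  ordered : ∀ t : ℝ, 0 ≤ t → ∀ j : ℤ, (S t).x j < (S t).x (j + 1)
  position : ∀ t : ℝ, 0 ≤ t → ∀ j : ℤ,
    HasDerivWithinAt (fun τ => (S τ).x j) ((S t).u j) (Ici 0) t
  color : ∀ t : ℝ, 0 ≤ t → ∀ j : ℤ,
    HasDerivWithinAt (fun τ => (S τ).c j) 0 (Ici 0) t
  mass : ∀ t : ℝ, 0 ≤ t → ∀ j : ℤ,
    HasDerivWithinAt (fun τ => (S τ).ρ j * (S τ).dx j) 0 (Ici 0) t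
  momentum : ∀ t : ℝ, 0 ≤ t → ∀ j : ℤ, ∃ a : ℝ,
    HasDerivWithinAt (fun τ => (S τ).u j) a (Ici 0) t ∧
    (S t).rhoNode j * (S t).dxNode j * a
        + (p ((S t).c j) ((S t).ρ j) - p ((S t).c (j - 1)) ((S t).ρ (j - 1)))
      = μ ((S t).c j) * (((S t).u (j + 1) - (S t).u j) / (S t).dx j)
        - μ ((S t).c (j - 1)) * (((S t).u j - (S t).u (j - 1)) / (S t).dx (j - 1))

/-- Partial derivative in time of a function of `(t, x)`. -/
def partialT (f : ℝ → ℝ → ℝ) (t x : ℝ) : ℝ := deriv (fun τ => f τ x) t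

/-- Partial derivative in space of a function of `(t, x)`. -/
def partialX (f : ℝ → ℝ → ℝ) (t x : ℝ) : ℝ := deriv (fun y => f t y) x

/-- Both partial derivatives exist at `(t, x)`. -/
def HasPartials (f : ℝ → ℝ → ℝ) (t x : ℝ) : Prop :=
  DifferentiableAt ℝ (fun τ => f τ x) t ∧ DifferentiableAt ℝ (fun y => f t y) x

/-- The norm of `L²((0,t) × (0,1))`. -/
def L2SpaceTime (t : ℝ) (g : ℝ → ℝ → ℝ) : ENNReal :=
  eLpNorm (fun z : ℝ × ℝ => g z.1 z.2) 2 (volume.restrict (Ioo 0 t ×ˢ Ioo (0 : ℝ) 1))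

/-- The norm of `L²(0,1)`. -/
def L2Space (g : ℝ → ℝ) : ENNReal := eLpNorm g 2 (volume.restrict (Ioo (0 : ℝ) 1))

/-- Continuous, strictly positive, increasing functions of time `t ≥ 0`. -/
def IsBoundFunction (C : ℝ → ℝ) : Prop :=
  ContinuousOn C (Ici 0) ∧ StrictMonoOn C (Ici 0) ∧ ∀ t : ℝ, 0 ≤ t → 0 < C t

end SemiDiscrete

end

/-! The proof is the Lagrangian energy method for one-dimensional viscous flow, carried out exactly
on the moving mesh: integrations by parts become Abel summation over one period (`sum_by_parts`).
Colors and cell masses are constant in time, hence so are the viscosities and the node masses.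
Constants independent of `J` come from using only sums weighted by lengths or masses and total
variations.

Energy. The energy decays at the rate `diss` (`IsFlow.hasDeriv_energy`). For the internal energy
`potential`, which is bounded below and dominates the pressure up to mass by the growth condition,
this bounds the kinetic energy and the integral of the pressure (`exists_energy_bound`).

Density. In cell `n`, `μ log ρ` has time derivative `-(Z + p)`, while a partial sum of momenta has a
difference of two fluxes as its derivative. The combination `densityPotential` removes the pointwise
fluxes, and what remains is absorbed by the energy dissipation (`exists_density_bounds`). The upper
bound comes first, since it only needs `p ≥ 0`; the lower one then uses a bounded pressure.

Acceleration. With all coefficients bounded (`IsBounded`), the flux is the good unknown: its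
differences are masses times accelerations, so it is bounded pointwise by `diss` and `accSq`,
although `p` and the velocity gradient may jump between cells. Testing the momentum equation with
the acceleration (`hasDeriv_lyapunov`) dissipates `accSq`; the production is quadratic in `diss`,
and a Gronwall factor `exp (k (E - t))` closes the estimate because `E' = -diss`. Differentiating
the momentum equation in time dissipates `accDiss`. No uniform bound of `accSq` is available at time
zero, so this last estimate carries the weight `t` (`exists_acceleration_bounds`).

Reconstruction. Inside a cell the derivatives of the interpolants are explicit and their squares
integrate to the discrete sums. For the supremum of the flux slope, an interpolation inequality with
parameter `τ^(-1/2)` bounds its square by a multiple of `(1 + τ^(-1/2)) (accSq + τ accDiss)`;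
Young's inequality leaves the power `τ^(-r/(2(2-r)))`, integrable exactly when `r < 4/3`. Finally
`exists_isBoundFunction` turns constants valid up to each `T` into continuous increasing functions
of time. -/

namespace SemiDiscrete

/-! ### Sums of periodic sequences, total variation and interpolation -/

section PeriodicSums

variable {J : ℕ} {f g : ℤ → ℝ}

theorem sum_periodic_shift (hf : Function.Periodic f (J : ℤ)) :
    ∑ j ∈ Finset.range J, f ((j : ℤ) + 1) = ∑ j ∈ Finset.range J, f (j : ℤ) := by
  have h1 := Finset.sum_range_succ (fun j : ℕ => f j) J
  have h2 := Finset.sum_range_succ' (fun j : ℕ => f j) J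
  have h3 : f (J : ℤ) = f 0 := by simpa using hf 0
  push_cast at h2
  rw [h1, h3] at h2
  linarith

theorem sum_by_parts (hf : Function.Periodic f (J : ℤ)) (hg : Function.Periodic g (J : ℤ)) :
    ∑ j ∈ Finset.range J, f (j : ℤ) * (g j - g (j - 1))
      = - ∑ j ∈ Finset.range J, g (j : ℤ) * (f (j + 1) - f j) := by
  have hg' : Function.Periodic (fun j => g (j - 1)) (J : ℤ) := fun j => by
    show g (j + J - 1) = g (j - 1)
    rw [show j + (J : ℤ) - 1 = j - 1 + J by ring, hg]
  have h1 := sum_periodic_shift (J := J) (f := fun j => f j * g (j - 1)) (hf.mul hg')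
  simp only [add_sub_cancel_right] at h1
  simp only [mul_sub, Finset.sum_sub_distrib]
  rw [← h1]
  simp only [mul_comm (f _) (g _)]
  ring

theorem exists_nat_of_periodic (hJ : 1 ≤ J) (j : ℤ) :
    ∃ i : ℕ, i < J ∧ ∀ f : ℤ → ℝ, Function.Periodic f (J : ℤ) → f j = f i := by
  have hJ' : (0 : ℤ) < J := by exact_mod_cast hJ
  refine ⟨(j % J).toNat, ?_, fun f hf => ?_⟩
  · have := Int.emod_lt_of_pos j hJ'
    have := Int.emod_nonneg j hJ'.ne'
    omega
  · rw [Int.toNat_of_nonneg (Int.emod_nonneg j hJ'.ne'), Int.emod_def, mul_comm]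
    exact (hf.sub_zsmul_eq (j / J)).symm.trans (by simp)

theorem le_sum_of_periodic (hJ : 1 ≤ J) (hf : Function.Periodic f (J : ℤ)) (h0 : ∀ j, 0 ≤ f j)
    (j : ℤ) : f j ≤ ∑ i ∈ Finset.range J, f (i : ℤ) := by
  obtain ⟨i, hi, h⟩ := exists_nat_of_periodic hJ j
  rw [h f hf]
  exact Finset.single_le_sum (f := fun i : ℕ => f i) (fun _ _ => h0 _) (Finset.mem_range.2 hi)

/-- Both indices are reduced to one period and joined inside it, a path that uses each increment at
most once. -/
theorem abs_sub_le_sum_of_periodic (hJ : 1 ≤ J) (hf : Function.Periodic f (J : ℤ)) (j k : ℤ) :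
    |f j - f k| ≤ ∑ i ∈ Finset.range J, |f ((i : ℤ) + 1) - f i| := by
  have key : ∀ m n : ℕ, m ≤ n → n < J →
      |f m - f n| ≤ ∑ i ∈ Finset.range J, |f ((i : ℤ) + 1) - f i| := by
    intro m n hmn hn
    have h := dist_le_Ico_sum_dist (fun i : ℕ => f i) hmn
    simp only [Real.dist_eq] at h
    refine h.trans ?_
    have : ∀ i : ℕ, |f i - f ((i + 1 : ℕ) : ℤ)| = |f ((i : ℤ) + 1) - f i| := fun i => by
      push_cast; exact abs_sub_comm _ _
    simp only [this]
    refine Finset.sum_le_sum_of_subset_of_nonneg ?_ fun _ _ _ => abs_nonneg _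
    intro i hi
    simp only [Finset.mem_Ico, Finset.mem_range] at hi ⊢
    omega
  obtain ⟨m, hm, h1⟩ := exists_nat_of_periodic hJ j
  obtain ⟨n, hn, h2⟩ := exists_nat_of_periodic hJ k
  rw [h1 f hf, h2 f hf]
  rcases le_total m n with h | h
  · exact key m n h hn
  · rw [abs_sub_comm]; exact key n m h hm

/-- A value differs from any convex combination of the values by at most the total variation. -/
theorem abs_sub_average_le (hJ : 1 ≤ J) (hf : Function.Periodic f (J : ℤ)) {w : ℤ → ℝ}
    (hw : ∀ j, 0 ≤ w j) (hw1 : ∑ i ∈ Finset.range J, w (i : ℤ) = 1) (j : ℤ) :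
    |f j - ∑ i ∈ Finset.range J, w (i : ℤ) * f i|
      ≤ ∑ i ∈ Finset.range J, |f ((i : ℤ) + 1) - f i| := by
  have h1 : f j - ∑ i ∈ Finset.range J, w (i : ℤ) * f i
      = ∑ i ∈ Finset.range J, w (i : ℤ) * (f j - f i) := by
    simp only [mul_sub, Finset.sum_sub_distrib, ← Finset.sum_mul, hw1, one_mul]
  rw [h1]
  calc _ ≤ ∑ i ∈ Finset.range J, w (i : ℤ) * ∑ i ∈ Finset.range J, |f ((i : ℤ) + 1) - f i| := by
        refine (Finset.abs_sum_le_sum_abs _ _).trans (Finset.sum_le_sum fun i _ => ?_)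
        rw [abs_mul, abs_of_nonneg (hw _)]
        exact mul_le_mul_of_nonneg_left (abs_sub_le_sum_of_periodic hJ hf _ _) (hw _)
    _ = _ := by rw [← Finset.sum_mul, hw1, one_mul]

/-- Interpolation inequality for node functions on a nonuniform periodic mesh. -/
theorem sq_le_of_mesh (hJ : 1 ≤ J) (hf : Function.Periodic f (J : ℤ)) {h : ℤ → ℝ}
    (hh : Function.Periodic h (J : ℤ)) (hpos : ∀ j, 0 < h j)
    (h1 : ∑ i ∈ Finset.range J, h (i : ℤ) = 1) {l : ℝ} (hl : 0 < l) (j : ℤ) :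
    f j ^ 2 ≤ (1 + l) * ∑ i ∈ Finset.range J, (h ((i : ℤ) - 1) + h i) / 2 * f i ^ 2
      + l⁻¹ * ∑ i ∈ Finset.range J, (f ((i : ℤ) + 1) - f i) ^ 2 / h i := by
  have hh' : Function.Periodic (fun j => h (j - 1)) (J : ℤ) := fun j => by
    show h (j + J - 1) = h (j - 1)
    rw [show j + (J : ℤ) - 1 = j - 1 + J by ring, hh]
  have hsh : ∑ i ∈ Finset.range J, h ((i : ℤ) - 1) = ∑ i ∈ Finset.range J, h (i : ℤ) := by
    have := sum_periodic_shift hh'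
    simpa using this.symm
  have hw1 : ∑ i ∈ Finset.range J, (h ((i : ℤ) - 1) + h i) / 2 = 1 := by
    rw [← Finset.sum_div, Finset.sum_add_distrib, hsh, h1]; norm_num
  have hf2 : Function.Periodic (fun j => f j ^ 2) (J : ℤ) := fun j => by
    show f (j + J) ^ 2 = _; rw [hf]
  -- The total-variation bound is applied to the square of `f`; half-sums of adjacent lengths are
  -- admissible weights because they add up to one over a period.
  have key := (abs_le.1 (abs_sub_average_le hJ hf2 (w := fun i => (h (i - 1) + h i) / 2)
    (fun i => by have := hpos (i - 1); have := hpos i; positivity) hw1 j)).2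
  have h3 : ∑ i ∈ Finset.range J, |f ((i : ℤ) + 1) ^ 2 - f i ^ 2|
      ≤ ∑ i ∈ Finset.range J, (l⁻¹ * ((f ((i : ℤ) + 1) - f i) ^ 2 / h i)
          + l / 2 * (h i * f ((i : ℤ) + 1) ^ 2 + h i * f i ^ 2)) := by
    refine Finset.sum_le_sum fun i _ => ?_
    have hp := hpos (i : ℤ)
    set A := f ((i : ℤ) + 1)
    set B := f (i : ℤ)
    set k := h (i : ℤ)
    have e : l⁻¹ * ((A - B) ^ 2 / k) = (A - B) ^ 2 / (l * k) := by field_simp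
    have hlk : 0 < l * k := mul_pos hl hp
    -- Young's inequality with parameter `l * k`. The factor `l` stays free because it will depend
    -- on time in the supremum bound for the flux slope.
    have e1 : |A - B| * |A + B| ≤ (A - B) ^ 2 / (l * k) + l * k / 4 * (A + B) ^ 2 := by
      rw [← sq_abs (A - B), ← sq_abs (A + B)]
      have : |A - B| ^ 2 / (l * k) + l * k / 4 * |A + B| ^ 2 - |A - B| * |A + B|
          = (|A - B| - l * k / 2 * |A + B|) ^ 2 / (l * k) := by field_simp; ring
      have : 0 ≤ (|A - B| - l * k / 2 * |A + B|) ^ 2 / (l * k) := by positivity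
      linarith
    have e2 : |A ^ 2 - B ^ 2| = |A - B| * |A + B| := by rw [← abs_mul]; congr 1; ring
    rw [e, e2]
    have : l * k / 4 * (A + B) ^ 2 ≤ l / 2 * (k * A ^ 2 + k * B ^ 2) := by
      have : 0 ≤ l * k / 4 * (A - B) ^ 2 := by positivity
      nlinarith
    linarith
  have h4 : ∑ i ∈ Finset.range J, (h (i : ℤ) * f ((i : ℤ) + 1) ^ 2 + h i * f i ^ 2)
      = 2 * ∑ i ∈ Finset.range J, (h ((i : ℤ) - 1) + h i) / 2 * f i ^ 2 := by
    have := sum_periodic_shift (hh'.mul hf2)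
    simp only [Pi.mul_apply, add_sub_cancel_right] at this
    rw [Finset.sum_add_distrib, this, ← Finset.sum_add_distrib, Finset.mul_sum]
    refine Finset.sum_congr rfl fun i _ => by ring
  rw [Finset.sum_add_distrib, ← Finset.mul_sum, ← Finset.mul_sum, h4] at h3
  linarith

end PeriodicSums

end SemiDiscrete

namespace SemiDiscrete

/-! ### Periodic meshes, cellwise integration and piecewise affine interpolation -/

section Mesh

open MeshState Filter Topology

/-- Strictly increasing node positions, one period of which has length one. -/
structure IsMesh (J : ℕ) (a : ℤ → ℝ) : Prop where
  pos : 1 ≤ J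
  lt_succ : ∀ j, a j < a (j + 1)
  periodic : ∀ j, a (j + J) = a j + 1

variable {J : ℕ} {a v : ℤ → ℝ}

theorem IsMesh.strictMono (h : IsMesh J a) : StrictMono a := strictMono_int_of_lt_succ h.lt_succ

theorem IsMesh.add_mul (h : IsMesh J a) (j n : ℤ) : a (j + n * J) = a j + n := by
  induction n using Int.induction_on with
  | zero => simp
  | succ i ih =>
    rw [show j + ((i : ℤ) + 1) * J = j + i * J + J by ring, h.periodic, ih]; push_cast; ring
  | pred i ih =>
    have := h.periodic (j + (-(i : ℤ) - 1) * J)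
    rw [show j + (-(i : ℤ) - 1) * J + J = j + -(i : ℤ) * J by ring, ih] at this
    push_cast at this ⊢; linarith

theorem index_eq (ha : StrictMono a) {j : ℤ} {y : ℝ} (h1 : a j ≤ y) (h2 : y < a (j + 1)) :
    index a y = j := by
  have : {k : ℤ | a k ≤ y} = Iic j := by
    ext k
    simp only [mem_ofPred_eq, mem_Iic]
    refine ⟨fun hk => ?_, fun hk => (ha.monotone hk).trans h1⟩
    have := ha.lt_iff_lt.1 (hk.trans_lt h2)
    omega
  rw [index, this, csSup_Iic]

theorem IsMesh.index_mem (h : IsMesh J a) (y : ℝ) :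
    a (index a y) ≤ y ∧ y < a (index a y + 1) := by
  have hJ : (1 : ℤ) ≤ J := by exact_mod_cast h.pos
  have hne : {j : ℤ | a j ≤ y}.Nonempty := by
    refine ⟨0 + ⌊y - a 0⌋ * J, ?_⟩
    show a _ ≤ y
    rw [h.add_mul]; have := Int.floor_le (y - a 0); linarith
  have hub : ∀ k ∈ {j : ℤ | a j ≤ y}, k ≤ 0 + (⌊y - a 0⌋ + 1) * J := by
    intro k hk
    have h1 : y < a (0 + (⌊y - a 0⌋ + 1) * J) := by
      rw [h.add_mul]; push_cast; have := Int.lt_floor_add_one (y - a 0); linarith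
    exact (h.strictMono.lt_iff_lt.1 (lt_of_le_of_lt hk h1)).le
  have hbdd : BddAbove {j : ℤ | a j ≤ y} := ⟨_, hub⟩
  refine ⟨Int.csSup_mem hne hbdd, ?_⟩
  by_contra! hcon
  have := le_csSup hbdd (show index a y + 1 ∈ {j : ℤ | a j ≤ y} from hcon)
  simp only [index] at this
  omega

theorem IsMesh.index_add_one (h : IsMesh J a) (y : ℝ) : index a (y + 1) = index a y + J := by
  obtain ⟨h1, h2⟩ := h.index_mem y
  refine index_eq h.strictMono ?_ ?_
  · rw [h.periodic]; linarith
  · rw [show index a y + J + 1 = index a y + 1 + J by ring, h.periodic]; linarith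

theorem IsMesh.ae_mem_Ioo (h : IsMesh J a) :
    ∀ᵐ y : ℝ, y ∈ Ioo (a (index a y)) (a (index a y + 1)) := by
  have h1 : (range a).Countable := countable_range a
  have h2 : ∀ᵐ y : ℝ, y ∉ range a := (h1.measure_zero volume : volume (range a) = 0) |> fun hz =>
    compl_mem_ae_iff.2 hz
  filter_upwards [h2] with y hy
  obtain ⟨h3, h4⟩ := h.index_mem y
  exact ⟨lt_of_le_of_ne h3 fun e => hy ⟨_, e⟩, h4⟩

/-- Both intervals are fundamental domains for integer translations, an argument that needs no
measurability of `G`. -/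
theorem lintegral_Ioc_zero_one_of_periodic {G : ℝ → ENNReal} (hG : ∀ y, G (y + 1) = G y) (c : ℝ) :
    ∫⁻ y in Ioc (0 : ℝ) 1, G y = ∫⁻ y in Ioc c (c + 1), G y := by
  have h1 := isAddFundamentalDomain_Ioc (zero_lt_one (α := ℝ)) 0
  have h2 := isAddFundamentalDomain_Ioc (zero_lt_one (α := ℝ)) c
  rw [zero_add] at h1
  refine h1.setLIntegral_eq h2 G ?_
  rintro ⟨g, hg⟩ x
  obtain ⟨n, rfl⟩ := AddSubgroup.mem_zmultiples_iff.1 hg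
  show G (n • (1 : ℝ) + x) = G x
  have hper : Function.Periodic G (1 : ℝ) := hG
  rw [add_comm]
  exact hper.zsmul n x

/-- A function on the torus is integrated cell by cell. -/
theorem IsMesh.lintegral_le (h : IsMesh J a) {F : ℝ → ENNReal} {b : ℤ → ℝ → ENNReal}
    (hb : ∀ j y, b (j + J) (y + 1) = b j y)
    (hF : ∀ j, ∀ y ∈ Ioo (a j) (a (j + 1)), F y ≤ b j y) :
    ∫⁻ y in Ioo (0 : ℝ) 1, F y
      ≤ ∑ j ∈ Finset.range J, ∫⁻ y in Ioo (a (j : ℤ)) (a ((j : ℤ) + 1)), b j y := by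
  have h1 : ∫⁻ y in Ioo (0 : ℝ) 1, F y ≤ ∫⁻ y in Ioc (0 : ℝ) 1, b (index a y) y := by
    refine (lintegral_mono_set Ioo_subset_Ioc_self).trans (lintegral_mono_ae ?_)
    filter_upwards [ae_restrict_of_ae h.ae_mem_Ioo] with y hy using hF _ _ hy
  have h2 : a (J : ℤ) = a 0 + 1 := by simpa using h.periodic 0
  -- The unit interval may cut a cell in two; the period starting at the node `a 0` consists of `J`
  -- whole cells.
  rw [lintegral_Ioc_zero_one_of_periodic (fun y => by rw [h.index_add_one, hb]) (a 0), ← h2] at h1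
  refine h1.trans ?_
  have h3 : ∀ n : ℕ, ∫⁻ y in Ioc (a 0) (a (n : ℤ)), b (index a y) y
      ≤ ∑ j ∈ Finset.range n, ∫⁻ y in Ioo (a (j : ℤ)) (a ((j : ℤ) + 1)), b j y := by
    intro n
    induction n with
    | zero => simp
    | succ n ih =>
      have e : Ioc (a 0) (a ((n + 1 : ℕ) : ℤ)) = Ioc (a 0) (a (n : ℤ)) ∪ Ioc (a n) (a ((n : ℤ) + 1)) := by
        rw [Ioc_union_Ioc_eq_Ioc (h.strictMono.monotone (by positivity))
          (h.strictMono.monotone (by omega))]; push_cast; rfl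
      rw [e, Finset.sum_range_succ]
      refine (lintegral_union_le _ _ _).trans (add_le_add ih ?_)
      rw [← restrict_Ioo_eq_restrict_Ioc]
      refine setLIntegral_mono_ae' measurableSet_Ioo (ae_of_all _ fun y hy => ?_)
      rw [index_eq h.strictMono hy.1.le hy.2]
  exact h3 J

theorem IsMesh.lintegral_const_le (h : IsMesh J a) {F : ℝ → ℝ} {b : ℤ → ℝ}
    (hb : Function.Periodic b (J : ℤ)) (hb0 : ∀ j, 0 ≤ b j)
    (hF : ∀ j, ∀ y ∈ Ioo (a j) (a (j + 1)), F y ≤ b j) :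
    ∫⁻ y in Ioo (0 : ℝ) 1, ENNReal.ofReal (F y)
      ≤ ENNReal.ofReal (∑ j ∈ Finset.range J, b (j : ℤ) * (a ((j : ℤ) + 1) - a j)) := by
  refine (h.lintegral_le (b := fun j _ => ENNReal.ofReal (b j)) (fun j y => by rw [hb])
    fun j y hy => ENNReal.ofReal_le_ofReal (hF j y hy)).trans ?_
  rw [ENNReal.ofReal_sum_of_nonneg fun j _ =>
    mul_nonneg (hb0 _) (sub_nonneg.2 (h.lt_succ _).le)]
  refine Finset.sum_le_sum fun j _ => ?_
  rw [setLIntegral_const, Real.volume_Ioo, ENNReal.ofReal_mul (hb0 _)]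

/-- The function that is affine between consecutive nodes `a j` and takes there the values `v j`. -/
noncomputable def interp (a v : ℤ → ℝ) (y : ℝ) : ℝ :=
  let j := index a y
  (y - a j) / (a (j + 1) - a j) * v (j + 1) + (a (j + 1) - y) / (a (j + 1) - a j) * v j

theorem interp_eq (ha : StrictMono a) {j : ℤ} {y : ℝ} (h1 : a j ≤ y) (h2 : y < a (j + 1)) :
    interp a v y = (y - a j) / (a (j + 1) - a j) * v (j + 1)
      + (a (j + 1) - y) / (a (j + 1) - a j) * v j := by
  simp only [interp, index_eq ha h1 h2]

theorem hasDerivAt_affine (p q α β h y : ℝ) :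
    HasDerivAt (fun y => (y - p) / h * β + (q - y) / h * α) ((β - α) / h) y := by
  have h1 := ((((hasDerivAt_id y).sub_const p).div_const h).mul_const β).add
    ((((hasDerivAt_id y).const_sub q).div_const h).mul_const α)
  refine h1.congr_deriv ?_
  ring

theorem hasDerivAt_interp (ha : StrictMono a) {j : ℤ} {y : ℝ} (hy : y ∈ Ioo (a j) (a (j + 1))) :
    HasDerivAt (interp a v) ((v (j + 1) - v j) / (a (j + 1) - a j)) y := by
  refine (hasDerivAt_affine (a j) (a (j + 1)) (v j) (v (j + 1)) (a (j + 1) - a j) y).congr_of_eventuallyEq ?_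
  filter_upwards [Ioo_mem_nhds hy.1 hy.2] with z hz using interp_eq ha hz.1.le hz.2

/-- This covers the nodes too: where the interpolant is differentiable, its derivative is the
right-hand one, which is the slope of the cell to the right; elsewhere `deriv` is zero. Hence a
supremum over all points sees only genuine slopes. -/
theorem IsMesh.exists_abs_deriv_interp_le (h : IsMesh J a) (v : ℤ → ℝ) (y : ℝ) :
    ∃ j, |deriv (interp a v) y| ≤ |(v (j + 1) - v j) / (a (j + 1) - a j)| := by
  obtain ⟨h1, h2⟩ := h.index_mem y
  set j := index a y
  refine ⟨j, ?_⟩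
  by_cases hd : DifferentiableAt ℝ (interp a v) y
  · have e : HasDerivWithinAt (interp a v) ((v (j + 1) - v j) / (a (j + 1) - a j)) (Ici y) y := by
      refine (hasDerivAt_affine (a j) (a (j + 1)) (v j) (v (j + 1))
        (a (j + 1) - a j) y).hasDerivWithinAt.congr_of_eventuallyEq ?_
        (interp_eq h.strictMono h1 h2)
      filter_upwards [Ico_mem_nhdsGE h2] with z hz
        using interp_eq h.strictMono (h1.trans hz.1) hz.2
    rw [(uniqueDiffWithinAt_Ici y).eq_deriv _ hd.hasDerivAt.hasDerivWithinAt e]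
  · rw [deriv_zero_of_not_differentiableAt hd, abs_zero]; exact abs_nonneg _

/-- At a fixed point, the time derivative is the interpolation of the nodal values `v' - slope *
a'`: the derivative following the node minus the transport by the moving mesh. A point inside a cell
stays in that cell for nearby times. -/
theorem hasDerivAt_interp_time {A V : ℝ → ℤ → ℝ} {a' v' : ℤ → ℝ} {t y : ℝ} {j : ℤ}
    (hA : ∀ᶠ τ in 𝓝 t, StrictMono (A τ))
    (ha : ∀ k, HasDerivAt (fun τ => A τ k) (a' k) t)
    (hv : ∀ k, HasDerivAt (fun τ => V τ k) (v' k) t)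
    (hy : y ∈ Ioo (A t j) (A t (j + 1))) :
    HasDerivAt (fun τ => interp (A τ) (V τ) y)
      ((y - A t j) / (A t (j + 1) - A t j)
          * (v' (j + 1) - (V t (j + 1) - V t j) / (A t (j + 1) - A t j) * a' (j + 1))
        + (A t (j + 1) - y) / (A t (j + 1) - A t j)
          * (v' j - (V t (j + 1) - V t j) / (A t (j + 1) - A t j) * a' j)) t := by
  have hne : A t (j + 1) - A t j ≠ 0 := (sub_pos.2 (hy.1.trans hy.2)).ne'
  have h1 := ((((ha j).const_sub y).div ((ha (j + 1)).sub (ha j)) hne).mul (hv (j + 1))).add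
    ((((ha (j + 1)).sub_const y).div ((ha (j + 1)).sub (ha j)) hne).mul (hv j))
  refine (h1.congr_of_eventuallyEq ?_).congr_deriv ?_
  · filter_upwards [hA, (ha j).continuousAt.eventually_lt continuousAt_const hy.1,
      continuousAt_const.eventually_lt (ha (j + 1)).continuousAt hy.2] with τ h1 h2 h3
    exact interp_eq h1 h2.le h3
  · simp only [Pi.sub_apply, Pi.div_apply]
    field_simp
    ring

theorem sq_convex_le {θ α β : ℝ} (h0 : 0 ≤ θ) (h1 : θ ≤ 1) :
    (θ * α + (1 - θ) * β) ^ 2 ≤ θ * α ^ 2 + (1 - θ) * β ^ 2 := by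
  nlinarith [mul_nonneg (mul_nonneg h0 (sub_nonneg.2 h1)) (sq_nonneg (α - β))]

theorem sq_affine_le {p q α β y : ℝ} (hy : y ∈ Icc p q) (hpq : p < q) :
    ((y - p) / (q - p) * α + (q - y) / (q - p) * β) ^ 2
      ≤ (y - p) / (q - p) * α ^ 2 + (q - y) / (q - p) * β ^ 2 := by
  have hq : 0 < q - p := sub_pos.2 hpq
  have e : (q - y) / (q - p) = 1 - (y - p) / (q - p) := by field_simp; ring
  rw [e]
  refine sq_convex_le (div_nonneg (sub_nonneg.2 hy.1) hq.le) ?_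
  rw [div_le_one hq]; linarith [hy.2]

theorem sq_affine_le_add {p q α β y : ℝ} (hy : y ∈ Icc p q) (hpq : p < q) :
    ((y - p) / (q - p) * α + (q - y) / (q - p) * β) ^ 2 ≤ α ^ 2 + β ^ 2 := by
  have hq : 0 < q - p := sub_pos.2 hpq
  refine (sq_affine_le hy hpq).trans (add_le_add ?_ ?_)
  · exact mul_le_of_le_one_left (sq_nonneg _) ((div_le_one hq).2 (by linarith [hy.2]))
  · exact mul_le_of_le_one_left (sq_nonneg _) ((div_le_one hq).2 (by linarith [hy.1]))

theorem lintegral_affine {p q α β : ℝ} (hpq : p < q) (hα : 0 ≤ α) (hβ : 0 ≤ β) :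
    ∫⁻ y in Ioo p q, ENNReal.ofReal ((y - p) / (q - p) * α + (q - y) / (q - p) * β)
      = ENNReal.ofReal ((q - p) * ((α + β) / 2)) := by
  have hq : 0 < q - p := sub_pos.2 hpq
  have hc : Continuous fun y : ℝ => (y - p) / (q - p) * α + (q - y) / (q - p) * β := by fun_prop
  rw [← ofReal_integral_eq_lintegral_ofReal]
  · rw [← integral_Ioc_eq_integral_Ioo, ← intervalIntegral.integral_of_le hpq.le]
    congr 1
    have hd : ∀ y ∈ uIcc p q, HasDerivAt
        (fun y => (y - p) ^ 2 / (2 * (q - p)) * α - (q - y) ^ 2 / (2 * (q - p)) * β)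
        ((y - p) / (q - p) * α + (q - y) / (q - p) * β) y := by
      intro y _
      have h1 := (((((hasDerivAt_id y).sub_const p).pow 2).div_const (2 * (q - p))).mul_const α).sub
        (((((hasDerivAt_id y).const_sub q).pow 2).div_const (2 * (q - p))).mul_const β)
      refine h1.congr_deriv ?_
      simp only [id]
      field_simp
      ring
    rw [intervalIntegral.integral_eq_sub_of_hasDerivAt hd (hc.intervalIntegrable _ _)]
    field_simp
    ring
  · exact (hc.integrableOn_Icc (a := p) (b := q)).mono_set Ioo_subset_Icc_self
  · filter_upwards [ae_restrict_mem measurableSet_Ioo] with y hy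
    have := hy.1; have := hy.2
    have h1 : 0 ≤ (y - p) / (q - p) := div_nonneg (by linarith) hq.le
    have h2 : 0 ≤ (q - y) / (q - p) := div_nonneg (by linarith) hq.le
    show (0 : ℝ) ≤ _
    positivity

end Mesh

/-! ### Bound functions of time and differential inequalities on the half-line -/

section Time

/-- For each time there is a bound up to that time: then there is a bound function. -/
theorem exists_isBoundFunction {P : ℝ → ℝ → Prop} (hP : ∀ t c c', c ≤ c' → P t c → P t c')
    (h : ∀ T : ℝ, 0 ≤ T → ∃ c, ∀ t ∈ Icc 0 T, P t c) :
    ∃ C : ℝ → ℝ, IsBoundFunction C ∧ ∀ t, 0 ≤ t → P t (C t) := by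
  choose b hb using fun n : ℕ => h n (Nat.cast_nonneg n)
  -- A monotone step function that dominates the bound belonging to the next integer time.
  set F : ℝ → ℝ := fun t => ∑ k ∈ Finset.range (⌈t⌉₊ + 1), |b k| with hF
  have hmono : Monotone F := by
    intro s t hst
    refine Finset.sum_le_sum_of_subset_of_nonneg ?_ fun _ _ _ => abs_nonneg _
    intro i hi
    have := Nat.ceil_mono hst
    simp only [Finset.mem_range] at hi ⊢
    omega
  have hF0 : ∀ t, 0 ≤ F t := fun t => Finset.sum_nonneg fun _ _ => abs_nonneg _
  have hint : ∀ p q, IntervalIntegrable F volume p q := fun p q => hmono.intervalIntegrable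
  have hint' : ∀ t, IntervalIntegrable (fun x => F (t + x)) volume 0 1 := fun t =>
    (show Monotone fun x => F (t + x) from fun x y hxy => hmono (by linarith)).intervalIntegrable
  have hle : ∀ t, F t ≤ ∫ x in (0 : ℝ)..1, F (t + x) := fun t => by
    calc F t = ∫ x in (0 : ℝ)..1, F t := by simp
      _ ≤ _ := intervalIntegral.integral_mono_on zero_le_one (by simp) (hint' t)
          fun x hx => hmono (by linarith [hx.1])
  -- Averaging over `[t, t + 1]` makes the step function continuous and, by monotonicity, does not
  -- go below `F t`; the summand `t + 1` gives strict growth and positivity.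
  refine ⟨fun t => t + 1 + ∫ x in (0 : ℝ)..1, F (t + x), ⟨?_, ?_, ?_⟩, ?_⟩
  · have e : (fun t => t + 1 + ∫ x in (0 : ℝ)..1, F (t + x))
        = fun t => t + 1 + ((∫ x in (0 : ℝ)..(t + 1), F x) - ∫ x in (0 : ℝ)..t, F x) := by
      ext t
      rw [intervalIntegral.integral_interval_sub_left (hint _ _) (hint _ _),
        intervalIntegral.integral_comp_add_left]
      simp
    rw [e]
    have hc := intervalIntegral.continuous_primitive hint 0
    exact Continuous.continuousOn (by fun_prop)
  · intro s _ t _ hst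
    have := intervalIntegral.integral_mono_on zero_le_one (hint' s) (hint' t)
      fun x _ => hmono (by linarith : s + x ≤ t + x)
    simp only
    linarith
  · intro t ht
    have := (hF0 t).trans (hle t)
    linarith
  · intro t ht
    have h1 : b ⌈t⌉₊ ≤ F t := (le_abs_self _).trans
      (Finset.single_le_sum (f := fun k => |b k|) (fun _ _ => abs_nonneg _) (by simp))
    refine hP _ _ _ ?_ (hb ⌈t⌉₊ t ⟨ht, Nat.le_ceil t⟩)
    linarith [hle t]

variable {f f' g : ℝ → ℝ} {T : ℝ}

theorem continuousOn_of_hasDeriv (hf : ∀ t, 0 ≤ t → HasDerivWithinAt f (f' t) (Ici 0) t) :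
    ContinuousOn f (Ici 0) := fun t ht => (hf t ht).continuousWithinAt

theorem le_of_hasDeriv_nonpos (hf : ∀ t, 0 ≤ t → HasDerivWithinAt f (f' t) (Ici 0) t)
    (h : ∀ t ∈ Icc 0 T, f' t ≤ 0) {t : ℝ} (ht : t ∈ Icc 0 T) : f t ≤ f 0 := by
  have := antitoneOn_of_hasDerivWithinAt_nonpos (convex_Icc 0 T) (f := f) (f' := f')
    ((continuousOn_of_hasDeriv hf).mono Icc_subset_Ici_self)
    (fun x hx => (hf x (interior_subset hx).1).mono (interior_subset.trans Icc_subset_Ici_self))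
    (fun x hx => h x (interior_subset hx))
  exact this ⟨le_rfl, ht.1.trans ht.2⟩ ht ht.1

theorem eq_of_hasDeriv_zero (hf : ∀ t, 0 ≤ t → HasDerivWithinAt f 0 (Ici 0) t) {t : ℝ}
    (ht : 0 ≤ t) : f t = f 0 := by
  refine le_antisymm (le_of_hasDeriv_nonpos (T := t) hf (fun _ _ => le_rfl) ⟨ht, le_rfl⟩) ?_
  have := le_of_hasDeriv_nonpos (T := t) (fun s hs => (hf s hs).neg) (by simp) ⟨ht, le_rfl⟩
  simp only [Pi.neg_apply] at this
  linarith

/-- A dissipation rate has bounded integral. -/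
theorem lintegral_le_of_hasDeriv (hf : ∀ t, 0 ≤ t → HasDerivWithinAt f (f' t) (Ici 0) t)
    (hg : ContinuousOn g (Ici 0)) (hg0 : ∀ t, 0 ≤ t → 0 ≤ g t)
    (h : ∀ t ∈ Icc 0 T, f' t ≤ - g t) {t : ℝ} (ht : t ∈ Icc 0 T) :
    ∫⁻ τ in Ioo 0 t, ENNReal.ofReal (g τ) ≤ ENNReal.ofReal (f 0 - f t) := by
  have hi : IntegrableOn g (Icc 0 t) := (hg.mono fun x hx => hx.1).integrableOn_Icc
  have hc := ((continuousOn_of_hasDeriv hf).mono fun x (hx : x ∈ Icc 0 t) => hx.1).neg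
  have key := intervalIntegral.integral_le_sub_of_hasDeriv_right_of_le ht.1 hc
    (g' := fun τ => - f' τ) (φ := g)
    (fun τ hτ => ((hf τ hτ.1.le).neg).mono (fun z hz => hτ.1.le.trans (le_of_lt hz))) hi
    (fun τ hτ => by linarith [h τ ⟨hτ.1.le, hτ.2.le.trans ht.2⟩])
  rw [← ofReal_integral_eq_lintegral_ofReal (hi.mono_set Ioo_subset_Icc_self)]
  · refine ENNReal.ofReal_le_ofReal ?_
    rw [← integral_Ioc_eq_integral_Ioo, ← intervalIntegral.integral_of_le ht.1]
    simp only [Pi.neg_apply] at key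
    linarith
  · filter_upwards [ae_restrict_mem measurableSet_Ioo] with τ hτ using hg0 τ hτ.1.le

end Time

end SemiDiscrete

namespace SemiDiscrete

/-! ### Consequences of the constitutive assumptions -/

section Laws

open Filter Topology

variable {p : ℝ → ℝ → ℝ} {μ : ℝ → ℝ} {cLo cHi : ℝ}

namespace ConstitutiveLaws

theorem continuousOn_pressure (laws : ConstitutiveLaws p μ cLo cHi) {c : ℝ}
    (hc : c ∈ Icc cLo cHi) : ContinuousOn (p c) (Ici 0) :=
  laws.p_smooth.continuousOn.comp (f := fun r : ℝ => (c, r)) (by fun_prop) fun _ hr => ⟨hc, hr⟩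

theorem hasDerivAt_pressure (laws : ConstitutiveLaws p μ cLo cHi) {c ρ : ℝ}
    (hc : c ∈ Icc cLo cHi) (hρ : 0 < ρ) : HasDerivAt (p c) (deriv (p c) ρ) ρ := by
  have h1 : ContDiffOn ℝ 1 (p c) (Ici 0) :=
    laws.p_smooth.comp (f := fun r : ℝ => (c, r)) (by fun_prop) fun _ hr => ⟨hc, hr⟩
  exact ((h1.contDiffAt (Ici_mem_nhds hρ)).differentiableAt (by simp)).hasDerivAt

theorem exists_pressure_le (laws : ConstitutiveLaws p μ cLo cHi) (R : ℝ) :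
    ∃ P : ℝ, 0 ≤ P ∧ ∀ c ∈ Icc cLo cHi, ∀ ρ ∈ Icc 0 R, p c ρ ≤ P := by
  have hK : IsCompact (Icc cLo cHi ×ˢ Icc 0 R) := isCompact_Icc.prod isCompact_Icc
  obtain ⟨P, hP⟩ := hK.bddAbove_image
    (laws.p_smooth.continuousOn.mono (prod_mono_right fun r (hr : r ∈ Icc 0 R) => hr.1))
  refine ⟨max P 0, le_max_right _ _, fun c hc ρ hρ => le_max_of_le_left ?_⟩
  exact hP (mem_image_of_mem (fun z : ℝ × ℝ => p z.1 z.2) (mk_mem_prod hc hρ))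

/-- A function that is `C¹` on a convex set is locally Lipschitz up to the boundary, and a Lipschitz
constant bounds the partial derivative at every positive density; compactness makes the constant
global. The argument also covers `ρ` near zero and a degenerate color interval. -/
theorem exists_abs_deriv_pressure_le (laws : ConstitutiveLaws p μ cLo cHi) (R : ℝ) :
    ∃ L : ℝ, 0 ≤ L ∧ ∀ c ∈ Icc cLo cHi, ∀ ρ ∈ Ioc 0 R, |deriv (p c) ρ| ≤ L := by
  have hK : IsCompact (Icc cLo cHi ×ˢ Icc 0 R) := isCompact_Icc.prod isCompact_Icc
  have key : ∃ L : ℝ, ∀ z ∈ Icc cLo cHi ×ˢ Icc 0 R, 0 < z.2 → |deriv (p z.1) z.2| ≤ L := by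
    refine hK.induction_on
      (p := fun s => ∃ L : ℝ, ∀ z ∈ s, 0 < z.2 → |deriv (p z.1) z.2| ≤ L) ⟨0, by simp⟩
      (fun s t hst ⟨L, hL⟩ => ⟨L, fun z hz => hL z (hst hz)⟩)
      (fun s t ⟨L, hL⟩ ⟨L', hL'⟩ => ⟨max L L', fun z hz h0 => ?_⟩) fun z hz => ?_
    · rcases hz with hz | hz
      · exact le_max_of_le_left (hL z hz h0)
      · exact le_max_of_le_right (hL' z hz h0)
    · have hz' : z ∈ Icc cLo cHi ×ˢ Ici (0 : ℝ) := ⟨hz.1, hz.2.1⟩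
      obtain ⟨L, t, ht, hlip⟩ := (laws.p_smooth z hz').exists_lipschitzOnWith
        ((convex_Icc _ _).prod (convex_Ici _))
      obtain ⟨U, hU, hzU, hUt⟩ := mem_nhdsWithin.1 ht
      refine ⟨U ∩ (Icc cLo cHi ×ˢ Icc 0 R), ?_, L, ?_⟩
      · rw [inter_comm]; exact inter_mem_nhdsWithin _ (hU.mem_nhds hzU)
      · rintro ⟨c, ρ⟩ ⟨hw, hc, -⟩ (h0 : 0 < ρ)
        have hn : (fun r : ℝ => (c, r)) ⁻¹' U ∩ Ioi 0 ∈ 𝓝 ρ :=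
          inter_mem ((hU.preimage (by fun_prop)).mem_nhds hw) (Ioi_mem_nhds h0)
        rw [← Real.norm_eq_abs]
        refine norm_deriv_le_of_lipschitzOn (f := p c) hn (C := L) ?_
        intro r hr r' hr'
        have h1 := hlip (x := (c, r)) (hUt ⟨hr.1, hc, (mem_Ioi.1 hr.2).le⟩) (y := (c, r'))
          (hUt ⟨hr'.1, hc, (mem_Ioi.1 hr'.2).le⟩)
        simpa [Prod.edist_eq] using h1
  obtain ⟨L, hL⟩ := key
  exact ⟨max L 0, le_max_right _ _, fun c hc ρ hρ =>
    le_max_of_le_left (hL (c, ρ) ⟨hc, hρ.1.le, hρ.2⟩ hρ.1)⟩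

theorem exists_viscosity_bounds (laws : ConstitutiveLaws p μ cLo cHi) :
    ∃ lo hi : ℝ, 0 < lo ∧ 0 < hi ∧ ∀ c ∈ Icc cLo cHi, lo ≤ μ c ∧ μ c ≤ hi := by
  obtain ⟨lo, hlo, h⟩ := laws.μ_pos
  obtain ⟨hi, hhi⟩ := isCompact_Icc.bddAbove_image laws.μ_smooth.continuousOn
  exact ⟨lo, max hi 1, hlo, lt_max_of_lt_right one_pos, fun c hc =>
    ⟨h c hc, le_max_of_le_left (hhi (mem_image_of_mem _ hc))⟩⟩

theorem hasDerivAt_integral (laws : ConstitutiveLaws p μ cLo cHi) {c ρ : ℝ}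
    (hc : c ∈ Icc cLo cHi) (hρ : 0 < ρ) :
    HasDerivAt (fun r => ∫ s in (1 : ℝ)..r, p c s / s ^ 2) (p c ρ / ρ ^ 2) ρ := by
  have hcont : ContinuousOn (fun s => p c s / s ^ 2) (Ioi 0) :=
    ((laws.continuousOn_pressure hc).mono Ioi_subset_Ici_self).div (by fun_prop)
      fun s hs => pow_ne_zero 2 (ne_of_gt hs)
  refine intervalIntegral.integral_hasDerivAt_right ?_ ?_ (hcont.continuousAt (Ioi_mem_nhds hρ))
  · refine (hcont.mono ?_).intervalIntegrable
    intro s hs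
    exact lt_of_lt_of_le (lt_min one_pos hρ) hs.1
  · exact hcont.stronglyMeasurableAtFilter isOpen_Ioi _ hρ

theorem isInternalEnergy_potential (laws : ConstitutiveLaws p μ cLo cHi) :
    IsInternalEnergy p cLo cHi fun ρ c => potential p c ρ := by
  intro c hc ρ hρ
  refine ⟨_, (hasDerivAt_id ρ).mul (laws.hasDerivAt_integral hc hρ), ?_⟩
  simp only [potential, id]
  field_simp
  ring

/-- For `ρ ≥ 1` the integral is nonnegative. For `ρ ≤ 1` the function `∫_1^r p/s² + P/r` has
derivative `(p - P)/r² ≤ 0` and equals `P` at `r = 1`, so it is at least `P` at `ρ`; multiply by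
`ρ`. -/
theorem neg_le_potential (laws : ConstitutiveLaws p μ cLo cHi) {P : ℝ} (hP0 : 0 ≤ P)
    (hP : ∀ c ∈ Icc cLo cHi, ∀ ρ ∈ Icc (0 : ℝ) 1, p c ρ ≤ P) {c ρ : ℝ}
    (hc : c ∈ Icc cLo cHi) (hρ : 0 < ρ) : - P ≤ potential p c ρ := by
  rcases le_total 1 ρ with h1 | h1
  · have : 0 ≤ ∫ s in (1 : ℝ)..ρ, p c s / s ^ 2 := intervalIntegral.integral_nonneg h1 fun s hs =>
      div_nonneg (laws.p_nonneg c hc s (by linarith [hs.1])) (sq_nonneg s)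
    have : 0 ≤ potential p c ρ := mul_nonneg hρ.le this
    linarith
  · have hd : ∀ r ∈ Icc ρ 1, HasDerivAt (fun r => (∫ s in (1 : ℝ)..r, p c s / s ^ 2) + P / r)
        ((p c r - P) / r ^ 2) r := by
      intro r hr
      have hr0 : 0 < r := lt_of_lt_of_le hρ hr.1
      refine ((laws.hasDerivAt_integral hc hr0).add
        ((hasDerivAt_const r P).div (hasDerivAt_id r) hr0.ne')).congr_deriv ?_
      simp only [id]
      field_simp
      ring
    have hanti := antitoneOn_of_hasDerivWithinAt_nonpos (convex_Icc ρ 1)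
      (fun r hr => (hd r hr).continuousAt.continuousWithinAt)
      (fun r hr => (hd r (interior_subset hr)).hasDerivWithinAt) (fun r hr => by
        have hr := interior_subset hr
        exact div_nonpos_of_nonpos_of_nonneg
          (sub_nonpos.2 (hP c hc r ⟨(hρ.trans_le hr.1).le, hr.2⟩)) (sq_nonneg r))
    have h2 := hanti ⟨le_rfl, h1⟩ ⟨h1, le_rfl⟩ h1
    simp only [intervalIntegral.integral_same, zero_add, div_one] at h2
    have h3 := mul_le_mul_of_nonneg_left h2 hρ.le
    have h4 : ρ * ((∫ s in (1 : ℝ)..ρ, p c s / s ^ 2) + P / ρ) = potential p c ρ + P := by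
      rw [potential]; field_simp
    have : 0 ≤ ρ * P := by positivity
    linarith

theorem exists_potential_le (laws : ConstitutiveLaws p μ cLo cHi) {ρLo : ℝ} (hρLo : 0 < ρLo)
    (ρHi : ℝ) : ∃ e : ℝ, 0 ≤ e ∧ ∀ c ∈ Icc cLo cHi, ∀ ρ ∈ Icc ρLo ρHi, potential p c ρ ≤ e := by
  obtain ⟨P, hP0, hP⟩ := laws.exists_pressure_le (max 1 ρHi)
  set l := min 1 ρLo with hl
  have hl0 : 0 < l := lt_min one_pos hρLo
  refine ⟨|ρHi| * (P / l ^ 2 * (1 + |ρHi|)), by positivity, fun c hc ρ hρ => ?_⟩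
  have hρ0 : 0 < ρ := hρLo.trans_le hρ.1
  have hρ1 : ρ ≤ |ρHi| := hρ.2.trans (le_abs_self _)
  have h1 : ‖∫ s in (1 : ℝ)..ρ, p c s / s ^ 2‖ ≤ P / l ^ 2 * |ρ - 1| := by
    refine intervalIntegral.norm_integral_le_of_norm_le_const fun s hs => ?_
    have hs' : s ∈ uIcc 1 ρ := uIoc_subset_uIcc hs
    have h2 : l ≤ s := le_trans (min_le_min_left 1 hρ.1) hs'.1
    have h3 : s ≤ max 1 ρHi := hs'.2.trans (max_le_max_left 1 hρ.2)
    have h4 := laws.p_nonneg c hc s (hl0.le.trans h2)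
    rw [Real.norm_of_nonneg (by positivity)]
    have := hP c hc s ⟨hl0.le.trans h2, h3⟩
    gcongr
  have h5 : |ρ - 1| ≤ 1 + |ρHi| := by
    rw [abs_le]; constructor <;> linarith [abs_nonneg ρHi]
  rw [potential]
  have h6 : ∫ s in (1 : ℝ)..ρ, p c s / s ^ 2 ≤ P / l ^ 2 * (1 + |ρHi|) :=
    (le_abs_self _).trans (h1.trans (mul_le_mul_of_nonneg_left h5 (by positivity)))
  by_cases h7 : 0 ≤ ∫ s in (1 : ℝ)..ρ, p c s / s ^ 2
  · exact mul_le_mul hρ1 h6 h7 (abs_nonneg _)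
  · exact (mul_nonpos_of_nonneg_of_nonpos hρ0.le (not_le.1 h7).le).trans (by positivity)

/-- The growth condition, extended to all positive densities: below density one the pressure is
bounded, and adding `P` keeps the right-hand side positive. Integrated in space, it controls the
pressure by mass and energy. -/
theorem exists_pressure_le_potential (laws : ConstitutiveLaws p μ cLo cHi) :
    ∃ P C₀ : ℝ, 0 ≤ P ∧ 0 ≤ C₀ ∧ ∀ c ∈ Icc cLo cHi, ∀ ρ : ℝ, 0 < ρ →
      - P ≤ potential p c ρ ∧ p c ρ ≤ C₀ * (1 + ρ + potential p c ρ + P) := by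
  obtain ⟨P, hP0, hP⟩ := laws.exists_pressure_le 1
  obtain ⟨C₀, hC0, hC⟩ := laws.growth
  refine ⟨P, C₀ + P, hP0, by positivity, fun c hc ρ hρ => ?_⟩
  have h1 := laws.neg_le_potential hP0 hP hc hρ
  refine ⟨h1, ?_⟩
  have h2 : 0 ≤ P * (ρ + potential p c ρ + P) := mul_nonneg hP0 (by linarith)
  have h3 : 0 ≤ C₀ * (ρ + potential p c ρ + P) := mul_nonneg hC0.le (by linarith)
  rcases le_total 1 ρ with h | h
  · have := hC c hc ρ h
    have : 0 ≤ C₀ * P := by positivity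
    nlinarith
  · have := hP c hc ρ ⟨hρ.le, h⟩
    nlinarith

end ConstitutiveLaws

end Laws

end SemiDiscrete

namespace SemiDiscrete

/-! ### Discrete quantities, their periodicity and positivity -/

namespace MeshState

variable {J : ℕ} (p : ℝ → ℝ → ℝ) (μ : ℝ → ℝ) (s : MeshState J)

/-- The mass attached to the node `x_{j-1/2}`. -/
noncomputable def nodeMass (j : ℤ) : ℝ := (s.ρ (j - 1) * s.dx (j - 1) + s.ρ j * s.dx j) / 2

/-- The difference quotient of a node function on cell `j`. -/
noncomputable def grad (f : ℤ → ℝ) (j : ℤ) : ℝ := (f (j + 1) - f j) / s.dx j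

/-- The acceleration of the node `x_{j-1/2}` prescribed by the momentum equation. -/
noncomputable def acc (j : ℤ) : ℝ := (s.flux p μ j - s.flux p μ (j - 1)) / s.nodeMass j

/-- The time derivative of the effective flux along a solution. -/
noncomputable def fluxDot (j : ℤ) : ℝ :=
  μ (s.c j) * (s.grad (s.acc p μ) j - s.gradU j ^ 2)
    + deriv (p (s.c j)) (s.ρ j) * (s.ρ j * s.gradU j)

/-- The viscous dissipation. -/
noncomputable def diss : ℝ :=
  ∑ j ∈ Finset.range J, μ (s.c (j : ℤ)) * s.gradU (j : ℤ) ^ 2 * s.dx (j : ℤ)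

/-- The weighted square norm of the acceleration. -/
noncomputable def accSq : ℝ :=
  ∑ j ∈ Finset.range J, s.nodeMass (j : ℤ) * s.acc p μ (j : ℤ) ^ 2

/-- The viscous dissipation of the acceleration. -/
noncomputable def accDiss : ℝ :=
  ∑ j ∈ Finset.range J, μ (s.c (j : ℤ)) * s.grad (s.acc p μ) (j : ℤ) ^ 2 * s.dx (j : ℤ)

section Periodic

theorem add_period_add_one (j : ℤ) : j + (J : ℤ) + 1 = j + 1 + J := by ring

theorem add_period_sub_one (j : ℤ) : j + (J : ℤ) - 1 = j - 1 + J := by ring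

theorem dx_add_period (j : ℤ) : s.dx (j + J) = s.dx j := by
  simp only [dx, add_period_add_one, s.x_periodic]; ring

theorem gradU_add_period (j : ℤ) : s.gradU (j + J) = s.gradU j := by
  simp only [gradU, add_period_add_one, s.u_periodic, s.dx_add_period]

theorem flux_add_period (j : ℤ) : s.flux p μ (j + J) = s.flux p μ j := by
  simp only [flux, s.c_periodic, s.ρ_periodic, s.gradU_add_period]

theorem nodeMass_add_period (j : ℤ) : s.nodeMass (j + J) = s.nodeMass j := by
  simp only [nodeMass, add_period_sub_one, s.ρ_periodic, s.dx_add_period]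

theorem acc_add_period (j : ℤ) : s.acc p μ (j + J) = s.acc p μ j := by
  simp only [acc, add_period_sub_one, s.flux_add_period, s.nodeMass_add_period]

theorem grad_add_period {f : ℤ → ℝ} (hf : Function.Periodic f (J : ℤ)) (j : ℤ) :
    s.grad f (j + J) = s.grad f j := by
  simp only [grad, add_period_add_one, hf _, s.dx_add_period]

theorem fluxDot_add_period (j : ℤ) : s.fluxDot p μ (j + J) = s.fluxDot p μ j := by
  simp only [fluxDot, s.c_periodic, s.ρ_periodic, s.gradU_add_period,
    s.grad_add_period (s.acc_add_period p μ)]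

theorem sum_dx : ∑ j ∈ Finset.range J, s.dx (j : ℤ) = 1 := by
  have h1 := Finset.sum_range_sub (fun j : ℕ => s.x j) J
  have h2 := s.x_periodic 0
  push_cast at h1
  rw [zero_add] at h2
  simp only [dx]
  rw [h1, h2]; ring

theorem center_add_period (j : ℤ) : s.center (j + J) = s.center j + 1 := by
  simp only [center, add_period_add_one, s.x_periodic]; ring

theorem center_sub (j : ℤ) : s.center (j + 1) - s.center j = s.dxNode (j + 1) := by
  simp only [center, dxNode, dx, add_sub_cancel_right]; ring

theorem sum_nodeMass :
    ∑ j ∈ Finset.range J, s.nodeMass (j : ℤ) = ∑ j ∈ Finset.range J, s.ρ (j : ℤ) * s.dx (j : ℤ) := by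
  have h := sum_periodic_shift (J := J) (f := fun j => s.ρ (j - 1) * s.dx (j - 1)) fun j => by
    simp only [add_period_sub_one, s.ρ_periodic, s.dx_add_period]
  simp only [add_sub_cancel_right] at h
  simp only [nodeMass]
  rw [← Finset.sum_div, Finset.sum_add_distrib, ← h]; ring

/-- Integrating a node function over the dual mesh or over the cells. -/
theorem sum_node_mul {m f : ℤ → ℝ} (hm : Function.Periodic m (J : ℤ))
    (hf : Function.Periodic f (J : ℤ)) :
    ∑ j ∈ Finset.range J, (m ((j : ℤ) - 1) + m j) / 2 * f j
      = ∑ j ∈ Finset.range J, m (j : ℤ) * ((f ((j : ℤ) + 1) + f j) / 2) := by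
  have h := sum_periodic_shift (J := J) (f := fun j => m (j - 1) * f j) fun j => by
    simp only [add_period_sub_one, hm _, hf _]
  simp only [add_sub_cancel_right] at h
  have e1 : ∀ j : ℤ, (m (j - 1) + m j) / 2 * f j = 1 / 2 * (m (j - 1) * f j) + 1 / 2 * (m j * f j) :=
    fun j => by ring
  have e2 : ∀ j : ℤ, m j * ((f (j + 1) + f j) / 2)
      = 1 / 2 * (m j * f (j + 1)) + 1 / 2 * (m j * f j) := fun j => by ring
  simp only [e1, e2, Finset.sum_add_distrib, ← Finset.mul_sum, h]

end Periodic

section Ordered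

variable {s}

theorem dx_pos (hs : ∀ j : ℤ, s.x j < s.x (j + 1)) (j : ℤ) : 0 < s.dx j := sub_pos.2 (hs j)

theorem dx_le_one (hJ : 1 ≤ J) (hs : ∀ j : ℤ, s.x j < s.x (j + 1)) (j : ℤ) : s.dx j ≤ 1 := by
  rw [← s.sum_dx]
  exact le_sum_of_periodic hJ s.dx_add_period (fun j => (dx_pos hs j).le) j

theorem isMesh_x (hJ : 1 ≤ J) (hs : ∀ j : ℤ, s.x j < s.x (j + 1)) : IsMesh J s.x :=
  ⟨hJ, hs, s.x_periodic⟩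

theorem isMesh_center (hJ : 1 ≤ J) (hs : ∀ j : ℤ, s.x j < s.x (j + 1)) : IsMesh J s.center :=
  ⟨hJ, fun j => by have := hs j; have := hs (j + 1); simp only [center]; linarith,
    s.center_add_period⟩

theorem dxNode_pos (hs : ∀ j : ℤ, s.x j < s.x (j + 1)) (j : ℤ) : 0 < s.dxNode j := by
  have := dx_pos hs (j - 1); have := dx_pos hs j
  simp only [dxNode]; linarith

theorem rhoNode_mul_dxNode (hs : ∀ j : ℤ, s.x j < s.x (j + 1)) (j : ℤ) :
    s.rhoNode j * s.dxNode j = s.nodeMass j := by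
  have h1 := dx_pos hs (j - 1); have h2 := dx_pos hs j
  have : s.dx (j - 1) + s.dx j ≠ 0 := by positivity
  simp only [rhoNode, dxNode, nodeMass]
  field_simp

theorem nodeMass_pos (hs : ∀ j : ℤ, s.x j < s.x (j + 1)) (hρ : ∀ j, 0 < s.ρ j) (j : ℤ) :
    0 < s.nodeMass j := by
  have h1 := dx_pos hs (j - 1); have h2 := dx_pos hs j
  have h3 := hρ (j - 1); have h4 := hρ j
  simp only [nodeMass]; positivity

theorem grad_mul_dx (hs : ∀ j : ℤ, s.x j < s.x (j + 1)) (f : ℤ → ℝ) (j : ℤ) :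
    s.grad f j * s.dx j = f (j + 1) - f j := div_mul_cancel₀ _ (dx_pos hs j).ne'

theorem gradU_mul_dx (hs : ∀ j : ℤ, s.x j < s.x (j + 1)) (j : ℤ) :
    s.gradU j * s.dx j = s.u (j + 1) - s.u j := div_mul_cancel₀ _ (dx_pos hs j).ne'

theorem nodeMass_mul_acc (hs : ∀ j : ℤ, s.x j < s.x (j + 1)) (hρ : ∀ j, 0 < s.ρ j) (j : ℤ) :
    s.nodeMass j * s.acc p μ j = s.flux p μ j - s.flux p μ (j - 1) :=
  mul_div_cancel₀ _ (nodeMass_pos hs hρ j).ne'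

theorem energy_eq (hs : ∀ j : ℤ, s.x j < s.x (j + 1)) (H : ℝ → ℝ → ℝ) :
    s.energy H = 1 / 2 * ∑ j ∈ Finset.range J, s.nodeMass (j : ℤ) * s.u (j : ℤ) ^ 2
      + ∑ j ∈ Finset.range J, H (s.ρ (j : ℤ)) (s.c (j : ℤ)) * s.dx (j : ℤ) := by
  rw [energy, ← sum_periodic_shift (J := J) (f := fun j => s.nodeMass j * s.u j ^ 2) fun j => by
    simp only [s.nodeMass_add_period, s.u_periodic]]
  congr 2
  refine Finset.sum_congr rfl fun j _ => ?_
  rw [← rhoNode_mul_dxNode hs, sq_abs]; ring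

theorem accSq_nonneg (hs : ∀ j : ℤ, s.x j < s.x (j + 1)) (hρ : ∀ j, 0 < s.ρ j) :
    0 ≤ s.accSq p μ :=
  Finset.sum_nonneg fun _ _ => mul_nonneg (nodeMass_pos hs hρ _).le (sq_nonneg _)

/-- Abel summation moves the difference onto the flux, where it is node mass times acceleration.
This identity is the source of the dissipation of `accSq`. -/
theorem sum_flux_mul_grad_acc (hs : ∀ j : ℤ, s.x j < s.x (j + 1)) (hρ : ∀ j, 0 < s.ρ j) :
    ∑ j ∈ Finset.range J, s.flux p μ (j : ℤ) * (s.acc p μ ((j : ℤ) + 1) - s.acc p μ j)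
      = - s.accSq p μ := by
  have := sum_by_parts (s.acc_add_period p μ) (s.flux_add_period p μ)
  rw [eq_neg_iff_add_eq_zero, ← eq_neg_iff_add_eq_zero.1 this, add_comm]
  congr 1
  refine Finset.sum_congr rfl fun j _ => ?_
  rw [← nodeMass_mul_acc p μ hs hρ]; ring

end Ordered

end MeshState

/-! ### Evolution equations along a solution and the energy identity -/

/-- A global solution with admissible initial data. -/
structure IsFlow (p : ℝ → ℝ → ℝ) (μ : ℝ → ℝ) (cLo cHi ρLo ρHi K : ℝ) {J : ℕ} (s₀ : MeshState J)
    (S : ℝ → MeshState J) : Prop where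
  laws : ConstitutiveLaws p μ cLo cHi
  rho_pos : 0 < ρLo
  one_le : 1 ≤ J
  adm : s₀.Admissible cLo cHi ρLo ρHi K
  sol : IsGlobalSolution p μ s₀ S

namespace IsFlow

open MeshState

variable {p : ℝ → ℝ → ℝ} {μ : ℝ → ℝ} {cLo cHi ρLo ρHi K : ℝ} {J : ℕ} {s₀ : MeshState J}
  {S : ℝ → MeshState J} {t : ℝ}

theorem ordered (h : IsFlow p μ cLo cHi ρLo ρHi K s₀ S) (ht : 0 ≤ t) (j : ℤ) :
    (S t).x j < (S t).x (j + 1) := h.sol.ordered t ht j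

theorem color_eq (h : IsFlow p μ cLo cHi ρLo ρHi K s₀ S) (ht : 0 ≤ t) (j : ℤ) :
    (S t).c j = s₀.c j := by
  rw [← h.sol.initial]
  exact eq_of_hasDeriv_zero (f := fun τ => (S τ).c j) (fun τ hτ => h.sol.color τ hτ j) ht

theorem color_mem (h : IsFlow p μ cLo cHi ρLo ρHi K s₀ S) (ht : 0 ≤ t) (j : ℤ) :
    (S t).c j ∈ Icc cLo cHi := h.color_eq ht j ▸ h.adm.c_mem j

theorem mass_eq (h : IsFlow p μ cLo cHi ρLo ρHi K s₀ S) (ht : 0 ≤ t) (j : ℤ) :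
    (S t).ρ j * (S t).dx j = s₀.ρ j * s₀.dx j := by
  rw [← h.sol.initial]
  exact eq_of_hasDeriv_zero (f := fun τ => (S τ).ρ j * (S τ).dx j)
    (fun τ hτ => h.sol.mass τ hτ j) ht

theorem dens_pos (h : IsFlow p μ cLo cHi ρLo ρHi K s₀ S) (ht : 0 ≤ t) (j : ℤ) :
    0 < (S t).ρ j := by
  have h1 : 0 < s₀.ρ j * s₀.dx j :=
    mul_pos (h.rho_pos.trans_le (h.adm.ρ_mem j).1) (dx_pos h.adm.ordered j)
  rw [← h.mass_eq ht] at h1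
  exact pos_of_mul_pos_left h1 (dx_pos (h.ordered ht) j).le

theorem nodeMass_eq (h : IsFlow p μ cLo cHi ρLo ρHi K s₀ S) (ht : 0 ≤ t) (j : ℤ) :
    (S t).nodeMass j = s₀.nodeMass j := by
  simp only [nodeMass, h.mass_eq ht]

/-- The color is constant, so no chain rule is needed; `μ` is smooth only on the closed color
interval. -/
theorem hasDeriv_viscosity (h : IsFlow p μ cLo cHi ρLo ρHi K s₀ S) (ht : 0 ≤ t) (j : ℤ) :
    HasDerivWithinAt (fun τ => μ ((S τ).c j)) 0 (Ici 0) t :=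
  (hasDerivWithinAt_const t _ (μ (s₀.c j))).congr (fun τ hτ => by rw [h.color_eq hτ])
    (by rw [h.color_eq ht])

theorem hasDeriv_nodeMass (h : IsFlow p μ cLo cHi ρLo ρHi K s₀ S) (ht : 0 ≤ t) (j : ℤ) :
    HasDerivWithinAt (fun τ => (S τ).nodeMass j) 0 (Ici 0) t :=
  (hasDerivWithinAt_const t _ (s₀.nodeMass j)).congr (fun τ hτ => by rw [h.nodeMass_eq hτ])
    (by rw [h.nodeMass_eq ht])

theorem hasDeriv_dx (h : IsFlow p μ cLo cHi ρLo ρHi K s₀ S) (ht : 0 ≤ t) (j : ℤ) :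
    HasDerivWithinAt (fun τ => (S τ).dx j) ((S t).gradU j * (S t).dx j) (Ici 0) t := by
  rw [gradU_mul_dx (h.ordered ht)]
  exact (h.sol.position t ht (j + 1)).sub (h.sol.position t ht j)

theorem hasDeriv_rho (h : IsFlow p μ cLo cHi ρLo ρHi K s₀ S) (ht : 0 ≤ t) (j : ℤ) :
    HasDerivWithinAt (fun τ => (S τ).ρ j) (- ((S t).ρ j * (S t).gradU j)) (Ici 0) t := by
  have hd := dx_pos (h.ordered ht) j
  have e : ∀ τ, 0 ≤ τ → (S τ).ρ j = s₀.ρ j * s₀.dx j / (S τ).dx j := fun τ hτ => by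
    rw [← h.mass_eq hτ, mul_div_cancel_right₀ _ (dx_pos (h.ordered hτ) j).ne']
  refine (((hasDerivWithinAt_const t _ (s₀.ρ j * s₀.dx j)).div (h.hasDeriv_dx ht j) hd.ne').congr
    (fun τ hτ => e τ hτ) (e t ht)).congr_deriv ?_
  rw [← h.mass_eq ht]
  field_simp
  ring

theorem hasDeriv_pressure (h : IsFlow p μ cLo cHi ρLo ρHi K s₀ S) (ht : 0 ≤ t) (j : ℤ) :
    HasDerivWithinAt (fun τ => p ((S τ).c j) ((S τ).ρ j))
      (- (deriv (p ((S t).c j)) ((S t).ρ j) * ((S t).ρ j * (S t).gradU j))) (Ici 0) t := by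
  have h1 := (h.laws.hasDerivAt_pressure (h.color_mem ht j) (h.dens_pos ht j)).comp_hasDerivWithinAt
    t (h.hasDeriv_rho ht j)
  rw [← mul_neg]
  refine h1.congr (fun τ hτ => ?_) rfl
  simp only [Function.comp, h.color_eq hτ, h.color_eq ht]

theorem hasDeriv_u (h : IsFlow p μ cLo cHi ρLo ρHi K s₀ S) (ht : 0 ≤ t) (j : ℤ) :
    HasDerivWithinAt (fun τ => (S τ).u j) ((S t).acc p μ j) (Ici 0) t := by
  obtain ⟨a, h1, h2⟩ := h.sol.momentum t ht j
  refine h1.congr_deriv ?_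
  rw [rhoNode_mul_dxNode (h.ordered ht)] at h2
  rw [acc, eq_div_iff (nodeMass_pos (h.ordered ht) (h.dens_pos ht) j).ne']
  simp only [flux, gradU, sub_add_cancel]
  linarith

theorem hasDeriv_gradU (h : IsFlow p μ cLo cHi ρLo ρHi K s₀ S) (ht : 0 ≤ t) (j : ℤ) :
    HasDerivWithinAt (fun τ => (S τ).gradU j)
      ((S t).grad ((S t).acc p μ) j - (S t).gradU j ^ 2) (Ici 0) t := by
  have hd := dx_pos (h.ordered ht) j
  refine (((h.hasDeriv_u ht (j + 1)).sub (h.hasDeriv_u ht j)).div (h.hasDeriv_dx ht j)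
    hd.ne').congr_deriv ?_
  simp only [grad, gradU, Pi.sub_apply]
  field_simp

theorem hasDeriv_flux (h : IsFlow p μ cLo cHi ρLo ρHi K s₀ S) (ht : 0 ≤ t) (j : ℤ) :
    HasDerivWithinAt (fun τ => (S τ).flux p μ j) ((S t).fluxDot p μ j) (Ici 0) t := by
  refine (((h.hasDeriv_viscosity ht j).mul (h.hasDeriv_gradU ht j)).sub
    (h.hasDeriv_pressure ht j)).congr_deriv ?_
  simp only [fluxDot]
  ring

theorem hasDeriv_acc (h : IsFlow p μ cLo cHi ρLo ρHi K s₀ S) (ht : 0 ≤ t) (j : ℤ) :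
    HasDerivWithinAt (fun τ => (S τ).acc p μ j)
      (((S t).fluxDot p μ j - (S t).fluxDot p μ (j - 1)) / (S t).nodeMass j) (Ici 0) t := by
  refine (((h.hasDeriv_flux ht j).sub (h.hasDeriv_flux ht (j - 1))).div (h.hasDeriv_nodeMass ht j)
    (nodeMass_pos (h.ordered ht) (h.dens_pos ht) j).ne').congr_deriv ?_
  have := (nodeMass_pos (h.ordered ht) (h.dens_pos ht) j).ne'
  field_simp
  ring

theorem continuousOn_diss (h : IsFlow p μ cLo cHi ρLo ρHi K s₀ S) :
    ContinuousOn (fun τ => (S τ).diss μ) (Ici 0) := by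
  refine continuousOn_finsetSum _ fun j _ t ht => ?_
  exact ((h.hasDeriv_viscosity ht j).continuousWithinAt.mul
    ((h.hasDeriv_gradU ht j).continuousWithinAt.pow 2)).mul (h.hasDeriv_dx ht j).continuousWithinAt

theorem continuousOn_accSq (h : IsFlow p μ cLo cHi ρLo ρHi K s₀ S) :
    ContinuousOn (fun τ => (S τ).accSq p μ) (Ici 0) := by
  refine continuousOn_finsetSum _ fun j _ t ht => ?_
  exact (h.hasDeriv_nodeMass ht j).continuousWithinAt.mul
    ((h.hasDeriv_acc ht j).continuousWithinAt.pow 2)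

theorem continuousOn_accDiss (h : IsFlow p μ cLo cHi ρLo ρHi K s₀ S) :
    ContinuousOn (fun τ => (S τ).accDiss p μ) (Ici 0) := by
  refine continuousOn_finsetSum _ fun j _ t ht => ?_
  exact ((h.hasDeriv_viscosity ht j).continuousWithinAt.mul
    ((((h.hasDeriv_acc ht (j + 1)).continuousWithinAt.sub
      (h.hasDeriv_acc ht j).continuousWithinAt).div (h.hasDeriv_dx ht j).continuousWithinAt
        (dx_pos (h.ordered ht) j).ne').pow 2)).mul (h.hasDeriv_dx ht j).continuousWithinAt

/-- The energy identity. -/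
theorem hasDeriv_energy (h : IsFlow p μ cLo cHi ρLo ρHi K s₀ S) {H : ℝ → ℝ → ℝ}
    (hH : IsInternalEnergy p cLo cHi H) (ht : 0 ≤ t) :
    HasDerivWithinAt (fun τ => (S τ).energy H) (- (S t).diss μ) (Ici 0) t := by
  choose H' hH' hp using fun j : ℤ => hH _ (h.color_mem ht j) _ (h.dens_pos ht j)
  have h1 : ∀ j : ℤ, HasDerivWithinAt (fun τ => H ((S τ).ρ j) ((S τ).c j))
      (H' j * - ((S t).ρ j * (S t).gradU j)) (Ici 0) t := fun j => by
    refine ((hH' j).comp_hasDerivWithinAt t (h.hasDeriv_rho ht j)).congr (fun τ hτ => ?_) rfl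
    simp only [Function.comp, h.color_eq hτ, h.color_eq ht]
  have h2 := ((HasDerivWithinAt.fun_sum (u := Finset.range J) fun j _ =>
      (h.hasDeriv_nodeMass ht j).mul ((h.hasDeriv_u ht j).pow 2)).const_mul (1 / 2)).add
    (HasDerivWithinAt.fun_sum (u := Finset.range J) fun j _ => (h1 j).mul (h.hasDeriv_dx ht j))
  refine (h2.congr (fun τ hτ => ?_) ?_).congr_deriv ?_
  · exact energy_eq (h.ordered hτ) H
  · exact energy_eq (h.ordered ht) H
  · have h3 := sum_by_parts (S t).u_periodic ((S t).flux_add_period p μ)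
    have e1 : ∀ j : ℤ, (S t).u j * ((S t).flux p μ j - (S t).flux p μ (j - 1))
        = (S t).nodeMass j * (S t).u j * (S t).acc p μ j := fun j => by
      rw [← nodeMass_mul_acc p μ (h.ordered ht) (h.dens_pos ht)]; ring
    simp only [e1] at h3
    have e2 : ∑ j ∈ Finset.range J, (0 * (S t).u (j : ℤ) ^ 2
          + (S t).nodeMass j * ((2 : ℕ) * (S t).u j ^ (2 - 1) * (S t).acc p μ j))
        = 2 * ∑ j ∈ Finset.range J, (S t).nodeMass (j : ℤ) * (S t).u j * (S t).acc p μ j := by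
      rw [Finset.mul_sum]
      refine Finset.sum_congr rfl fun j _ => ?_
      push_cast; ring
    simp only [Pi.pow_apply]
    rw [e2, h3, diss, ← Finset.sum_neg_distrib, ← Finset.sum_neg_distrib, ← mul_assoc,
      Finset.mul_sum, ← Finset.sum_add_distrib]
    refine Finset.sum_congr rfl fun j _ => ?_
    rw [← gradU_mul_dx (h.ordered ht), flux]
    have := hp j
    linear_combination (-(S t).gradU j * (S t).dx j) * this

end IsFlow

end SemiDiscrete

namespace SemiDiscrete

/-! ### Uniform energy bounds and two-sided density bounds -/

namespace MeshState

variable {J : ℕ} {s : MeshState J}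

theorem diss_nonneg {μ : ℝ → ℝ} (hs : ∀ j : ℤ, s.x j < s.x (j + 1)) (hμ : ∀ j, 0 ≤ μ (s.c j)) :
    0 ≤ s.diss μ :=
  Finset.sum_nonneg fun _ _ => mul_nonneg (mul_nonneg (hμ _) (sq_nonneg _)) (dx_pos hs _).le

/-- `∑ h_j (u_{j+1/2} - u_{j-1/2})` is controlled by the dissipation if `h` is bounded. -/
theorem abs_sum_mul_sub_le {μ : ℝ → ℝ} {lo B : ℝ} (hs : ∀ j : ℤ, s.x j < s.x (j + 1))
    (hlo : 0 < lo) (hμ : ∀ j, lo ≤ μ (s.c j)) {h : ℤ → ℝ} (hh : ∀ j ∈ Finset.range J, |h j| ≤ B)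
    {ε : ℝ} (hε : 0 < ε) :
    |∑ j ∈ Finset.range J, h (j : ℤ) * (s.u ((j : ℤ) + 1) - s.u j)|
      ≤ ε * s.diss μ + B ^ 2 / (4 * ε * lo) := by
  have h1 : B ^ 2 / (4 * ε * lo) = ∑ j ∈ Finset.range J, B ^ 2 / (4 * ε * lo) * s.dx (j : ℤ) := by
    rw [← Finset.mul_sum, s.sum_dx, mul_one]
  rw [h1, diss, Finset.mul_sum, ← Finset.sum_add_distrib]
  refine (Finset.abs_sum_le_sum_abs _ _).trans (Finset.sum_le_sum fun j hj => ?_)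
  have hd := dx_pos hs (j : ℤ)
  rw [← gradU_mul_dx hs, abs_mul, abs_mul, abs_of_pos hd, ← mul_assoc]
  have h2 : ε * (μ (s.c j) * s.gradU j ^ 2 * s.dx j) + B ^ 2 / (4 * ε * lo) * s.dx j
      = (ε * (μ (s.c j) * |s.gradU j| ^ 2) + B ^ 2 / (4 * ε * lo)) * s.dx j := by
    rw [sq_abs]; ring
  rw [h2]
  refine mul_le_mul_of_nonneg_right ?_ hd.le
  set g := |s.gradU j|
  have hg : 0 ≤ g := abs_nonneg _
  have h3 : ε * (lo * g ^ 2) ≤ ε * (μ (s.c j) * g ^ 2) := by have := hμ j; gcongr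
  have h4 : |h j| * g ≤ B * g := mul_le_mul_of_nonneg_right (hh j hj) hg
  have h5 : ε * (lo * g ^ 2) + B ^ 2 / (4 * ε * lo) - B * g
      = (2 * ε * lo * g - B) ^ 2 / (4 * ε * lo) := by field_simp; ring
  have h6 : 0 ≤ (2 * ε * lo * g - B) ^ 2 / (4 * ε * lo) := by positivity
  linarith

/-- The kinetic part of the energy is bounded by the discrete `H¹` norm. -/
theorem sum_nodeMass_mul_sq_le (hJ : 1 ≤ J) (hs : ∀ j : ℤ, s.x j < s.x (j + 1)) {R : ℝ}
    (hR : 0 ≤ R) (hρ : ∀ j, s.ρ j ≤ R) :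
    ∑ j ∈ Finset.range J, s.nodeMass (j : ℤ) * s.u (j : ℤ) ^ 2 ≤ 2 * R * s.h1Sq := by
  have h1 : ∑ j ∈ Finset.range J, s.nodeMass (j : ℤ) * s.u (j : ℤ) ^ 2
      = ∑ j ∈ Finset.range J, s.ρ (j : ℤ) * s.dx j * ((s.u ((j : ℤ) + 1) ^ 2 + s.u j ^ 2) / 2) :=
    sum_node_mul (m := fun j => s.ρ j * s.dx j) (f := fun j => s.u j ^ 2)
      (fun j => by simp only [s.ρ_periodic, s.dx_add_period])
      (fun j => by simp only [s.u_periodic])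
  rw [h1, h1Sq, ← Finset.sum_add_distrib, Finset.mul_sum]
  refine Finset.sum_le_sum fun j _ => ?_
  have hd := dx_pos hs (j : ℤ)
  have hd1 := dx_le_one hJ hs (j : ℤ)
  have e := gradU_mul_dx hs (j : ℤ)
  rw [sq_abs, sq_abs]
  set g := s.gradU (j : ℤ)
  set d := s.dx (j : ℤ)
  set v := s.u ((j : ℤ) + 1)
  have e' : s.u (j : ℤ) = v - g * d := by linarith
  rw [e']
  have h2 : (g * d) ^ 2 ≤ g ^ 2 := by
    rw [mul_pow]; exact mul_le_of_le_one_right (sq_nonneg _) (pow_le_one₀ hd.le hd1)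
  have h3 : (v ^ 2 + (v - g * d) ^ 2) / 2 ≤ 2 * (v ^ 2 + g ^ 2) := by
    nlinarith [sq_nonneg (v + g * d), sq_nonneg g, sq_nonneg v]
  calc s.ρ j * d * ((v ^ 2 + (v - g * d) ^ 2) / 2)
      ≤ R * d * ((v ^ 2 + (v - g * d) ^ 2) / 2) := by have := hρ j; gcongr
    _ ≤ R * d * (2 * (v ^ 2 + g ^ 2)) := by gcongr
    _ = _ := by ring

end MeshState

namespace IsFlow

open MeshState

variable {p : ℝ → ℝ → ℝ} {μ : ℝ → ℝ} {cLo cHi ρLo ρHi K : ℝ} {J : ℕ} {s₀ : MeshState J}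
  {S : ℝ → MeshState J} {t : ℝ}

theorem sum_mass_le (h : IsFlow p μ cLo cHi ρLo ρHi K s₀ S) (ht : 0 ≤ t) :
    ∑ j ∈ Finset.range J, (S t).ρ (j : ℤ) * (S t).dx (j : ℤ) ≤ |ρHi| := by
  calc _ ≤ ∑ j ∈ Finset.range J, |ρHi| * s₀.dx (j : ℤ) := Finset.sum_le_sum fun j _ => by
        rw [h.mass_eq ht]
        exact mul_le_mul_of_nonneg_right ((h.adm.ρ_mem j).2.trans (le_abs_self _))
          (dx_pos h.adm.ordered j).le
    _ = |ρHi| := by rw [← Finset.mul_sum, s₀.sum_dx, mul_one]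

/-- Because `potential` is bounded below, a bound on the decreasing energy bounds the kinetic and
the internal part separately; `exists_pressure_le_potential` then gives the pressure integral. -/
theorem exists_energy_bound (laws : ConstitutiveLaws p μ cLo cHi) (hρ : 0 < ρLo) (ρHi K : ℝ) :
    ∃ b : ℝ, 0 ≤ b ∧ ∀ (J : ℕ) (s₀ : MeshState J) (S : ℝ → MeshState J),
      IsFlow p μ cLo cHi ρLo ρHi K s₀ S → ∀ t, 0 ≤ t →
        |(S t).energy fun ρ c => potential p c ρ| ≤ b ∧
        ∑ j ∈ Finset.range J, (S t).nodeMass (j : ℤ) * (S t).u (j : ℤ) ^ 2 ≤ b ∧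
        ∑ j ∈ Finset.range J, p ((S t).c j) ((S t).ρ j) * (S t).dx j ≤ b := by
  obtain ⟨lo, hi, hlo, hhi, hμ⟩ := laws.exists_viscosity_bounds
  obtain ⟨e, he0, he⟩ := laws.exists_potential_le hρ ρHi
  obtain ⟨P, C₀, hP0, hC0, hP⟩ := laws.exists_pressure_le_potential
  set e' := |ρHi| * |K| + e
  have he' : 0 ≤ e' := by positivity
  have hkin0 : ∀ (J : ℕ) (s₀ : MeshState J) (S : ℝ → MeshState J),
      IsFlow p μ cLo cHi ρLo ρHi K s₀ S → ∀ t, 0 ≤ t →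
      0 ≤ ∑ j ∈ Finset.range J, (S t).nodeMass (j : ℤ) * (S t).u (j : ℤ) ^ 2 :=
    fun J s₀ S h t ht => Finset.sum_nonneg fun j _ =>
      mul_nonneg (nodeMass_pos (h.ordered ht) (h.dens_pos ht) j).le (sq_nonneg _)
  refine ⟨2 * (e' + P) + C₀ * (1 + |ρHi| + e' + P), by positivity, fun J s₀ S h t ht => ?_⟩
  have h0 : s₀.energy (fun ρ c => potential p c ρ) ≤ e' := by
    rw [energy_eq h.adm.ordered]
    refine add_le_add ?_ ?_
    · have := sum_nodeMass_mul_sq_le h.one_le h.adm.ordered (abs_nonneg ρHi)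
        fun j => (h.adm.ρ_mem j).2.trans (le_abs_self _)
      have h1 : |ρHi| * s₀.h1Sq ≤ |ρHi| * |K| :=
        mul_le_mul_of_nonneg_left (h.adm.h1.trans (le_abs_self _)) (abs_nonneg _)
      linarith
    · calc _ ≤ ∑ j ∈ Finset.range J, e * s₀.dx (j : ℤ) := Finset.sum_le_sum fun j _ =>
            mul_le_mul_of_nonneg_right (he _ (h.adm.c_mem j) _ (h.adm.ρ_mem j))
              (dx_pos h.adm.ordered j).le
        _ = e := by rw [← Finset.mul_sum, s₀.sum_dx, mul_one]
  have h1 : (S t).energy (fun ρ c => potential p c ρ) ≤ e' := by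
    refine le_trans ?_ h0
    rw [← h.sol.initial]
    exact le_of_hasDeriv_nonpos (T := t) (f := fun τ => (S τ).energy fun ρ c => potential p c ρ)
      (fun τ hτ => h.hasDeriv_energy laws.isInternalEnergy_potential hτ)
      (fun τ hτ => neg_nonpos.2 (diss_nonneg (h.ordered hτ.1)
        fun j => hlo.le.trans (hμ _ (h.color_mem hτ.1 j)).1)) ⟨ht, le_rfl⟩
  have hpot : - P ≤ ∑ j ∈ Finset.range J, potential p ((S t).c j) ((S t).ρ j) * (S t).dx j := by
    calc - P = ∑ j ∈ Finset.range J, (- P) * (S t).dx (j : ℤ) := by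
          rw [← Finset.mul_sum, (S t).sum_dx, mul_one]
      _ ≤ _ := Finset.sum_le_sum fun j _ => mul_le_mul_of_nonneg_right
          (hP _ (h.color_mem ht j) _ (h.dens_pos ht j)).1 (dx_pos (h.ordered ht) j).le
  have hk := hkin0 J s₀ S h t ht
  have hE := energy_eq (h.ordered ht) fun ρ c => potential p c ρ
  have hpr : ∑ j ∈ Finset.range J, p ((S t).c j) ((S t).ρ j) * (S t).dx j
      ≤ C₀ * (1 + |ρHi| + e' + P) := by
    calc _ ≤ ∑ j ∈ Finset.range J, (C₀ * (1 + P) * (S t).dx (j : ℤ)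
          + C₀ * ((S t).ρ (j : ℤ) * (S t).dx (j : ℤ))
          + C₀ * (potential p ((S t).c j) ((S t).ρ j) * (S t).dx j)) :=
          Finset.sum_le_sum fun j _ => by
            have := mul_le_mul_of_nonneg_right (hP _ (h.color_mem ht j) _ (h.dens_pos ht j)).2
              (dx_pos (h.ordered ht) j).le
            linarith
      _ = C₀ * (1 + P + ∑ j ∈ Finset.range J, (S t).ρ (j : ℤ) * (S t).dx (j : ℤ)
          + ∑ j ∈ Finset.range J, potential p ((S t).c j) ((S t).ρ j) * (S t).dx j) := by
          rw [Finset.sum_add_distrib, Finset.sum_add_distrib, ← Finset.mul_sum, ← Finset.mul_sum,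
            ← Finset.mul_sum, (S t).sum_dx]; ring
      _ ≤ _ := mul_le_mul_of_nonneg_left (by linarith [h.sum_mass_le ht]) hC0
  have hq : 0 ≤ C₀ * (1 + |ρHi| + e' + P) := by positivity
  refine ⟨abs_le.2 ⟨?_, ?_⟩, ?_, ?_⟩ <;> linarith

/-- Discrete mass-weighted antiderivative of the velocity. -/
noncomputable def momentumSum (s : MeshState J) (n : ℕ) : ℝ :=
  ∑ k ∈ Finset.range n, s.nodeMass ((k : ℤ) + 1) * s.u ((k : ℤ) + 1)

theorem hasDeriv_momentumSum (h : IsFlow p μ cLo cHi ρLo ρHi K s₀ S) (ht : 0 ≤ t) (n : ℕ) :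
    HasDerivWithinAt (fun τ => momentumSum (S τ) n)
      ((S t).flux p μ n - (S t).flux p μ 0) (Ici 0) t := by
  have h1 := HasDerivWithinAt.fun_sum (u := Finset.range n) fun k _ =>
    (h.hasDeriv_nodeMass ht ((k : ℤ) + 1)).mul (h.hasDeriv_u ht ((k : ℤ) + 1))
  refine h1.congr_deriv ?_
  have h2 := Finset.sum_range_sub (fun k : ℕ => (S t).flux p μ k) n
  push_cast at h2
  rw [← h2]
  refine Finset.sum_congr rfl fun k _ => ?_
  rw [nodeMass_mul_acc p μ (h.ordered ht) (h.dens_pos ht), add_sub_cancel_right]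
  ring

/-- Since `|u| ≤ 1 + u²`, a partial sum of momenta is at most the total mass plus twice the kinetic
energy. -/
theorem abs_momentumSum_le (h : IsFlow p μ cLo cHi ρLo ρHi K s₀ S) (ht : 0 ≤ t) {n : ℕ}
    (hn : n ≤ J) : |momentumSum (S t) n|
      ≤ |ρHi| + ∑ j ∈ Finset.range J, (S t).nodeMass (j : ℤ) * (S t).u (j : ℤ) ^ 2 := by
  have hM := nodeMass_pos (h.ordered ht) (h.dens_pos ht)
  have h1 := sum_periodic_shift (J := J)
    (f := fun j => (S t).nodeMass j + (S t).nodeMass j * (S t).u j ^ 2) fun j => by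
      simp only [(S t).nodeMass_add_period, (S t).u_periodic]
  have h2 : |momentumSum (S t) n| ≤ ∑ j ∈ Finset.range J,
      ((S t).nodeMass ((j : ℤ) + 1) + (S t).nodeMass ((j : ℤ) + 1) * (S t).u ((j : ℤ) + 1) ^ 2) := by
    refine (Finset.abs_sum_le_sum_abs _ _).trans ?_
    refine (Finset.sum_le_sum fun k _ => ?_).trans (Finset.sum_le_sum_of_subset_of_nonneg
      (Finset.range_subset_range.2 hn) fun k _ _ => ?_)
    · rw [abs_mul, abs_of_pos (hM _), ← mul_one_add]
      refine mul_le_mul_of_nonneg_left ?_ (hM _).le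
      rw [← sq_abs]
      nlinarith [sq_nonneg (|(S t).u ((k : ℤ) + 1)| - 1), abs_nonneg ((S t).u ((k : ℤ) + 1))]
    · have := hM ((k : ℤ) + 1); positivity
  rw [h1, Finset.sum_add_distrib, sum_nodeMass] at h2
  linarith [h.sum_mass_le ht]

/-- The quantity whose evolution controls the density in cell `n`. -/
noncomputable def densityPotential (μ : ℝ → ℝ) (s : MeshState J) (n : ℕ) : ℝ :=
  μ (s.c n) * Real.log (s.ρ n) + momentumSum s n
    - ∑ i ∈ Finset.range J, s.dx (i : ℤ) * momentumSum s i

/-- The term `μ log ρ` contributes `-Z_n - p_n` and the momentum sum `Z_n - Z_0`, so `Z_n` cancels.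
Subtracting the length-weighted mean of the momentum sums trades `Z_0` for the mean of the flux,
plus a term from the changing lengths. Only the pressure in cell `n` remains pointwise. -/
theorem hasDeriv_densityPotential (h : IsFlow p μ cLo cHi ρLo ρHi K s₀ S) (ht : 0 ≤ t) (n : ℕ) :
    HasDerivWithinAt (fun τ => densityPotential μ (S τ) n)
      (∑ i ∈ Finset.range J, p ((S t).c i) ((S t).ρ i) * (S t).dx i
        - p ((S t).c n) ((S t).ρ n)
        - ∑ i ∈ Finset.range J, (μ ((S t).c i) + momentumSum (S t) i)
            * ((S t).u ((i : ℤ) + 1) - (S t).u i)) (Ici 0) t := by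
  have h1 := (((h.hasDeriv_viscosity ht n).mul
    ((h.hasDeriv_rho ht n).log (h.dens_pos ht n).ne')).add (h.hasDeriv_momentumSum ht n)).sub
    (HasDerivWithinAt.fun_sum (u := Finset.range J) fun i _ =>
      (h.hasDeriv_dx ht i).mul (h.hasDeriv_momentumSum ht i))
  refine h1.congr_deriv ?_
  have e1 : ∀ i : ℕ, (μ ((S t).c i) + momentumSum (S t) i) * ((S t).u ((i : ℤ) + 1) - (S t).u i)
      = (S t).flux p μ i * (S t).dx i + p ((S t).c i) ((S t).ρ i) * (S t).dx i
        + momentumSum (S t) i * ((S t).gradU i * (S t).dx i) := fun i => by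
    rw [← gradU_mul_dx (h.ordered ht), flux]; ring
  have e2 : ∀ i : ℕ, (S t).gradU i * (S t).dx i * momentumSum (S t) i
        + (S t).dx i * ((S t).flux p μ i - (S t).flux p μ 0)
      = momentumSum (S t) i * ((S t).gradU i * (S t).dx i) + (S t).flux p μ i * (S t).dx i
        - (S t).flux p μ 0 * (S t).dx i := fun i => by ring
  simp only [e1, e2, Finset.sum_add_distrib, Finset.sum_sub_distrib, ← Finset.mul_sum, (S t).sum_dx]
  have h3 : μ ((S t).c n) * (-((S t).ρ n * (S t).gradU n) / (S t).ρ n)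
      = - (S t).flux p μ n - p ((S t).c n) ((S t).ρ n) := by
    have := (h.dens_pos ht n).ne'
    rw [flux]; field_simp; ring
  rw [h3]; ring

theorem exists_density_bounds (laws : ConstitutiveLaws p μ cLo cHi) (hρ : 0 < ρLo) (ρHi K T : ℝ) :
    ∃ lo hi : ℝ, 0 < lo ∧ 0 < hi ∧ ∀ (J : ℕ) (s₀ : MeshState J) (S : ℝ → MeshState J),
      IsFlow p μ cLo cHi ρLo ρHi K s₀ S → ∀ t ∈ Icc 0 T, ∀ j,
        lo ≤ (S t).ρ j ∧ (S t).ρ j ≤ hi := by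
  obtain ⟨m, M, hm, hM, hμ⟩ := laws.exists_viscosity_bounds
  obtain ⟨b, hb0, hb⟩ := exists_energy_bound laws hρ ρHi K
  set q := |ρHi| + b
  have hq : 0 ≤ q := by positivity
  set k := (M + q) ^ 2 / (4 * m)
  have hk : 0 ≤ k := by positivity
  have hμJ : ∀ (J : ℕ) (s₀ : MeshState J) (S : ℝ → MeshState J),
      IsFlow p μ cLo cHi ρLo ρHi K s₀ S → ∀ t, 0 ≤ t → ∀ i : ℕ, i ≤ J →
      |momentumSum (S t) i| ≤ q := fun J s₀ S h t ht i hi =>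
    (h.abs_momentumSum_le ht hi).trans (by have := (hb J s₀ S h t ht).2.1; linarith)
  have hsum : ∀ (J : ℕ) (s₀ : MeshState J) (S : ℝ → MeshState J),
      IsFlow p μ cLo cHi ρLo ρHi K s₀ S → ∀ t, 0 ≤ t →
      |∑ i ∈ Finset.range J, (S t).dx (i : ℤ) * momentumSum (S t) i| ≤ q :=
    fun J s₀ S h t ht => by
      calc _ ≤ ∑ i ∈ Finset.range J, (S t).dx (i : ℤ) * q := by
            refine (Finset.abs_sum_le_sum_abs _ _).trans (Finset.sum_le_sum fun i hi => ?_)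
            rw [abs_mul, abs_of_pos (dx_pos (h.ordered ht) _)]
            exact mul_le_mul_of_nonneg_left (hμJ J s₀ S h t ht i (Finset.mem_range.1 hi).le)
              (dx_pos (h.ordered ht) _).le
        _ = q := by rw [← Finset.sum_mul, (S t).sum_dx, one_mul]
  have hv : ∀ (J : ℕ) (s₀ : MeshState J) (S : ℝ → MeshState J),
      IsFlow p μ cLo cHi ρLo ρHi K s₀ S → ∀ t, 0 ≤ t →
      |∑ i ∈ Finset.range J, (μ ((S t).c i) + momentumSum (S t) i)
            * ((S t).u ((i : ℤ) + 1) - (S t).u i)| ≤ (S t).diss μ + k :=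
    fun J s₀ S h t ht => by
      -- With `ε = 1` the velocity increments cost exactly one `diss`, which the energy decay can
      -- pay for. The conversion `i.toNat` is harmless, since only indices in `range J` occur.
      have h1 := abs_sum_mul_sub_le (s := S t) (μ := μ) (h.ordered ht) hm
        (fun j => (hμ _ (h.color_mem ht j)).1)
        (h := fun i => μ ((S t).c i) + momentumSum (S t) i.toNat) (B := M + q) (fun i hi => by
          have h2 := hμ _ (h.color_mem ht i)
          have h3 := hμJ J s₀ S h t ht i (Finset.mem_range.1 hi).le
          refine (abs_add_le _ _).trans (add_le_add ?_ (by simpa using h3))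
          rw [abs_of_nonneg (by linarith)]; exact h2.2) one_pos
      simpa using h1
  have hlog0 : ∀ (J : ℕ) (s₀ : MeshState J) (S : ℝ → MeshState J),
      IsFlow p μ cLo cHi ρLo ρHi K s₀ S → ∀ j,
      |μ (s₀.c j) * Real.log (s₀.ρ j)| ≤ M * (|Real.log ρLo| + |Real.log ρHi|) :=
    fun J s₀ S h j => by
      have h2 := hμ _ (h.adm.c_mem j)
      have h3 := h.adm.ρ_mem j
      have h4 : 0 < s₀.ρ j := hρ.trans_le h3.1
      have h5 := Real.log_le_log hρ h3.1
      have h6 := Real.log_le_log h4 h3.2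
      rw [abs_mul, abs_of_nonneg (hm.le.trans h2.1)]
      refine mul_le_mul h2.2 (abs_le.2 ⟨?_, ?_⟩) (abs_nonneg _) hM.le
      · linarith [neg_abs_le (Real.log ρLo), abs_nonneg (Real.log ρHi)]
      · linarith [le_abs_self (Real.log ρHi), abs_nonneg (Real.log ρLo)]
  set L := M * (|Real.log ρLo| + |Real.log ρHi|)
  have hL : 0 ≤ L := by positivity
  set T' := |T|
  -- Collected costs: `L` for the initial logarithm, `2 * q` for the momentum terms at each of the
  -- two times, `2 * b` for the energy difference, and the accumulated drift.
  set U := (L + 4 * q + 2 * b + (k + b) * T') / m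
  obtain ⟨P, hP0, hP⟩ := laws.exists_pressure_le (Real.exp U)
  set V := (L + 4 * q + 2 * b + (k + P) * T') / m
  have hdp : ∀ (J : ℕ) (s₀ : MeshState J) (S : ℝ → MeshState J),
      IsFlow p μ cLo cHi ρLo ρHi K s₀ S → ∀ t, 0 ≤ t → ∀ n : ℕ, n < J →
      |densityPotential μ (S t) n - μ (s₀.c n) * Real.log ((S t).ρ n)| ≤ 2 * q :=
    fun J s₀ S h t ht n hn => by
      have h1 := hμJ J s₀ S h t ht n hn.le
      have h2 := hsum J s₀ S h t ht
      rw [densityPotential, h.color_eq ht, add_sub_assoc, add_sub_cancel_left]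
      exact (abs_sub _ _).trans (by linarith)
  have hup : ∀ (J : ℕ) (s₀ : MeshState J) (S : ℝ → MeshState J),
      IsFlow p μ cLo cHi ρLo ρHi K s₀ S → ∀ t ∈ Icc 0 T, ∀ n : ℕ, n < J →
      (S t).ρ n ≤ Real.exp U := fun J s₀ S h t ht n hn => by
    -- Adding the energy cancels the dissipation; the drift `k + b` pays for the Young constant and
    -- the mean pressure, and the pressure in cell `n` has the favourable sign.
    have hder := fun τ (hτ : 0 ≤ τ) => ((h.hasDeriv_densityPotential hτ n).add
      (h.hasDeriv_energy laws.isInternalEnergy_potential hτ)).sub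
      ((hasDerivWithinAt_id τ (Ici 0)).const_mul (k + b))
    have h1 := le_of_hasDeriv_nonpos hder (fun τ hτ => by
      have h2 := (abs_le.1 (hv J s₀ S h τ hτ.1)).1
      have h3 := (hb J s₀ S h τ hτ.1).2.2
      have h4 := laws.p_nonneg _ (h.color_mem hτ.1 n) _ (h.dens_pos hτ.1 n).le
      linarith) ht
    simp only [Pi.add_apply, Pi.sub_apply, id, mul_zero, sub_zero] at h1
    have h5 := abs_le.1 (hb J s₀ S h t ht.1).1
    have h6 := abs_le.1 (hb J s₀ S h 0 le_rfl).1
    have h7 := abs_le.1 (hdp J s₀ S h t ht.1 n hn)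
    have h8 := abs_le.1 (hdp J s₀ S h 0 le_rfl n hn)
    have h9 := abs_le.1 (hlog0 J s₀ S h n)
    have h10 : (S 0).ρ n = s₀.ρ n := by rw [h.sol.initial]
    rw [h10] at h8
    have h11 : (k + b) * t ≤ (k + b) * T' :=
      mul_le_mul_of_nonneg_left (ht.2.trans (le_abs_self T)) (by positivity)
    have h12 : μ (s₀.c n) * Real.log ((S t).ρ n) ≤ L + 4 * q + 2 * b + (k + b) * T' := by linarith
    refine (Real.log_le_iff_le_exp (h.dens_pos ht.1 n)).1 ?_
    rw [le_div_iff₀ hm]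
    rcases le_total 0 (Real.log ((S t).ρ n)) with hl | hl
    · have := mul_le_mul_of_nonneg_right (hμ _ (h.adm.c_mem n)).1 hl
      linarith
    · have := mul_nonpos_of_nonpos_of_nonneg hl hm.le
      have : 0 ≤ (k + b) * T' := by positivity
      linarith
  have hlow : ∀ (J : ℕ) (s₀ : MeshState J) (S : ℝ → MeshState J),
      IsFlow p μ cLo cHi ρLo ρHi K s₀ S → ∀ t ∈ Icc 0 T, ∀ n : ℕ, n < J →
      Real.exp (-V) ≤ (S t).ρ n := fun J s₀ S h t ht n hn => by
    -- Opposite sign: now the mean pressure is favourable, and the pressure in cell `n` is bounded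
    -- by `P` thanks to the upper density bound.
    have hder := fun τ (hτ : 0 ≤ τ) => ((h.hasDeriv_energy laws.isInternalEnergy_potential hτ).sub
      (h.hasDeriv_densityPotential hτ n)).sub
      ((hasDerivWithinAt_id τ (Ici 0)).const_mul (k + P))
    have h1 := le_of_hasDeriv_nonpos hder (fun τ hτ => by
      have h2 := (abs_le.1 (hv J s₀ S h τ hτ.1)).2
      have h3 : 0 ≤ ∑ i ∈ Finset.range J, p ((S τ).c i) ((S τ).ρ i) * (S τ).dx i :=
        Finset.sum_nonneg fun i _ => mul_nonneg
          (laws.p_nonneg _ (h.color_mem hτ.1 i) _ (h.dens_pos hτ.1 i).le)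
          (dx_pos (h.ordered hτ.1) i).le
      have h4 := hP _ (h.color_mem hτ.1 n) _ ⟨(h.dens_pos hτ.1 n).le, hup J s₀ S h τ hτ n hn⟩
      linarith) ht
    simp only [Pi.sub_apply, id, mul_zero, sub_zero] at h1
    have h5 := abs_le.1 (hb J s₀ S h t ht.1).1
    have h6 := abs_le.1 (hb J s₀ S h 0 le_rfl).1
    have h7 := abs_le.1 (hdp J s₀ S h t ht.1 n hn)
    have h8 := abs_le.1 (hdp J s₀ S h 0 le_rfl n hn)
    have h9 := abs_le.1 (hlog0 J s₀ S h n)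
    have h10 : (S 0).ρ n = s₀.ρ n := by rw [h.sol.initial]
    rw [h10] at h8
    have h11 : (k + P) * t ≤ (k + P) * T' :=
      mul_le_mul_of_nonneg_left (ht.2.trans (le_abs_self T)) (by positivity)
    have h12 : -(L + 4 * q + 2 * b + (k + P) * T') ≤ μ (s₀.c n) * Real.log ((S t).ρ n) := by
      linarith
    refine (Real.le_log_iff_exp_le (h.dens_pos ht.1 n)).1 ?_
    rw [← neg_div, div_le_iff₀ hm]
    rcases le_total 0 (Real.log ((S t).ρ n)) with hl | hl
    · have := mul_nonneg hl hm.le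
      have : 0 ≤ (k + P) * T' := by positivity
      linarith
    · have := mul_le_mul_of_nonpos_right (hμ _ (h.adm.c_mem n)).1 hl
      linarith
  refine ⟨Real.exp (-V), Real.exp U, Real.exp_pos _, Real.exp_pos _, fun J s₀ S h t ht j => ?_⟩
  obtain ⟨n, hn, hper⟩ := exists_nat_of_periodic h.one_le j
  rw [hper _ (S t).ρ_periodic]
  exact ⟨hlow J s₀ S h t ht n hn, hup J s₀ S h t ht n hn⟩

end IsFlow

end SemiDiscrete

namespace SemiDiscrete

/-! ### Pointwise flux bounds and production terms for bounded coefficients -/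

namespace MeshState

variable {J : ℕ} {p : ℝ → ℝ → ℝ} {μ : ℝ → ℝ} {b : ℝ} {s : MeshState J}

/-- All coefficients of the momentum equation in the state `s` are controlled by `b`. -/
structure IsBounded (p : ℝ → ℝ → ℝ) (μ : ℝ → ℝ) (b : ℝ) (s : MeshState J) : Prop where
  one_le_card : 1 ≤ J
  one_le : 1 ≤ b
  ordered : ∀ j : ℤ, s.x j < s.x (j + 1)
  visc_lower : ∀ j, b⁻¹ ≤ μ (s.c j)
  visc_upper : ∀ j, μ (s.c j) ≤ b
  dens_lower : ∀ j, b⁻¹ ≤ s.ρ j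
  dens_upper : ∀ j, s.ρ j ≤ b
  pressure : ∀ j, |p (s.c j) (s.ρ j)| ≤ b
  pressure_deriv : ∀ j, |deriv (p (s.c j)) (s.ρ j) * s.ρ j| ≤ b

namespace IsBounded

theorem pos (h : s.IsBounded p μ b) : 0 < b := zero_lt_one.trans_le h.one_le

theorem visc_pos (h : s.IsBounded p μ b) (j : ℤ) : 0 < μ (s.c j) :=
  (inv_pos.2 h.pos).trans_le (h.visc_lower j)

theorem dens_pos (h : s.IsBounded p μ b) (j : ℤ) : 0 < s.ρ j :=
  (inv_pos.2 h.pos).trans_le (h.dens_lower j)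

theorem one_le_mul_visc (h : s.IsBounded p μ b) (j : ℤ) : 1 ≤ b * μ (s.c j) := by
  have := mul_le_mul_of_nonneg_left (h.visc_lower j) h.pos.le
  rwa [mul_inv_cancel₀ h.pos.ne'] at this

theorem dx_pos (h : s.IsBounded p μ b) (j : ℤ) : 0 < s.dx j := MeshState.dx_pos h.ordered j

theorem diss_nonneg (h : s.IsBounded p μ b) : 0 ≤ s.diss μ :=
  MeshState.diss_nonneg h.ordered fun j => (h.visc_pos j).le

theorem accSq_nonneg (h : s.IsBounded p μ b) : 0 ≤ s.accSq p μ :=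
  MeshState.accSq_nonneg p μ h.ordered h.dens_pos

theorem accDiss_nonneg (h : s.IsBounded p μ b) : 0 ≤ s.accDiss p μ :=
  Finset.sum_nonneg fun _ _ =>
    mul_nonneg (mul_nonneg (h.visc_pos _).le (sq_nonneg _)) (h.dx_pos _).le

theorem nodeMass_le (h : s.IsBounded p μ b) (j : ℤ) : s.nodeMass j ≤ b * s.dxNode j := by
  have h1 := mul_le_mul_of_nonneg_right (h.dens_upper (j - 1)) (h.dx_pos (j - 1)).le
  have h2 := mul_le_mul_of_nonneg_right (h.dens_upper j) (h.dx_pos j).le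
  simp only [nodeMass, dxNode]; linarith

theorem dxNode_le (h : s.IsBounded p μ b) (j : ℤ) : s.dxNode j ≤ b * s.nodeMass j := by
  have h1 := mul_le_mul_of_nonneg_right (h.dens_lower (j - 1)) (h.dx_pos (j - 1)).le
  have h2 := mul_le_mul_of_nonneg_right (h.dens_lower j) (h.dx_pos j).le
  have : b⁻¹ * s.dxNode j ≤ s.nodeMass j := by simp only [nodeMass, dxNode]; linarith
  rwa [inv_mul_le_iff₀ h.pos] at this

theorem sum_sq_le (h : s.IsBounded p μ b) (f : ℤ → ℝ) :
    ∑ j ∈ Finset.range J, f j ^ 2 * s.dx (j : ℤ)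
      ≤ b * ∑ j ∈ Finset.range J, μ (s.c j) * f j ^ 2 * s.dx (j : ℤ) := by
  rw [Finset.mul_sum]
  refine Finset.sum_le_sum fun j _ => ?_
  have h1 := mul_le_mul_of_nonneg_right (h.one_le_mul_visc j)
    (mul_nonneg (sq_nonneg (f j)) (h.dx_pos j).le)
  linarith

theorem sum_const_mul_dx (c : ℝ) : ∑ j ∈ Finset.range J, c * s.dx (j : ℤ) = c := by
  rw [← Finset.mul_sum, s.sum_dx, mul_one]

theorem sum_nodeMass_le (h : s.IsBounded p μ b) :
    ∑ j ∈ Finset.range J, s.nodeMass (j : ℤ) ≤ b := by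
  rw [s.sum_nodeMass, ← sum_const_mul_dx (s := s) b]
  exact Finset.sum_le_sum fun j _ => mul_le_mul_of_nonneg_right (h.dens_upper _) (h.dx_pos _).le

/-- The flux deviates from its mean by at most its total variation, the sum of masses times `|acc|`,
which Cauchy–Schwarz bounds by `accSq`. The mean itself is controlled by `diss` and the pressure
bound. -/
theorem flux_sq_le (h : s.IsBounded p μ b) (j : ℤ) :
    s.flux p μ j ^ 2 ≤ 2 * b * s.accSq p μ + 4 * b * s.diss μ + 4 * b ^ 2 := by
  have hM := nodeMass_pos h.ordered h.dens_pos
  have h1 := abs_sub_average_le h.one_le_card (s.flux_add_period p μ) (fun i => (h.dx_pos i).le)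
    s.sum_dx j
  have e1 : ∀ i : ℕ, |s.flux p μ ((i : ℤ) + 1) - s.flux p μ i|
      = s.nodeMass ((i : ℤ) + 1) * |s.acc p μ ((i : ℤ) + 1)| := fun i => by
    have := nodeMass_mul_acc p μ h.ordered h.dens_pos ((i : ℤ) + 1)
    rw [add_sub_cancel_right] at this
    rw [← this, abs_mul, abs_of_pos (hM _)]
  have e2 := sum_periodic_shift (J := J) (f := fun i => s.nodeMass i * |s.acc p μ i|) fun i => by
    simp only [s.nodeMass_add_period, s.acc_add_period]
  simp only [e1, e2] at h1
  have h2 : (∑ i ∈ Finset.range J, s.nodeMass (i : ℤ) * |s.acc p μ i|) ^ 2 ≤ b * s.accSq p μ := by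
    refine (Finset.sum_sq_le_sum_mul_sum_of_sq_le_mul (Finset.range J)
      (f := fun i : ℕ => s.nodeMass i) (g := fun i : ℕ => s.nodeMass i * s.acc p μ i ^ 2)
      (fun i _ => (hM i).le) (fun i _ => mul_nonneg (hM i).le (sq_nonneg _))
      (fun i _ => by rw [mul_pow, sq_abs]; exact le_of_eq (by ring))).trans ?_
    exact mul_le_mul_of_nonneg_right h.sum_nodeMass_le h.accSq_nonneg
  have h3 : (∑ i ∈ Finset.range J, μ (s.c i) * s.gradU i * s.dx (i : ℤ)) ^ 2 ≤ b * s.diss μ := by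
    refine (Finset.sum_sq_le_sum_mul_sum_of_sq_le_mul (Finset.range J)
      (f := fun i : ℕ => μ (s.c i) * s.dx i) (g := fun i : ℕ => μ (s.c i) * s.gradU i ^ 2 * s.dx i)
      (fun i _ => mul_nonneg (h.visc_pos i).le (h.dx_pos i).le)
      (fun i _ => mul_nonneg (mul_nonneg (h.visc_pos i).le (sq_nonneg _)) (h.dx_pos i).le)
      (fun i _ => le_of_eq (by ring))).trans ?_
    refine mul_le_mul_of_nonneg_right ?_ h.diss_nonneg
    rw [← sum_const_mul_dx (s := s) b]
    exact Finset.sum_le_sum fun i _ => mul_le_mul_of_nonneg_right (h.visc_upper _) (h.dx_pos _).le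
  have h4 : |∑ i ∈ Finset.range J, p (s.c i) (s.ρ i) * s.dx (i : ℤ)| ≤ b := by
    refine (Finset.abs_sum_le_sum_abs _ _).trans ?_
    rw [← sum_const_mul_dx (s := s) b]
    refine Finset.sum_le_sum fun i _ => ?_
    rw [abs_mul, abs_of_pos (h.dx_pos i)]
    exact mul_le_mul_of_nonneg_right (h.pressure i) (h.dx_pos i).le
  have e3 : ∑ i ∈ Finset.range J, s.dx (i : ℤ) * s.flux p μ i
      = ∑ i ∈ Finset.range J, μ (s.c i) * s.gradU i * s.dx (i : ℤ)
        - ∑ i ∈ Finset.range J, p (s.c i) (s.ρ i) * s.dx (i : ℤ) := by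
    rw [← Finset.sum_sub_distrib]
    exact Finset.sum_congr rfl fun i _ => by rw [flux]; ring
  rw [e3] at h1
  set N := ∑ i ∈ Finset.range J, s.nodeMass (i : ℤ) * |s.acc p μ i|
  set X := ∑ i ∈ Finset.range J, μ (s.c i) * s.gradU i * s.dx (i : ℤ)
  set Q := ∑ i ∈ Finset.range J, p (s.c i) (s.ρ i) * s.dx (i : ℤ)
  set z := s.flux p μ j
  have h5 : (z - (X - Q)) ^ 2 ≤ N ^ 2 := sq_le_sq.2 (h1.trans (le_abs_self _))
  have h6 : Q ^ 2 ≤ b ^ 2 := sq_le_sq.2 (h4.trans (le_abs_self _))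
  nlinarith [sq_nonneg (z - 2 * (X - Q)), sq_nonneg (X + Q)]

/-- The gradient is recovered from `μ gradU = Z + p`, so the pointwise bound of the flux passes to
it even where color and density jump. -/
theorem gradU_sq_le (h : s.IsBounded p μ b) (j : ℤ) :
    s.gradU j ^ 2 ≤ 10 * b ^ 4 * (1 + s.diss μ + s.accSq p μ) := by
  have h1 := h.flux_sq_le j
  have hb := h.one_le
  have hD := h.diss_nonneg
  have hA := h.accSq_nonneg
  set q := p (s.c j) (s.ρ j)
  have h2 : q ^ 2 ≤ b ^ 2 := sq_le_sq.2 ((h.pressure j).trans (le_abs_self _))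
  have h3 : μ (s.c j) * s.gradU j = s.flux p μ j + q := by simp only [flux, q]; ring
  have h4 : (μ (s.c j) * s.gradU j) ^ 2 ≤ 2 * s.flux p μ j ^ 2 + 2 * q ^ 2 := by
    rw [h3]; nlinarith [sq_nonneg (s.flux p μ j - q)]
  have h5 : s.gradU j ^ 2 ≤ b ^ 2 * (μ (s.c j) * s.gradU j) ^ 2 := by
    have : 1 ≤ (b * μ (s.c j)) ^ 2 := one_le_pow₀ (h.one_le_mul_visc j)
    have := mul_le_mul_of_nonneg_right this (sq_nonneg (s.gradU j))
    linarith
  have h6 : (μ (s.c j) * s.gradU j) ^ 2 ≤ 10 * b ^ 2 * (1 + s.diss μ + s.accSq p μ) := by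
    have h7 : b ≤ b ^ 2 := by nlinarith
    have h8 := mul_le_mul_of_nonneg_right h7 hD
    have h9 := mul_le_mul_of_nonneg_right h7 hA
    have : 0 ≤ b ^ 2 * s.accSq p μ := by positivity
    have : 0 ≤ b ^ 2 * s.diss μ := by positivity
    nlinarith
  calc _ ≤ b ^ 2 * (10 * b ^ 2 * (1 + s.diss μ + s.accSq p μ)) :=
        h5.trans (mul_le_mul_of_nonneg_left h6 (sq_nonneg b))
    _ = _ := by ring

theorem abs_sum_pressure_le (h : s.IsBounded p μ b) :
    |∑ j ∈ Finset.range J, p (s.c j) (s.ρ j) * (s.u ((j : ℤ) + 1) - s.u j)|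
      ≤ 1 / 4 * s.diss μ + b ^ 3 := by
  have h1 := abs_sum_mul_sub_le (s := s) (μ := μ) h.ordered (inv_pos.2 h.pos) h.visc_lower
    (h := fun j => p (s.c j) (s.ρ j)) (fun j _ => h.pressure j) (ε := 1 / 4) (by norm_num)
  have e : b ^ 2 / (4 * (1 / 4) * b⁻¹) = b ^ 3 := by have := h.pos; field_simp
  rwa [e] at h1

theorem sum_gradU_sq_le (h : s.IsBounded p μ b) :
    ∑ j ∈ Finset.range J, s.gradU (j : ℤ) ^ 2 * s.dx (j : ℤ) ≤ b * s.diss μ :=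
  h.sum_sq_le s.gradU

/-- In the cubic term one factor is bounded pointwise by `gradU_sq_le` and the other two form
`diss`. Only half of `accSq` is spent, and the rest is quadratic in `diss`. -/
theorem velocity_production_le (h : s.IsBounded p μ b) :
    ∑ j ∈ Finset.range J, (deriv (p (s.c j)) (s.ρ j) * s.ρ j * s.gradU j ^ 2 * s.dx (j : ℤ)
        - 1 / 2 * (μ (s.c j) * s.gradU j ^ 3 * s.dx (j : ℤ)))
      ≤ 1 / 2 * s.accSq p μ + 10 * b ^ 4 * (1 + s.diss μ) ^ 2 := by
  have hb := h.one_le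
  have hD := h.diss_nonneg
  have hA := h.accSq_nonneg
  set G := 10 * b ^ 4 * (1 + s.diss μ + s.accSq p μ) with hG
  have hG0 : 0 ≤ G := by positivity
  have h1 : ∑ j ∈ Finset.range J, deriv (p (s.c j)) (s.ρ j) * s.ρ j * s.gradU j ^ 2 * s.dx (j : ℤ)
      ≤ b * (b * s.diss μ) := by
    refine le_trans ?_ (mul_le_mul_of_nonneg_left h.sum_gradU_sq_le h.pos.le)
    rw [Finset.mul_sum]
    refine Finset.sum_le_sum fun j _ => ?_
    rw [mul_assoc]
    exact mul_le_mul_of_nonneg_right ((le_abs_self _).trans (h.pressure_deriv j))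
      (mul_nonneg (sq_nonneg _) (h.dx_pos j).le)
  have h2 : ∑ j ∈ Finset.range J, -(1 / 2 * (μ (s.c j) * s.gradU j ^ 3 * s.dx (j : ℤ)))
      ≤ 1 / 2 * (√G * s.diss μ) := by
    rw [diss, Finset.mul_sum, Finset.mul_sum]
    refine Finset.sum_le_sum fun j _ => ?_
    have h3 : - s.gradU j ≤ √G := by
      have := Real.abs_le_sqrt (h.gradU_sq_le j)
      linarith [neg_abs_le (s.gradU j)]
    have h4 : 0 ≤ μ (s.c j) * s.gradU j ^ 2 * s.dx j :=
      mul_nonneg (mul_nonneg (h.visc_pos j).le (sq_nonneg _)) (h.dx_pos j).le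
    have := mul_le_mul_of_nonneg_right h3 h4
    nlinarith
  -- Young's inequality weighted by `10 * b ^ 4`, the prefactor in `G`, so that `accSq` appears with
  -- coefficient one before the factor `1 / 2`.
  have h5 : √G * s.diss μ ≤ (1 + s.diss μ + s.accSq p μ) + 10 * b ^ 4 * s.diss μ ^ 2 / 4 := by
    have hb4 : 0 < 10 * b ^ 4 := by have := h.pos; positivity
    have e : √G ^ 2 = G := Real.sq_sqrt hG0
    have h6 : (1 + s.diss μ + s.accSq p μ) = √G ^ 2 / (10 * b ^ 4) := by
      rw [e, hG]; field_simp
    have h7 : √G ^ 2 / (10 * b ^ 4) + 10 * b ^ 4 * s.diss μ ^ 2 / 4 - √G * s.diss μ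
        = (√G - 10 * b ^ 4 * s.diss μ / 2) ^ 2 / (10 * b ^ 4) := by field_simp; ring
    have : 0 ≤ (√G - 10 * b ^ 4 * s.diss μ / 2) ^ 2 / (10 * b ^ 4) := by positivity
    linarith
  have e1 : ∑ j ∈ Finset.range J, (deriv (p (s.c j)) (s.ρ j) * s.ρ j * s.gradU j ^ 2 * s.dx (j : ℤ)
        - 1 / 2 * (μ (s.c j) * s.gradU j ^ 3 * s.dx (j : ℤ)))
      = ∑ j ∈ Finset.range J, deriv (p (s.c j)) (s.ρ j) * s.ρ j * s.gradU j ^ 2 * s.dx (j : ℤ)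
        + ∑ j ∈ Finset.range J, -(1 / 2 * (μ (s.c j) * s.gradU j ^ 3 * s.dx (j : ℤ))) := by
    rw [← Finset.sum_add_distrib]; simp only [sub_eq_add_neg]
  rw [e1]
  have hb2 : b ^ 2 ≤ b ^ 4 := pow_le_pow_right₀ hb (by norm_num)
  have hb4 : 1 ≤ b ^ 4 := one_le_pow₀ hb
  have := mul_le_mul_of_nonneg_right hb2 hD
  have := mul_le_mul_of_nonneg_right hb4 hD
  have : 0 ≤ b ^ 4 * s.diss μ ^ 2 := by positivity
  have : 0 ≤ b ^ 4 * s.diss μ := by positivity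
  nlinarith

/-- Completing the square in the acceleration gradient keeps one of the two available copies of
`accDiss`. The fourth power of the velocity gradient that appears is split with `gradU_sq_le`. -/
theorem acc_production_le (h : s.IsBounded p μ b) :
    - 2 * ∑ j ∈ Finset.range J, s.fluxDot p μ j * (s.grad (s.acc p μ) j * s.dx (j : ℤ))
      ≤ - s.accDiss p μ + 22 * b ^ 4 * (1 + s.diss μ) * (1 + s.diss μ + s.accSq p μ) := by
  have hb := h.one_le
  have hb0 := h.pos
  have hD := h.diss_nonneg
  have hA := h.accSq_nonneg
  set G := 10 * b ^ 4 * (1 + s.diss μ + s.accSq p μ) with hG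
  have h1 : - 2 * ∑ j ∈ Finset.range J, s.fluxDot p μ j * (s.grad (s.acc p μ) j * s.dx (j : ℤ))
      ≤ - s.accDiss p μ + (2 * G + 2 * b ^ 4) * s.diss μ := by
    rw [accDiss, diss, Finset.mul_sum, Finset.mul_sum, ← Finset.sum_neg_distrib,
      ← Finset.sum_add_distrib]
    refine Finset.sum_le_sum fun j _ => ?_
    have hd := h.dx_pos (j : ℤ)
    have hg := h.gradU_sq_le j
    have hw := h.pressure_deriv j
    have hμ := h.visc_pos j
    have hμ1 := h.one_le_mul_visc j
    rw [fluxDot]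
    rw [← hG] at hg
    set m := μ (s.c j)
    set g := s.gradU j
    set α := s.grad (s.acc p μ) j
    set w := deriv (p (s.c j)) (s.ρ j) * s.ρ j with hwdef
    have e1 : -2 * ((m * (α - g ^ 2) + deriv (p (s.c j)) (s.ρ j) * (s.ρ j * g)) * (α * s.dx j))
        = (-2 * (m * (α - g ^ 2) + w * g) * α) * s.dx j := by rw [hwdef]; ring
    have e2 : -(m * α ^ 2 * s.dx j) + (2 * G + 2 * b ^ 4) * (m * g ^ 2 * s.dx j)
        = (-(m * α ^ 2) + (2 * G + 2 * b ^ 4) * (m * g ^ 2)) * s.dx j := by ring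
    rw [e1, e2]
    refine mul_le_mul_of_nonneg_right ?_ hd.le
    have h2 : -2 * (m * (α - g ^ 2) + w * g) * α
        ≤ -(m * α ^ 2) + (m * g ^ 2 - w * g) ^ 2 / m := by
      have : -(m * α ^ 2) + (m * g ^ 2 - w * g) ^ 2 / m - -2 * (m * (α - g ^ 2) + w * g) * α
          = (m * α - (m * g ^ 2 - w * g)) ^ 2 / m := by field_simp; ring
      have : 0 ≤ (m * α - (m * g ^ 2 - w * g)) ^ 2 / m := by positivity
      linarith
    have h3 : (m * g ^ 2 - w * g) ^ 2 / m ≤ 2 * (g ^ 2 * (m * g ^ 2)) + 2 * (w ^ 2 * g ^ 2) / m := by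
      have e : 2 * (g ^ 2 * (m * g ^ 2)) + 2 * (w ^ 2 * g ^ 2) / m - (m * g ^ 2 - w * g) ^ 2 / m
          = (m * g ^ 2 + w * g) ^ 2 / m := by field_simp; ring
      have : 0 ≤ (m * g ^ 2 + w * g) ^ 2 / m := by positivity
      linarith
    have h4 : g ^ 2 * (m * g ^ 2) ≤ G * (m * g ^ 2) :=
      mul_le_mul_of_nonneg_right hg (by positivity)
    have h5 : 2 * (w ^ 2 * g ^ 2) / m ≤ 2 * b ^ 4 * (m * g ^ 2) := by
      rw [div_le_iff₀ hμ]
      have hw2 : w ^ 2 ≤ b ^ 2 := sq_le_sq.2 (hw.trans (le_abs_self _))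
      have h6 : 1 ≤ (b * m) ^ 2 := one_le_pow₀ hμ1
      have h7 : w ^ 2 * g ^ 2 ≤ b ^ 2 * g ^ 2 := mul_le_mul_of_nonneg_right hw2 (sq_nonneg g)
      have h8 := mul_le_mul_of_nonneg_right h6 (by positivity : 0 ≤ b ^ 2 * g ^ 2)
      nlinarith
    linarith
  refine h1.trans (add_le_add le_rfl ?_)
  have hb4 : 0 ≤ b ^ 4 := by positivity
  have h2 : 0 ≤ b ^ 4 * (1 + s.diss μ + s.accSq p μ) := by positivity
  have h3 : b ^ 4 * s.diss μ ≤ b ^ 4 * ((1 + s.diss μ + s.accSq p μ) * s.diss μ) :=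
    mul_le_mul_of_nonneg_left (le_mul_of_one_le_left hD (by linarith)) hb4
  rw [hG]
  nlinarith

end IsBounded

end MeshState

/-! ### Time-weighted acceleration estimates -/

namespace IsFlow

open MeshState

variable {p : ℝ → ℝ → ℝ} {μ : ℝ → ℝ} {cLo cHi ρLo ρHi K : ℝ} {J : ℕ} {s₀ : MeshState J}
  {S : ℝ → MeshState J} {t : ℝ}

/-- Half of the dissipation minus the work of the pressure. -/
noncomputable def lyapunov (p : ℝ → ℝ → ℝ) (μ : ℝ → ℝ) (s : MeshState J) : ℝ :=
  1 / 2 * s.diss μ - ∑ j ∈ Finset.range J, p (s.c j) (s.ρ j) * (s.u ((j : ℤ) + 1) - s.u j)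

/-- Subtracting the work of the pressure completes `μ gradU` to the full flux in front of the
acceleration gradient, so that `sum_flux_mul_grad_acc` applies. The other terms come from the moving
mesh and the changing pressure. -/
theorem hasDeriv_lyapunov (h : IsFlow p μ cLo cHi ρLo ρHi K s₀ S) (ht : 0 ≤ t) :
    HasDerivWithinAt (fun τ => lyapunov p μ (S τ))
      (- (S t).accSq p μ + ∑ j ∈ Finset.range J,
        (deriv (p ((S t).c j)) ((S t).ρ j) * (S t).ρ j * (S t).gradU j ^ 2 * (S t).dx (j : ℤ)
          - 1 / 2 * (μ ((S t).c j) * (S t).gradU j ^ 3 * (S t).dx (j : ℤ)))) (Ici 0) t := by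
  have h1 := ((HasDerivWithinAt.fun_sum (u := Finset.range J) fun j _ =>
    ((h.hasDeriv_viscosity ht j).mul ((h.hasDeriv_gradU ht j).pow 2)).mul
      (h.hasDeriv_dx ht j)).const_mul (1 / 2)).sub
    (HasDerivWithinAt.fun_sum (u := Finset.range J) fun j _ =>
      (h.hasDeriv_pressure ht j).mul ((h.hasDeriv_u ht ((j : ℤ) + 1)).sub (h.hasDeriv_u ht j)))
  refine h1.congr_deriv ?_
  rw [← sum_flux_mul_grad_acc p μ (h.ordered ht) (h.dens_pos ht), ← Finset.sum_add_distrib,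
    Finset.mul_sum, ← Finset.sum_sub_distrib]
  refine Finset.sum_congr rfl fun j _ => ?_
  simp only [Pi.pow_apply, Pi.mul_apply, Pi.sub_apply]
  rw [← gradU_mul_dx (h.ordered ht), ← grad_mul_dx (h.ordered ht), flux]
  push_cast
  ring

theorem hasDeriv_accSq (h : IsFlow p μ cLo cHi ρLo ρHi K s₀ S) (ht : 0 ≤ t) :
    HasDerivWithinAt (fun τ => (S τ).accSq p μ)
      (- 2 * ∑ j ∈ Finset.range J, (S t).fluxDot p μ j
        * ((S t).grad ((S t).acc p μ) j * (S t).dx (j : ℤ))) (Ici 0) t := by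
  have h1 := HasDerivWithinAt.fun_sum (u := Finset.range J) fun j _ =>
    (h.hasDeriv_nodeMass ht j).mul ((h.hasDeriv_acc ht j).pow 2)
  refine h1.congr_deriv ?_
  have h2 := sum_by_parts ((S t).acc_add_period p μ) ((S t).fluxDot_add_period p μ)
  simp only [grad_mul_dx (h.ordered ht)]
  rw [neg_mul, ← mul_neg, ← h2, Finset.mul_sum]
  refine Finset.sum_congr rfl fun j _ => ?_
  have := (nodeMass_pos (h.ordered ht) (h.dens_pos ht) j).ne'
  push_cast
  field_simp
  ring

theorem exists_isBounded (laws : ConstitutiveLaws p μ cLo cHi) (hρ : 0 < ρLo) (ρHi K T : ℝ) :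
    ∃ b : ℝ, 1 ≤ b ∧ ∀ (J : ℕ) (s₀ : MeshState J) (S : ℝ → MeshState J),
      IsFlow p μ cLo cHi ρLo ρHi K s₀ S → s₀.diss μ ≤ b ∧ ∀ t ∈ Icc 0 T,
        (S t).IsBounded p μ b ∧ |(S t).energy fun ρ c => potential p c ρ| ≤ b ∧
        ∑ j ∈ Finset.range J, (S t).nodeMass (j : ℤ) * (S t).u (j : ℤ) ^ 2 ≤ b := by
  obtain ⟨m, M, hm, hM, hμ⟩ := laws.exists_viscosity_bounds
  obtain ⟨e, he0, he⟩ := exists_energy_bound laws hρ ρHi K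
  obtain ⟨lo, hi, hlo, hhi, hd⟩ := exists_density_bounds laws hρ ρHi K T
  obtain ⟨P, hP0, hP⟩ := laws.exists_pressure_le hi
  obtain ⟨L, hL0, hL⟩ := laws.exists_abs_deriv_pressure_le hi
  set b := 1 + m⁻¹ + M + e + lo⁻¹ + hi + P + L * hi + M * |K| with hb
  have hm' := inv_pos.2 hm
  have hlo' := inv_pos.2 hlo
  have h0 : 0 ≤ L * hi := by positivity
  have h0' : 0 ≤ M * |K| := by positivity
  have hb1 : 1 ≤ b := by linarith
  have hb0 : 0 < b := by linarith
  refine ⟨b, hb1, fun J s₀ S h => ⟨?_, fun t ht => ?_⟩⟩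
  · have h1 : s₀.diss μ ≤ M * s₀.h1Sq := by
      rw [diss, h1Sq, mul_add, Finset.mul_sum, Finset.mul_sum, ← Finset.sum_add_distrib]
      refine Finset.sum_le_sum fun j _ => ?_
      have hdx := (dx_pos h.adm.ordered j).le
      have h2 : μ (s₀.c j) * (s₀.gradU j ^ 2 * s₀.dx j) ≤ M * (s₀.gradU j ^ 2 * s₀.dx j) :=
        mul_le_mul_of_nonneg_right (hμ _ (h.adm.c_mem j)).2 (by positivity)
      have h3 : 0 ≤ M * (|s₀.u (j + 1)| ^ 2 * s₀.dx j) := by positivity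
      rw [sq_abs (s₀.gradU j)]
      linarith
    have h4 : M * s₀.h1Sq ≤ M * |K| :=
      mul_le_mul_of_nonneg_left (h.adm.h1.trans (le_abs_self K)) hM.le
    linarith
  · obtain ⟨h1, h2, h3⟩ := he J s₀ S h t ht.1
    have hdt := hd J s₀ S h t ht
    have hc := h.color_mem ht.1
    have hρ0 := h.dens_pos ht.1
    refine ⟨⟨h.one_le, hb1, h.ordered ht.1, fun j => ?_, fun j => ?_, fun j => ?_, fun j => ?_,
      fun j => ?_, fun j => ?_⟩, by linarith, by linarith⟩
    · exact (inv_le_of_inv_le₀ hm (by linarith)).trans (hμ _ (hc j)).1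
    · linarith [(hμ _ (hc j)).2]
    · exact (inv_le_of_inv_le₀ hlo (by linarith)).trans (hdt j).1
    · linarith [(hdt j).2]
    · rw [abs_of_nonneg (laws.p_nonneg _ (hc j) _ (hρ0 j).le)]
      linarith [hP _ (hc j) _ ⟨(hρ0 j).le, (hdt j).2⟩]
    · rw [abs_mul, abs_of_pos (hρ0 j)]
      have := mul_le_mul (hL _ (hc j) _ ⟨hρ0 j, (hdt j).2⟩) (hdt j).2 (hρ0 j).le hL0
      linarith

/-- Bounds for the dissipation and for the acceleration on a bounded time interval. -/
theorem exists_acceleration_bounds (laws : ConstitutiveLaws p μ cLo cHi) (hρ : 0 < ρLo)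
    (ρHi K : ℝ) {T : ℝ} (hT : 0 ≤ T) :
    ∃ C : ℝ, 0 ≤ C ∧ ∀ (J : ℕ) (s₀ : MeshState J) (S : ℝ → MeshState J),
      IsFlow p μ cLo cHi ρLo ρHi K s₀ S → ∀ t ∈ Icc 0 T,
        (S t).diss μ ≤ C ∧ t * (S t).accSq p μ ≤ C ∧
        ∫⁻ τ in Ioo 0 t, ENNReal.ofReal ((S τ).accSq p μ) ≤ ENNReal.ofReal C ∧
        ∫⁻ τ in Ioo 0 t, ENNReal.ofReal (τ * (S τ).accDiss p μ) ≤ ENNReal.ofReal C := by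
  obtain ⟨b, hb1, hb⟩ := exists_isBounded laws hρ ρHi K T
  have hb0 : 0 < b := by linarith
  -- Four times the factor in `velocity_production_le`, because `1 + diss` is at most four times the
  -- shifted Lyapunov functional.
  set k := 40 * b ^ 4 with hk
  have hk0 : 0 < k := by positivity
  set R := Real.exp (k * (b + T)) with hR
  have hR0 : 0 < R := Real.exp_pos _
  set w := (b + 2 * b ^ 3 + 1) * R with hw
  have hw0 : 0 ≤ w := by positivity
  set d := 4 * (w * R) with hdd
  have hd0 : 0 ≤ d := by positivity
  set q := 22 * b ^ 4 * (1 + d) with hq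
  have hq0 : 0 ≤ q := by positivity
  -- The factor `2 * R` undoes the decay rate of `W`; then `1` pays for differentiating the weight
  -- `τ` and `T * q` for the `accSq` in `acc_production_le`.
  set c₁ := 2 * R * (1 + T * q) with hc₁
  have hc₁0 : 0 ≤ c₁ := by positivity
  set c₂ := T * q * (1 + d) with hc₂
  have hc₂0 : 0 ≤ c₂ := by positivity
  refine ⟨d + 2 * R * w + c₁ * w + c₂ * T, by positivity, fun J s₀ S h => ?_⟩
  obtain ⟨hD0, hB⟩ := hb J s₀ S h
  -- The pressure work costs at most a quarter of `diss` plus `b ^ 3`, so the shift makes the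
  -- functional positive and comparable with `1 + diss`.
  have hY : ∀ τ ∈ Icc 0 T, 1 + 1 / 4 * (S τ).diss μ ≤ lyapunov p μ (S τ) + (b ^ 3 + 1) ∧
      lyapunov p μ (S τ) + (b ^ 3 + 1) ≤ (S τ).diss μ + (2 * b ^ 3 + 1) := fun τ hτ => by
    have h1 := abs_le.1 (hB τ hτ).1.abs_sum_pressure_le
    have := (hB τ hτ).1.diss_nonneg
    simp only [lyapunov]
    constructor <;> linarith
  -- A Gronwall weight built from the energy: its logarithmic derivative is `-k (1 + diss)`, which
  -- absorbs the quadratic production without a prior pointwise bound on `diss`.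
  set W : ℝ → ℝ := fun τ => (lyapunov p μ (S τ) + (b ^ 3 + 1))
    * Real.exp (k * ((S τ).energy (fun ρ c => potential p c ρ) - τ)) with hW
  have hWder := fun τ (hτ : 0 ≤ τ) => ((h.hasDeriv_lyapunov hτ).add_const (b ^ 3 + 1)).mul
    (((h.hasDeriv_energy laws.isInternalEnergy_potential hτ).sub
      (hasDerivWithinAt_id τ (Ici 0))).const_mul k).exp
  set W' : ℝ → ℝ := _
  change ∀ τ, 0 ≤ τ → HasDerivWithinAt W (W' τ) (Ici 0) τ at hWder
  have hexp : ∀ τ ∈ Icc 0 T, R⁻¹ ≤ Real.exp (k * ((S τ).energy (fun ρ c => potential p c ρ) - τ)) ∧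
      Real.exp (k * ((S τ).energy (fun ρ c => potential p c ρ) - τ)) ≤ R := fun τ hτ => by
    have h1 := abs_le.1 (hB τ hτ).2.1
    rw [hR, ← Real.exp_neg]
    constructor
    · refine Real.exp_le_exp.2 ?_
      rw [← mul_neg]
      exact mul_le_mul_of_nonneg_left (by linarith [hτ.2]) hk0.le
    · exact Real.exp_le_exp.2 (mul_le_mul_of_nonneg_left (by linarith [hτ.1]) hk0.le)
  have hW'le : ∀ τ ∈ Icc 0 T, W' τ ≤ - ((2 * R)⁻¹ * (S τ).accSq p μ) := fun τ hτ => by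
    obtain ⟨hbd, -, -⟩ := hB τ hτ
    have hA := hbd.accSq_nonneg
    have hD := hbd.diss_nonneg
    have h1 := hbd.velocity_production_le
    have h2 := (hY τ hτ).1
    have h3 := (hexp τ hτ).1
    set E := Real.exp (k * ((S τ).energy (fun ρ c => potential p c ρ) - τ)) with hE
    set Q := ∑ j ∈ Finset.range J,
        (deriv (p ((S τ).c j)) ((S τ).ρ j) * (S τ).ρ j * (S τ).gradU j ^ 2 * (S τ).dx (j : ℤ)
          - 1 / 2 * (μ ((S τ).c j) * (S τ).gradU j ^ 3 * (S τ).dx (j : ℤ))) with hQ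
    set Y := lyapunov p μ (S τ) + (b ^ 3 + 1) with hYdef
    have e : W' τ = E * (- (S τ).accSq p μ + Q - k * ((1 + (S τ).diss μ) * Y)) := by
      simp only [W', id, Pi.sub_apply]
      rw [← hE, ← hQ, ← hYdef]
      ring
    have h4 : (1 + (S τ).diss μ) * (1 + (S τ).diss μ) ≤ (1 + (S τ).diss μ) * (4 * Y) :=
      mul_le_mul_of_nonneg_left (by linarith) (by linarith)
    have h5 : 10 * b ^ 4 * (1 + (S τ).diss μ) ^ 2 ≤ k * ((1 + (S τ).diss μ) * Y) := by
      have := mul_le_mul_of_nonneg_left h4 (by positivity : 0 ≤ 10 * b ^ 4)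
      rw [hk]
      linarith
    have h6 : - (S τ).accSq p μ + Q - k * ((1 + (S τ).diss μ) * Y) ≤ - (1 / 2 * (S τ).accSq p μ) := by
      linarith
    rw [e]
    have h7 := mul_le_mul_of_nonneg_left h6 (Real.exp_pos
      (k * ((S τ).energy (fun ρ c => potential p c ρ) - τ))).le
    have h8 := mul_le_mul_of_nonneg_right h3 (by positivity : 0 ≤ 1 / 2 * (S τ).accSq p μ)
    rw [mul_inv]
    linarith
  have hWnn : ∀ τ ∈ Icc 0 T, 0 ≤ W τ := fun τ hτ =>
    mul_nonneg (by linarith [(hY τ hτ).1, (hB τ hτ).1.diss_nonneg]) (Real.exp_pos _).le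
  have h0T : (0 : ℝ) ∈ Icc 0 T := ⟨le_rfl, hT⟩
  have hW0 : W 0 ≤ w := by
    have h1 := (hY 0 h0T).2
    have h2 : (S 0).diss μ ≤ b := by rw [h.sol.initial]; exact hD0
    exact mul_le_mul (by linarith) (hexp 0 h0T).2 (Real.exp_pos _).le (by positivity)
  have hWle : ∀ τ ∈ Icc 0 T, W τ ≤ w := fun τ hτ =>
    (le_of_hasDeriv_nonpos hWder (fun r hr => (hW'le r hr).trans (by
      have := (hB r hr).1.accSq_nonneg
      rw [neg_nonpos]; positivity)) hτ).trans hW0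
  have hdiss : ∀ τ ∈ Icc 0 T, (S τ).diss μ ≤ d := fun τ hτ => by
    have h1 := (hY τ hτ).1
    have h2 := (hexp τ hτ).1
    have h3 := hWle τ hτ
    have h4 : 0 ≤ lyapunov p μ (S τ) + (b ^ 3 + 1) := by
      linarith [(hB τ hτ).1.diss_nonneg]
    have h5 : (lyapunov p μ (S τ) + (b ^ 3 + 1)) * R⁻¹ ≤ w :=
      (mul_le_mul_of_nonneg_left h2 h4).trans h3
    rw [← div_eq_mul_inv, div_le_iff₀ hR0] at h5
    linarith
  -- The weight `τ` removes the initial value of `accSq`; the decay of `W` absorbs the terms linear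
  -- in `accSq`, and `c₂ * τ` the bounded production.
  set V : ℝ → ℝ := fun τ => τ * (S τ).accSq p μ + c₁ * W τ - c₂ * τ with hV
  have hVder := fun τ (hτ : 0 ≤ τ) => (((hasDerivWithinAt_id τ (Ici 0)).mul
    (h.hasDeriv_accSq hτ)).add ((hWder τ hτ).const_mul c₁)).sub
    ((hasDerivWithinAt_id τ (Ici 0)).const_mul c₂)
  set V' : ℝ → ℝ := _
  change ∀ τ, 0 ≤ τ → HasDerivWithinAt V (V' τ) (Ici 0) τ at hVder
  have hV'le : ∀ τ ∈ Icc 0 T, V' τ ≤ - (τ * (S τ).accDiss p μ) := fun τ hτ => by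
    obtain ⟨hbd, -, -⟩ := hB τ hτ
    have hA := hbd.accSq_nonneg
    have hD := hbd.diss_nonneg
    have h1 := hbd.acc_production_le
    have h2 := hW'le τ hτ
    set Q := - 2 * ∑ j ∈ Finset.range J, (S τ).fluxDot p μ j
        * ((S τ).grad ((S τ).acc p μ) j * (S τ).dx (j : ℤ)) with hQ
    have e : V' τ = (S τ).accSq p μ + τ * Q + c₁ * W' τ - c₂ := by
      simp only [V', id]
      rw [← hQ]
      ring
    have hdd := hdiss τ hτ
    have h3 : 22 * b ^ 4 * (1 + (S τ).diss μ) * (1 + (S τ).diss μ + (S τ).accSq p μ)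
        ≤ q * (1 + d + (S τ).accSq p μ) := by
      rw [hq]; gcongr
    have h4 := mul_le_mul_of_nonneg_left (h1.trans (add_le_add le_rfl h3)) hτ.1
    have h5 : τ * (q * (1 + d + (S τ).accSq p μ)) ≤ T * (q * (1 + d + (S τ).accSq p μ)) :=
      mul_le_mul_of_nonneg_right hτ.2 (by positivity)
    have h6 := mul_le_mul_of_nonneg_left h2 hc₁0
    have h7 : c₁ * ((2 * R)⁻¹ * (S τ).accSq p μ) = (1 + T * q) * (S τ).accSq p μ := by
      rw [hc₁]; field_simp
    rw [e, hc₂]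
    linarith
  have hV0 : V 0 ≤ c₁ * w := by
    simp only [hV, zero_mul, zero_add, mul_zero, sub_zero]
    exact mul_le_mul_of_nonneg_left hW0 hc₁0
  intro t ht
  have hVle : V t ≤ V 0 := le_of_hasDeriv_nonpos hVder (fun r hr => (hV'le r hr).trans (by
      have := (hB r hr).1.accDiss_nonneg
      rw [neg_nonpos]; exact mul_nonneg hr.1 this)) ht
  have hct : c₂ * t ≤ c₂ * T := mul_le_mul_of_nonneg_left ht.2 hc₂0
  have hcW : 0 ≤ c₁ * W t := mul_nonneg hc₁0 (hWnn t ht)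
  have hRw : 0 ≤ 2 * R * w := by positivity
  have hcw : 0 ≤ c₁ * w := by positivity
  have hcT : 0 ≤ c₂ * T := by positivity
  have htA : 0 ≤ t * (S t).accSq p μ := mul_nonneg ht.1 (hB t ht).1.accSq_nonneg
  refine ⟨by linarith [hdiss t ht], ?_, ?_, ?_⟩
  · simp only [hV] at hVle hV0
    linarith
  · refine (lintegral_le_of_hasDeriv (T := T) (fun τ hτ => (hWder τ hτ).const_mul (2 * R))
      h.continuousOn_accSq
      (fun τ hτ => MeshState.accSq_nonneg p μ (h.ordered hτ) (h.dens_pos hτ)) (fun τ hτ => ?_)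
      ht).trans (ENNReal.ofReal_le_ofReal ?_)
    · have h1 := mul_le_mul_of_nonneg_left (hW'le τ hτ) (by positivity : 0 ≤ 2 * R)
      rwa [mul_neg, mul_inv_cancel_left₀ (by positivity)] at h1
    · have h1 : 0 ≤ 2 * R * W t := mul_nonneg (by positivity) (hWnn t ht)
      have h2 := mul_le_mul_of_nonneg_left hW0 (by positivity : 0 ≤ 2 * R)
      linarith
  · refine (lintegral_le_of_hasDeriv (T := T) hVder
      (continuousOn_id.mul h.continuousOn_accDiss) (fun τ hτ => ?_) hV'le ht).trans
      (ENNReal.ofReal_le_ofReal ?_)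
    · exact mul_nonneg hτ (Finset.sum_nonneg fun j _ => mul_nonneg (mul_nonneg
        ((laws.μ_pos.choose_spec.1.le.trans (laws.μ_pos.choose_spec.2 _ (h.color_mem hτ j))))
        (sq_nonneg _)) (dx_pos (h.ordered hτ) j).le)
    · simp only [hV] at hV0 ⊢
      linarith

end IsFlow

end SemiDiscrete

namespace SemiDiscrete

/-! ### Space derivatives and integrals of the reconstructions -/

namespace MeshState

open Filter Topology

variable {J : ℕ} {p : ℝ → ℝ → ℝ} {μ : ℝ → ℝ} {b : ℝ} {s : MeshState J}

theorem uHat_eq_interp (s : MeshState J) : s.uHat = interp s.x s.u := rfl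

theorem zHat_eq_interp (p : ℝ → ℝ → ℝ) (μ : ℝ → ℝ) (s : MeshState J) :
    s.zHat p μ = interp s.center (s.flux p μ) := by
  ext y
  simp only [zHat, interp, center_sub]

/-- The slope of the reconstructed flux between the centres of the cells `j - 1` and `j`. -/
noncomputable def fluxSlope (p : ℝ → ℝ → ℝ) (μ : ℝ → ℝ) (s : MeshState J) (j : ℤ) : ℝ :=
  (s.flux p μ j - s.flux p μ (j - 1)) / s.dxNode j

theorem fluxSlope_succ (j : ℤ) : s.fluxSlope p μ (j + 1)
    = (s.flux p μ (j + 1) - s.flux p μ j) / (s.center (j + 1) - s.center j) := by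
  rw [fluxSlope, add_sub_cancel_right, center_sub]

theorem dxNode_add_period (j : ℤ) : s.dxNode (j + J) = s.dxNode j := by
  simp only [dxNode, add_period_sub_one, s.dx_add_period]

theorem fluxSlope_add_period (j : ℤ) : s.fluxSlope p μ (j + J) = s.fluxSlope p μ j := by
  simp only [fluxSlope, add_period_sub_one, s.flux_add_period, s.dxNode_add_period]

theorem sum_dxNode_mul {f : ℤ → ℝ} (hf : Function.Periodic f (J : ℤ)) :
    ∑ j ∈ Finset.range J, s.dxNode (j : ℤ) * f j
      = ∑ j ∈ Finset.range J, s.dx (j : ℤ) * ((f ((j : ℤ) + 1) + f j) / 2) :=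
  sum_node_mul s.dx_add_period hf

/-- Convexity of the square inside a cell, followed by the exact integral of the affine majorant:
each end point receives half the cell mass, so the constant is one. -/
theorem lintegral_kinetic_le (hJ : 1 ≤ J) (hs : ∀ j : ℤ, s.x j < s.x (j + 1))
    (hρ : ∀ j, 0 < s.ρ j) :
    ∫⁻ y in Ioo (0 : ℝ) 1, ENNReal.ofReal (s.rhoHat y * |s.uHat y| ^ 2)
      ≤ ENNReal.ofReal (∑ j ∈ Finset.range J, s.nodeMass (j : ℤ) * s.u (j : ℤ) ^ 2) := by
  have hm := isMesh_x hJ hs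
  refine (hm.lintegral_le (b := fun j y => ENNReal.ofReal
    ((y - s.x j) / (s.x (j + 1) - s.x j) * (s.ρ j * s.u (j + 1) ^ 2)
      + (s.x (j + 1) - y) / (s.x (j + 1) - s.x j) * (s.ρ j * s.u j ^ 2))) (fun j y => ?_)
    fun j y hy => ENNReal.ofReal_le_ofReal ?_).trans ?_
  · simp only [add_period_add_one, s.x_periodic, s.ρ_periodic, s.u_periodic,
      add_sub_add_right_eq_sub]
  · have h1 := sq_affine_le (α := s.u (j + 1)) (β := s.u j) ⟨hy.1.le, hy.2.le⟩ (hs j)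
    rw [sq_abs, rhoHat, uHat_eq_interp, interp_eq hm.strictMono hy.1.le hy.2,
      index_eq hm.strictMono hy.1.le hy.2]
    have := mul_le_mul_of_nonneg_left h1 (hρ j).le
    linarith
  · have e : ∑ j ∈ Finset.range J, s.nodeMass (j : ℤ) * s.u (j : ℤ) ^ 2
        = ∑ j ∈ Finset.range J, s.ρ (j : ℤ) * s.dx j * ((s.u ((j : ℤ) + 1) ^ 2 + s.u j ^ 2) / 2) :=
      sum_node_mul (m := fun j => s.ρ j * s.dx j) (f := fun j => s.u j ^ 2)
        (fun j => by simp only [s.ρ_periodic, s.dx_add_period])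
        (fun j => by simp only [s.u_periodic])
    rw [e, ENNReal.ofReal_sum_of_nonneg fun j _ => by
      have := hρ j; have := dx_pos hs (j : ℤ); positivity]
    refine Finset.sum_le_sum fun j _ => ?_
    have h0 := (hρ j).le
    rw [lintegral_affine (hs j) (by positivity) (by positivity)]
    refine ENNReal.ofReal_le_ofReal (le_of_eq ?_)
    simp only [dx]; ring

theorem lintegral_internal_le (hJ : 1 ≤ J) (hs : ∀ j : ℤ, s.x j < s.x (j + 1)) {H : ℝ → ℝ → ℝ}
    (hH : ∀ y, 0 ≤ H (s.rhoHat y) (s.cHat y)) :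
    ∫⁻ y in Ioo (0 : ℝ) 1, ENNReal.ofReal (H (s.rhoHat y) (s.cHat y))
      ≤ ENNReal.ofReal (∑ j ∈ Finset.range J, H (s.ρ (j : ℤ)) (s.c (j : ℤ)) * s.dx (j : ℤ)) ∧
    0 ≤ ∑ j ∈ Finset.range J, H (s.ρ (j : ℤ)) (s.c (j : ℤ)) * s.dx (j : ℤ) := by
  have hm := isMesh_x hJ hs
  -- The sign of `H` is known only at reconstructed values; the left end point of a cell realizes
  -- its pair of values.
  have h0 : ∀ j : ℤ, 0 ≤ H (s.ρ j) (s.c j) := fun j => by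
    have := hH (s.x j)
    rwa [rhoHat, cHat, index_eq hm.strictMono le_rfl (hs j)] at this
  refine ⟨hm.lintegral_const_le (b := fun j => H (s.ρ j) (s.c j))
    (fun j => by simp only [s.ρ_periodic, s.c_periodic]) h0 fun j y hy => ?_,
    Finset.sum_nonneg fun j _ => mul_nonneg (h0 j) (dx_pos hs j).le⟩
  rw [rhoHat, cHat, index_eq hm.strictMono hy.1.le hy.2]

theorem deriv_uHat (hJ : 1 ≤ J) (hs : ∀ j : ℤ, s.x j < s.x (j + 1)) {j : ℤ} {y : ℝ}
    (hy : y ∈ Ioo (s.x j) (s.x (j + 1))) : deriv s.uHat y = s.gradU j :=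
  (hasDerivAt_interp (isMesh_x hJ hs).strictMono hy).deriv

theorem lintegral_dissipation_le (hJ : 1 ≤ J) (hs : ∀ j : ℤ, s.x j < s.x (j + 1))
    (hμ : ∀ j, 0 ≤ μ (s.c j)) :
    ∫⁻ y in Ioo (0 : ℝ) 1, ENNReal.ofReal (μ (s.cHat y) * |deriv s.uHat y| ^ 2)
      ≤ ENNReal.ofReal (s.diss μ) := by
  have hm := isMesh_x hJ hs
  refine hm.lintegral_const_le (b := fun j => μ (s.c j) * s.gradU j ^ 2)
    (fun j => by simp only [s.gradU_add_period, s.c_periodic])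
    (fun j => mul_nonneg (hμ j) (sq_nonneg _)) fun j y hy => ?_
  rw [deriv_uHat hJ hs hy, cHat, index_eq hm.strictMono hy.1.le hy.2, sq_abs]

namespace IsBounded

theorem lintegral_deriv_uHat_le (h : s.IsBounded p μ b) :
    ∫⁻ y in Ioo (0 : ℝ) 1, ENNReal.ofReal (deriv s.uHat y ^ 2) ≤ ENNReal.ofReal (b * s.diss μ) := by
  refine ((isMesh_x h.one_le_card h.ordered).lintegral_const_le (b := fun j => s.gradU j ^ 2)
    (fun j => by simp only [s.gradU_add_period]) (fun j => sq_nonneg _) fun j y hy => ?_).trans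
    (ENNReal.ofReal_le_ofReal h.sum_gradU_sq_le)
  rw [deriv_uHat h.one_le_card h.ordered hy]

theorem sum_dxNode_mul_sq_le (h : s.IsBounded p μ b) (f : ℤ → ℝ) :
    ∑ j ∈ Finset.range J, s.dxNode (j : ℤ) * f j ^ 2
      ≤ b * ∑ j ∈ Finset.range J, s.nodeMass (j : ℤ) * f j ^ 2 := by
  rw [Finset.mul_sum]
  refine Finset.sum_le_sum fun j _ => ?_
  rw [← mul_assoc]
  exact mul_le_mul_of_nonneg_right (h.dxNode_le j) (sq_nonneg _)

theorem sq_le (h : s.IsBounded p μ b) {f : ℤ → ℝ} (hf : Function.Periodic f (J : ℤ)) {l : ℝ}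
    (hl : 0 < l) (j : ℤ) :
    f j ^ 2 ≤ (1 + l) * (b * ∑ i ∈ Finset.range J, s.nodeMass (i : ℤ) * f i ^ 2)
      + l⁻¹ * (b * ∑ i ∈ Finset.range J, μ (s.c i) * s.grad f i ^ 2 * s.dx (i : ℤ)) := by
  refine (sq_le_of_mesh h.one_le_card hf s.dx_add_period h.dx_pos s.sum_dx hl j).trans ?_
  refine add_le_add (mul_le_mul_of_nonneg_left (h.sum_dxNode_mul_sq_le f) (by positivity))
    (mul_le_mul_of_nonneg_left (le_trans (le_of_eq ?_) (h.sum_sq_le (s.grad f))) (by positivity))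
  refine Finset.sum_congr rfl fun i _ => ?_
  have := (h.dx_pos i).ne'
  rw [grad]; field_simp

theorem u_sq_le (h : s.IsBounded p μ b) (j : ℤ) :
    s.u j ^ 2 ≤ 2 * b * ∑ i ∈ Finset.range J, s.nodeMass (i : ℤ) * s.u i ^ 2 + b * s.diss μ := by
  have := h.sq_le s.u_periodic one_pos j
  have e : ∑ i ∈ Finset.range J, μ (s.c i) * s.grad s.u i ^ 2 * s.dx (i : ℤ) = s.diss μ := rfl
  rw [e] at this
  linarith

/-- The slope is the acceleration times node mass over dual length, a mean density, hence at most
`b`. -/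
theorem fluxSlope_sq_le (h : s.IsBounded p μ b) (j : ℤ) :
    s.fluxSlope p μ j ^ 2 ≤ b ^ 2 * s.acc p μ j ^ 2 := by
  have hM := nodeMass_mul_acc p μ h.ordered h.dens_pos j
  have hN := dxNode_pos h.ordered j
  have h1 : s.nodeMass j / s.dxNode j ≤ b := (div_le_iff₀ hN).2 (h.nodeMass_le j)
  have h2 : 0 ≤ s.nodeMass j / s.dxNode j :=
    div_nonneg (nodeMass_pos h.ordered h.dens_pos j).le hN.le
  rw [fluxSlope, ← hM, mul_div_right_comm, mul_pow]
  gcongr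

theorem sum_fluxSlope_sq_le (h : s.IsBounded p μ b) :
    ∑ j ∈ Finset.range J, s.dxNode (j : ℤ) * s.fluxSlope p μ j ^ 2 ≤ b ^ 3 * s.accSq p μ := by
  calc _ ≤ ∑ j ∈ Finset.range J, b ^ 2 * (s.dxNode (j : ℤ) * s.acc p μ j ^ 2) :=
        Finset.sum_le_sum fun j _ => by
          have := mul_le_mul_of_nonneg_left (h.fluxSlope_sq_le j) (dxNode_pos h.ordered j).le
          linarith
    _ ≤ b ^ 2 * (b * s.accSq p μ) := by
        rw [← Finset.mul_sum]
        exact mul_le_mul_of_nonneg_left (h.sum_dxNode_mul_sq_le _) (sq_nonneg b)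
    _ = _ := by ring

theorem lintegral_deriv_zHat_le (h : s.IsBounded p μ b) :
    ∫⁻ y in Ioo (0 : ℝ) 1, ENNReal.ofReal (|deriv (s.zHat p μ) y| ^ 2)
      ≤ ENNReal.ofReal (b ^ 3 * s.accSq p μ) := by
  have hm := isMesh_center h.one_le_card h.ordered
  have hper : Function.Periodic (fun j => s.fluxSlope p μ j ^ 2) (J : ℤ) := fun j => by
    simp only [s.fluxSlope_add_period]
  refine (hm.lintegral_const_le (b := fun j => s.fluxSlope p μ (j + 1) ^ 2)
    (fun j => by simp only [add_period_add_one, s.fluxSlope_add_period]) (fun j => sq_nonneg _)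
    fun j y hy => ?_).trans (ENNReal.ofReal_le_ofReal (le_trans (le_of_eq ?_) h.sum_fluxSlope_sq_le))
  · rw [zHat_eq_interp, (hasDerivAt_interp hm.strictMono hy).deriv, sq_abs, fluxSlope_succ]
  · rw [← sum_periodic_shift (J := J) (f := fun j => s.dxNode j * s.fluxSlope p μ j ^ 2) fun j => by
      simp only [s.fluxSlope_add_period, s.dxNode_add_period]]
    refine Finset.sum_congr rfl fun j _ => ?_
    rw [center_sub, mul_comm]

theorem abs_deriv_zHat_sq_le (h : s.IsBounded p μ b) {l : ℝ} (hl : 0 < l) (y : ℝ) :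
    |deriv (s.zHat p μ) y| ^ 2
      ≤ b ^ 3 * ((1 + l) * s.accSq p μ + l⁻¹ * s.accDiss p μ) := by
  obtain ⟨j, hj⟩ := (isMesh_center h.one_le_card h.ordered).exists_abs_deriv_interp_le
    (s.flux p μ) y
  rw [← fluxSlope_succ, ← zHat_eq_interp] at hj
  have h1 := pow_le_pow_left₀ (abs_nonneg _) hj 2
  rw [sq_abs (s.fluxSlope p μ (j + 1))] at h1
  refine h1.trans ((h.fluxSlope_sq_le _).trans ?_)
  have h2 := mul_le_mul_of_nonneg_left (h.sq_le (s.acc_add_period p μ) hl (j + 1)) (sq_nonneg b)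
  refine h2.trans (le_of_eq ?_)
  simp only [accSq, accDiss]
  ring

/-- The three terms of `fluxDot` are squared separately, and `gradU_sq_le` reduces the fourth power
of the velocity gradient to a square. Thus only `accDiss` enters beyond `accSq` and `diss`. -/
theorem sum_fluxDot_sq_le (h : s.IsBounded p μ b) :
    ∑ j ∈ Finset.range J, s.dx (j : ℤ) * s.fluxDot p μ j ^ 2
      ≤ 3 * b ^ 3 * (s.accDiss p μ
        + (10 * b ^ 4 * (1 + s.diss μ + s.accSq p μ) + 1) * s.diss μ) := by
  set G := 10 * b ^ 4 * (1 + s.diss μ + s.accSq p μ) with hG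
  have hb := h.pos
  have h1 : ∑ j ∈ Finset.range J, s.dx (j : ℤ) * s.fluxDot p μ j ^ 2
      ≤ 3 * b ^ 2 * (∑ j ∈ Finset.range J, s.grad (s.acc p μ) j ^ 2 * s.dx (j : ℤ)
        + (G + 1) * ∑ j ∈ Finset.range J, s.gradU (j : ℤ) ^ 2 * s.dx (j : ℤ)) := by
    rw [Finset.mul_sum (Finset.range J) _ (G + 1), ← Finset.sum_add_distrib, Finset.mul_sum]
    refine Finset.sum_le_sum fun j _ => ?_
    have hg := h.gradU_sq_le j
    have hw := h.pressure_deriv j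
    have hμ := (h.visc_pos j).le
    have hμ1 := h.visc_upper j
    rw [fluxDot]
    rw [← hG] at hg
    set m := μ (s.c j)
    set g := s.gradU j
    set α := s.grad (s.acc p μ) j
    set w := deriv (p (s.c j)) (s.ρ j) * s.ρ j with hwdef
    have e1 : m * (α - g ^ 2) + deriv (p (s.c j)) (s.ρ j) * (s.ρ j * g)
        = m * α - m * g ^ 2 + w * g := by rw [hwdef]; ring
    have e2 : 3 * b ^ 2 * (α ^ 2 * s.dx j + (G + 1) * (g ^ 2 * s.dx j))
        = s.dx j * (3 * (b ^ 2 * α ^ 2 + b ^ 2 * (G * g ^ 2) + b ^ 2 * g ^ 2)) := by ring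
    rw [e1, e2]
    refine mul_le_mul_of_nonneg_left ?_ (h.dx_pos j).le
    have hm2 : m ^ 2 ≤ b ^ 2 := pow_le_pow_left₀ hμ hμ1 2
    have hw2 : w ^ 2 ≤ b ^ 2 := sq_le_sq.2 (hw.trans (le_abs_self _))
    have h2 : (m * α - m * g ^ 2 + w * g) ^ 2
        ≤ 3 * ((m * α) ^ 2 + (m * g ^ 2) ^ 2 + (w * g) ^ 2) := by
      nlinarith [sq_nonneg (m * α + m * g ^ 2), sq_nonneg (m * α - w * g),
        sq_nonneg (m * g ^ 2 + w * g)]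
    have h3 : (m * α) ^ 2 ≤ b ^ 2 * α ^ 2 := by rw [mul_pow]; gcongr
    have h4 : (w * g) ^ 2 ≤ b ^ 2 * g ^ 2 := by rw [mul_pow]; gcongr
    have h5 : (m * g ^ 2) ^ 2 ≤ b ^ 2 * (G * g ^ 2) := by
      rw [mul_pow, sq (g ^ 2)]; gcongr
    linarith
  refine h1.trans ?_
  have hG0 : 0 ≤ G + 1 := by
    have := h.diss_nonneg; have := h.accSq_nonneg; positivity
  have h2 : ∑ j ∈ Finset.range J, s.grad (s.acc p μ) j ^ 2 * s.dx (j : ℤ) ≤ b * s.accDiss p μ :=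
    h.sum_sq_le _
  have h3 := mul_le_mul_of_nonneg_left h.sum_gradU_sq_le hG0
  calc _ ≤ 3 * b ^ 2 * (b * s.accDiss p μ + (G + 1) * (b * s.diss μ)) := by gcongr
    _ = _ := by ring

end IsBounded

end MeshState

/-! ### Time derivatives of the reconstructions -/

namespace IsFlow

open MeshState Filter Topology

variable {p : ℝ → ℝ → ℝ} {μ : ℝ → ℝ} {cLo cHi ρLo ρHi K : ℝ} {J : ℕ} {s₀ : MeshState J}
  {S : ℝ → MeshState J} {t b : ℝ}

theorem hasDerivAt_uHat (h : IsFlow p μ cLo cHi ρLo ρHi K s₀ S) (ht : 0 < t) {j : ℤ} {y : ℝ}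
    (hy : y ∈ Ioo ((S t).x j) ((S t).x (j + 1))) :
    HasDerivAt (fun τ => (S τ).uHat y)
      ((y - (S t).x j) / ((S t).x (j + 1) - (S t).x j)
          * ((S t).acc p μ (j + 1) - (S t).gradU j * (S t).u (j + 1))
        + ((S t).x (j + 1) - y) / ((S t).x (j + 1) - (S t).x j)
          * ((S t).acc p μ j - (S t).gradU j * (S t).u j)) t := by
  have hn := Ici_mem_nhds ht
  exact hasDerivAt_interp_time (A := fun τ => (S τ).x) (V := fun τ => (S τ).u)
    (by filter_upwards [hn] with τ hτ using (isMesh_x h.one_le (h.ordered hτ)).strictMono)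
    (fun k => (h.sol.position t ht.le k).hasDerivAt hn)
    (fun k => (h.hasDeriv_u ht.le k).hasDerivAt hn) hy

theorem hasDeriv_center (h : IsFlow p μ cLo cHi ρLo ρHi K s₀ S) (ht : 0 ≤ t) (j : ℤ) :
    HasDerivWithinAt (fun τ => (S τ).center j) (((S t).u j + (S t).u (j + 1)) / 2) (Ici 0) t :=
  ((h.sol.position t ht j).add (h.sol.position t ht (j + 1))).div_const 2

theorem hasDerivAt_zHat (h : IsFlow p μ cLo cHi ρLo ρHi K s₀ S) (ht : 0 < t) {j : ℤ} {y : ℝ}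
    (hy : y ∈ Ioo ((S t).center j) ((S t).center (j + 1))) :
    HasDerivAt (fun τ => (S τ).zHat p μ y)
      ((y - (S t).center j) / ((S t).center (j + 1) - (S t).center j)
          * ((S t).fluxDot p μ (j + 1) - (S t).fluxSlope p μ (j + 1)
            * (((S t).u (j + 1) + (S t).u (j + 1 + 1)) / 2))
        + ((S t).center (j + 1) - y) / ((S t).center (j + 1) - (S t).center j)
          * ((S t).fluxDot p μ j - (S t).fluxSlope p μ (j + 1)
            * (((S t).u j + (S t).u (j + 1)) / 2))) t := by
  have hn := Ici_mem_nhds ht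
  simp only [zHat_eq_interp, fluxSlope_succ]
  exact hasDerivAt_interp_time (A := fun τ => (S τ).center) (V := fun τ => (S τ).flux p μ)
    (by filter_upwards [hn] with τ hτ using (isMesh_center h.one_le (h.ordered hτ)).strictMono)
    (fun k => (h.hasDeriv_center ht.le k).hasDerivAt hn)
    (fun k => (h.hasDeriv_flux ht.le k).hasDerivAt hn) hy

theorem ae_hasPartials (h : IsFlow p μ cLo cHi ρLo ρHi K s₀ S) (ht : 0 < t) :
    ∀ᵐ y : ℝ, HasPartials (fun t y => (S t).uHat y) t y ∧
      HasPartials (fun t y => (S t).zHat p μ y) t y := by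
  have hx := isMesh_x h.one_le (h.ordered ht.le)
  have hc := isMesh_center h.one_le (h.ordered ht.le)
  filter_upwards [hx.ae_mem_Ioo, hc.ae_mem_Ioo] with y h1 h2
  refine ⟨⟨(h.hasDerivAt_uHat ht h1).differentiableAt,
    (hasDerivAt_interp hx.strictMono h1).differentiableAt⟩,
    ⟨(h.hasDerivAt_zHat ht h2).differentiableAt, ?_⟩⟩
  simp only [zHat_eq_interp]
  exact (hasDerivAt_interp hc.strictMono h2).differentiableAt

theorem lintegral_partialT_uHat_le (h : IsFlow p μ cLo cHi ρLo ρHi K s₀ S) (ht : 0 < t)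
    (hb : (S t).IsBounded p μ b) {U : ℝ} (hU0 : 0 ≤ U) (hU : ∀ j, (S t).u j ^ 2 ≤ U) :
    ∫⁻ y in Ioo (0 : ℝ) 1, ENNReal.ofReal (partialT (fun t y => (S t).uHat y) t y ^ 2)
      ≤ ENNReal.ofReal (4 * b * (S t).accSq p μ + 4 * U * b * (S t).diss μ) := by
  set s := S t
  have hs := hb.ordered
  refine ((isMesh_x hb.one_le_card hs).lintegral_const_le
    (b := fun j => 2 * (s.acc p μ (j + 1) ^ 2 + s.acc p μ j ^ 2) + 4 * U * s.gradU j ^ 2)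
    (fun j => by simp only [add_period_add_one, s.acc_add_period, s.gradU_add_period])
    (fun j => by positivity) fun j y hy => ?_).trans (ENNReal.ofReal_le_ofReal ?_)
  · rw [partialT, (h.hasDerivAt_uHat ht hy).deriv]
    refine (sq_affine_le_add ⟨hy.1.le, hy.2.le⟩ (hs j)).trans ?_
    have h1 := mul_le_mul_of_nonneg_left (hU (j + 1)) (sq_nonneg (s.gradU j))
    have h2 := mul_le_mul_of_nonneg_left (hU j) (sq_nonneg (s.gradU j))
    nlinarith [sq_nonneg (s.acc p μ (j + 1) + s.gradU j * s.u (j + 1)),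
      sq_nonneg (s.acc p μ j + s.gradU j * s.u j)]
  · have e : ∑ j ∈ Finset.range J, (2 * (s.acc p μ ((j : ℤ) + 1) ^ 2 + s.acc p μ j ^ 2)
          + 4 * U * s.gradU j ^ 2) * (s.x ((j : ℤ) + 1) - s.x j)
        = 4 * ∑ j ∈ Finset.range J, s.dxNode (j : ℤ) * s.acc p μ j ^ 2
          + 4 * U * ∑ j ∈ Finset.range J, s.gradU (j : ℤ) ^ 2 * s.dx (j : ℤ) := by
      rw [sum_dxNode_mul (f := fun j => s.acc p μ j ^ 2) fun j => by
        simp only [s.acc_add_period], Finset.mul_sum, Finset.mul_sum, ← Finset.sum_add_distrib]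
      refine Finset.sum_congr rfl fun j _ => ?_
      simp only [dx]; ring
    rw [e]
    have h1 : ∑ j ∈ Finset.range J, s.dxNode (j : ℤ) * s.acc p μ j ^ 2 ≤ b * s.accSq p μ :=
      hb.sum_dxNode_mul_sq_le _
    have h2 := mul_le_mul_of_nonneg_left hb.sum_gradU_sq_le (by positivity : 0 ≤ 4 * U)
    linarith

/-- Flux derivatives are weighted by cell lengths, but the interpolant lives on dual cells, whose
length must be bounded by each adjacent cell; the mesh ratio supplies this. For the velocity the
lengths of the two cells at a node add up to the correct dual weight. -/
theorem lintegral_partialT_zHat_le (h : IsFlow p μ cLo cHi ρLo ρHi K s₀ S) (ht : 0 < t)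
    (hb : (S t).IsBounded p μ b) {U : ℝ} (hU0 : 0 ≤ U) (hU : ∀ j, (S t).u j ^ 2 ≤ U) {κ : ℝ}
    (hκ : (S t).MeshRatioLE κ) :
    ∫⁻ y in Ioo (0 : ℝ) 1, ENNReal.ofReal (partialT (fun t y => (S t).zHat p μ y) t y ^ 2)
      ≤ ENNReal.ofReal (4 * (1 + κ) * ∑ j ∈ Finset.range J,
          (S t).dx (j : ℤ) * (S t).fluxDot p μ j ^ 2 + 4 * U * (b ^ 3 * (S t).accSq p μ)) := by
  set s := S t
  have hs := hb.ordered
  have hc := isMesh_center hb.one_le_card hs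
  refine (hc.lintegral_const_le
    (b := fun j => 2 * (s.fluxDot p μ (j + 1) ^ 2 + s.fluxDot p μ j ^ 2)
      + 4 * U * s.fluxSlope p μ (j + 1) ^ 2)
    (fun j => by simp only [add_period_add_one, s.fluxDot_add_period, s.fluxSlope_add_period])
    (fun j => by positivity) fun j y hy => ?_).trans (ENNReal.ofReal_le_ofReal ?_)
  · rw [partialT, (h.hasDerivAt_zHat ht hy).deriv]
    refine (sq_affine_le_add ⟨hy.1.le, hy.2.le⟩ (hc.lt_succ j)).trans ?_
    have key : ∀ α σ v w : ℝ, v ^ 2 ≤ U → w ^ 2 ≤ U →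
        (α - σ * ((v + w) / 2)) ^ 2 ≤ 2 * α ^ 2 + 2 * U * σ ^ 2 := fun α σ v w hv hw => by
      have h1 : ((v + w) / 2) ^ 2 ≤ U := by nlinarith [sq_nonneg (v - w)]
      have h2 := mul_le_mul_of_nonneg_left h1 (sq_nonneg σ)
      nlinarith [sq_nonneg (α + σ * ((v + w) / 2))]
    have h1 := key (s.fluxDot p μ (j + 1)) (s.fluxSlope p μ (j + 1)) _ _ (hU (j + 1)) (hU (j + 1 + 1))
    have h2 := key (s.fluxDot p μ j) (s.fluxSlope p μ (j + 1)) _ _ (hU j) (hU (j + 1))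
    linarith
  · have e1 : ∑ j ∈ Finset.range J, s.dx ((j : ℤ) + 1) * s.fluxDot p μ ((j : ℤ) + 1) ^ 2
        = ∑ j ∈ Finset.range J, s.dx (j : ℤ) * s.fluxDot p μ j ^ 2 :=
      sum_periodic_shift (f := fun j => s.dx j * s.fluxDot p μ j ^ 2) fun j => by
        simp only [s.dx_add_period, s.fluxDot_add_period]
    have e2 : ∑ j ∈ Finset.range J, s.dxNode ((j : ℤ) + 1) * s.fluxSlope p μ ((j : ℤ) + 1) ^ 2
        = ∑ j ∈ Finset.range J, s.dxNode (j : ℤ) * s.fluxSlope p μ j ^ 2 :=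
      sum_periodic_shift (f := fun j => s.dxNode j * s.fluxSlope p μ j ^ 2) fun j => by
        simp only [s.dxNode_add_period, s.fluxSlope_add_period]
    have h1 : ∑ j ∈ Finset.range J, (2 * (s.fluxDot p μ ((j : ℤ) + 1) ^ 2 + s.fluxDot p μ j ^ 2)
          + 4 * U * s.fluxSlope p μ ((j : ℤ) + 1) ^ 2) * (s.center ((j : ℤ) + 1) - s.center j)
        ≤ ∑ j ∈ Finset.range J, (2 * (1 + κ) * (s.dx ((j : ℤ) + 1) * s.fluxDot p μ ((j : ℤ) + 1) ^ 2)
          + 2 * (1 + κ) * (s.dx (j : ℤ) * s.fluxDot p μ j ^ 2)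
          + 4 * U * (s.dxNode ((j : ℤ) + 1) * s.fluxSlope p μ ((j : ℤ) + 1) ^ 2)) := by
      refine Finset.sum_le_sum fun j _ => ?_
      obtain ⟨k1, k2⟩ := hκ j
      have d1 := hb.dx_pos j
      have d2 := hb.dx_pos ((j : ℤ) + 1)
      have hN : s.dxNode ((j : ℤ) + 1) = (s.dx j + s.dx ((j : ℤ) + 1)) / 2 := by
        rw [dxNode, add_sub_cancel_right]
      have n1 : s.dxNode ((j : ℤ) + 1) ≤ (1 + κ) * s.dx j := by rw [hN]; linarith
      have n2 : s.dxNode ((j : ℤ) + 1) ≤ (1 + κ) * s.dx ((j : ℤ) + 1) := by rw [hN]; linarith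
      have m1 := mul_le_mul_of_nonneg_right n1 (sq_nonneg (s.fluxDot p μ j))
      have m2 := mul_le_mul_of_nonneg_right n2 (sq_nonneg (s.fluxDot p μ ((j : ℤ) + 1)))
      rw [center_sub]
      linarith
    refine h1.trans ?_
    rw [Finset.sum_add_distrib, Finset.sum_add_distrib, ← Finset.mul_sum, ← Finset.mul_sum,
      ← Finset.mul_sum, e1, e2]
    have h2 := mul_le_mul_of_nonneg_left hb.sum_fluxSlope_sq_le (by positivity : 0 ≤ 4 * U)
    linarith

end IsFlow

end SemiDiscrete

namespace SemiDiscrete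

/-! ### Norms, Young's inequality and the singular time weight -/

section Norms

theorem eLpNorm_two_le {α : Type*} [MeasurableSpace α] {ν : Measure α} {g : α → ℝ} {X : ℝ}
    (h : ∫⁻ a, ENNReal.ofReal (g a ^ 2) ∂ν ≤ ENNReal.ofReal X) :
    eLpNorm g 2 ν ≤ ENNReal.ofReal √(max X 0) := by
  rw [eLpNorm_eq_lintegral_rpow_enorm_toReal two_ne_zero ENNReal.ofNat_ne_top, Real.sqrt_eq_rpow,
    ← ENNReal.ofReal_rpow_of_nonneg (le_max_right _ _) (by norm_num), ENNReal.toReal_ofNat]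
  refine ENNReal.rpow_le_rpow ?_ (by norm_num)
  refine le_trans (le_of_eq ?_) (h.trans (ENNReal.ofReal_le_ofReal (le_max_left _ _)))
  refine lintegral_congr fun a => ?_
  rw [Real.enorm_eq_ofReal_abs, ENNReal.ofReal_rpow_of_nonneg (abs_nonneg _) (by norm_num),
    Real.rpow_ofNat, sq_abs]

/-- Only one inequality of Tonelli's theorem is used, and it holds without measurability. -/
theorem L2SpaceTime_le {g : ℝ → ℝ → ℝ} {t X : ℝ}
    (h : ∫⁻ τ in Ioo 0 t, ∫⁻ y in Ioo (0 : ℝ) 1, ENNReal.ofReal (g τ y ^ 2) ≤ ENNReal.ofReal X) :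
    L2SpaceTime t g ≤ ENNReal.ofReal √(max X 0) := by
  refine eLpNorm_two_le (le_trans ?_ h)
  rw [Measure.volume_eq_prod, ← Measure.prod_restrict]
  exact lintegral_prod_le _

/-- Young's inequality in the form `(y X)^θ ≤ X + y^{θ/(1-θ)}`. -/
theorem mul_rpow_le_add {X y θ : ℝ} (hX : 0 ≤ X) (hy : 0 ≤ y) (h0 : 0 < θ) (h1 : θ < 1) :
    (y * X) ^ θ ≤ X + y ^ (θ / (1 - θ)) := by
  have h2 : 0 < 1 - θ := sub_pos.2 h1
  have hq : 0 ≤ y ^ (θ / (1 - θ)) := Real.rpow_nonneg hy _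
  have key := Real.geom_mean_le_arith_mean2_weighted h0.le h2.le hX hq (by ring)
  rw [← Real.rpow_mul hy, div_mul_cancel₀ _ h2.ne', ← Real.mul_rpow hX hy, mul_comm X y] at key
  have h3 : θ * X ≤ X := mul_le_of_le_one_left hX h1.le
  have h4 : (1 - θ) * y ^ (θ / (1 - θ)) ≤ y ^ (θ / (1 - θ)) :=
    mul_le_of_le_one_left hq (by linarith)
  linarith

/-- Up to time `T` the weight is at most a constant times `τ^(-q/2)`, which is integrable at zero
since `q < 2`. -/
theorem exists_lintegral_weight_le {c q T : ℝ} (hc : 0 ≤ c) (hq0 : 0 ≤ q) (hq : q < 2)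
    (hT : 0 ≤ T) :
    ∃ C : ℝ, 0 ≤ C ∧ ∀ t ∈ Icc 0 T,
      ∫⁻ τ in Ioo 0 t, ENNReal.ofReal ((c * (1 + τ ^ (-(1 / 2 : ℝ)))) ^ q) ≤ ENNReal.ofReal C := by
  set k := (c * (1 + T ^ (1 / 2 : ℝ))) ^ q
  have hk : 0 ≤ k := by positivity
  have hint : IntegrableOn (fun τ : ℝ => k * τ ^ (-(q / 2))) (Ioc 0 T) := by
    have := intervalIntegral.intervalIntegrable_rpow' (a := 0) (b := T) (r := -(q / 2)) (by linarith)
    exact ((intervalIntegrable_iff_integrableOn_Ioc_of_le hT).1 this).const_mul k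
  have hfin : ∫⁻ τ in Ioc 0 T, ENNReal.ofReal (k * τ ^ (-(q / 2))) ≠ ⊤ := hint.lintegral_lt_top.ne
  refine ⟨(∫⁻ τ in Ioc 0 T, ENNReal.ofReal (k * τ ^ (-(q / 2)))).toReal, ENNReal.toReal_nonneg,
    fun t ht => ?_⟩
  rw [ENNReal.ofReal_toReal hfin]
  refine le_trans ?_ (lintegral_mono_set (μ := volume)
    (fun τ hτ => ⟨hτ.1, hτ.2.le.trans ht.2⟩ : Ioo 0 t ⊆ Ioc 0 T))
  refine setLIntegral_mono_ae' measurableSet_Ioo (ae_of_all _ fun τ hτ => ?_)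
  refine ENNReal.ofReal_le_ofReal ?_
  have hτ0 : 0 < τ := hτ.1
  have hτT : τ ≤ T := hτ.2.le.trans ht.2
  have e1 : (τ ^ (-(1 / 2 : ℝ))) ^ q = τ ^ (-(q / 2)) := by
    rw [← Real.rpow_mul hτ0.le]; congr 1; ring
  rw [← e1, ← Real.mul_rpow (by positivity) (by positivity)]
  refine Real.rpow_le_rpow (by positivity) ?_ hq0
  rw [mul_assoc]
  refine mul_le_mul_of_nonneg_left ?_ hc
  have h1 : τ ^ (1 / 2 : ℝ) * τ ^ (-(1 / 2 : ℝ)) = 1 := by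
    rw [← Real.rpow_add hτ0]; simp
  have h2 : τ ^ (1 / 2 : ℝ) ≤ T ^ (1 / 2 : ℝ) := Real.rpow_le_rpow hτ0.le hτT (by norm_num)
  have h3 := mul_le_mul_of_nonneg_right h2 (Real.rpow_nonneg hτ0.le (-(1 / 2 : ℝ)))
  linarith

end Norms

/-! ### Assembly of the continuous estimates -/

namespace IsFlow

open MeshState

variable {p : ℝ → ℝ → ℝ} {μ : ℝ → ℝ} {cLo cHi ρLo ρHi K : ℝ} {J : ℕ} {s₀ : MeshState J}
  {S : ℝ → MeshState J} {t b C : ℝ}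

theorem iInf_le_cHat (h : IsFlow p μ cLo cHi ρLo ρHi K s₀ S) (ht : 0 ≤ t) (y : ℝ) :
    (⨅ j : Fin J, s₀.c ((j : ℕ) : ℤ)) ≤ (S t).cHat y ∧
      (S t).cHat y ≤ ⨆ j : Fin J, s₀.c ((j : ℕ) : ℤ) := by
  obtain ⟨i, hi, hper⟩ := exists_nat_of_periodic h.one_le (index (S t).x y)
  rw [cHat, h.color_eq ht, hper _ s₀.c_periodic]
  exact ⟨ciInf_le (f := fun j : Fin J => s₀.c ((j : ℕ) : ℤ)) (finite_range _).bddBelow ⟨i, hi⟩,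
    le_ciSup (f := fun j : Fin J => s₀.c ((j : ℕ) : ℤ)) (finite_range _).bddAbove ⟨i, hi⟩⟩

/-- The reconstructed kinetic term is at most twice the discrete kinetic energy, and the dissipation
at most the energy drop. The excess is one kinetic energy at time `t`, itself at most the initial
energy since the internal part is nonnegative; hence the factor `2`. -/
theorem energy_inequality (h : IsFlow p μ cLo cHi ρLo ρHi K s₀ S) (ht : 0 ≤ t) {H : ℝ → ℝ → ℝ}
    (hH : IsInternalEnergy p cLo cHi H) (hH0 : ∀ y, 0 ≤ H ((S t).rhoHat y) ((S t).cHat y)) :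
    (∫⁻ x in Ioo (0 : ℝ) 1, ENNReal.ofReal ((S t).rhoHat x * |(S t).uHat x| ^ 2))
      + (∫⁻ x in Ioo (0 : ℝ) 1, ENNReal.ofReal (H ((S t).rhoHat x) ((S t).cHat x)))
      + (∫⁻ τ in Ioo (0 : ℝ) t, ∫⁻ x in Ioo (0 : ℝ) 1,
          ENNReal.ofReal (μ ((S τ).cHat x) * |deriv (S τ).uHat x| ^ 2))
      ≤ ENNReal.ofReal (2 * s₀.energy H) := by
  obtain ⟨m, hm, hμ⟩ := h.laws.μ_pos
  have hμ0 : ∀ τ, 0 ≤ τ → ∀ j, 0 ≤ μ ((S τ).c j) := fun τ hτ j =>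
    hm.le.trans (hμ _ (h.color_mem hτ j))
  have hd : ∀ τ, 0 ≤ τ → 0 ≤ (S τ).diss μ := fun τ hτ => diss_nonneg (h.ordered hτ) (hμ0 τ hτ)
  have h1 := lintegral_kinetic_le h.one_le (h.ordered ht) (h.dens_pos ht)
  obtain ⟨h2, h2'⟩ := lintegral_internal_le h.one_le (h.ordered ht) hH0
  have h3 : ∫⁻ τ in Ioo (0 : ℝ) t, ∫⁻ x in Ioo (0 : ℝ) 1,
      ENNReal.ofReal (μ ((S τ).cHat x) * |deriv (S τ).uHat x| ^ 2)
      ≤ ENNReal.ofReal (s₀.energy H - (S t).energy H) := by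
    have h4 := lintegral_le_of_hasDeriv (T := t) (fun τ hτ => h.hasDeriv_energy hH hτ)
      h.continuousOn_diss hd (fun τ _ => le_rfl) ⟨ht, le_rfl⟩
    rw [h.sol.initial] at h4
    refine le_trans (setLIntegral_mono_ae' measurableSet_Ioo (ae_of_all _ fun τ hτ => ?_)) h4
    exact lintegral_dissipation_le h.one_le (h.ordered hτ.1.le) (hμ0 τ hτ.1.le)
  have h5 : (S t).energy H ≤ s₀.energy H := by
    have := le_of_hasDeriv_nonpos (T := t) (fun τ hτ => h.hasDeriv_energy hH hτ)
      (fun τ hτ => neg_nonpos.2 (hd τ hτ.1)) ⟨ht, le_rfl⟩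
    rwa [h.sol.initial] at this
  refine (add_le_add (add_le_add h1 h2) h3).trans ?_
  have h6 : 0 ≤ ∑ j ∈ Finset.range J, (S t).nodeMass (j : ℤ) * (S t).u (j : ℤ) ^ 2 :=
    Finset.sum_nonneg fun j _ =>
      mul_nonneg (nodeMass_pos (h.ordered ht) (h.dens_pos ht) j).le (sq_nonneg _)
  rw [← ENNReal.ofReal_add h6 h2', ← ENNReal.ofReal_add (add_nonneg h6 h2') (by linarith)]
  refine ENNReal.ofReal_le_ofReal ?_
  have := energy_eq (h.ordered ht) H
  linarith

/-- Cell masses are conserved and densities bounded on both sides, so length ratios stay comparable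
with the initial ones. -/
theorem meshRatioLE (h : IsFlow p μ cLo cHi ρLo ρHi K s₀ S) (ht : 0 ≤ t)
    (hb : (S t).IsBounded p μ b) {κ : ℝ} (hκ : s₀.MeshRatioLE κ) :
    (S t).MeshRatioLE (b ^ 2 * (|ρHi| * |κ| * ρLo⁻¹)) := by
  have hb0 := hb.pos
  have d0 := dx_pos h.adm.ordered
  have key : ∀ i j : ℤ, s₀.dx i ≤ κ * s₀.dx j →
      (S t).dx i ≤ b ^ 2 * (|ρHi| * |κ| * ρLo⁻¹) * (S t).dx j := fun i j hij => by
    have h1 : (S t).dx i ≤ b * ((S t).ρ i * (S t).dx i) := by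
      have := mul_le_mul_of_nonneg_right (hb.dens_lower i) (hb.dx_pos i).le
      rwa [inv_mul_le_iff₀ hb0] at this
    have h2 : s₀.ρ i * s₀.dx i ≤ |ρHi| * s₀.dx i :=
      mul_le_mul_of_nonneg_right ((h.adm.ρ_mem i).2.trans (le_abs_self _)) (d0 i).le
    have h3 : s₀.dx i ≤ |κ| * s₀.dx j :=
      hij.trans (mul_le_mul_of_nonneg_right (le_abs_self _) (d0 j).le)
    have h4 : s₀.dx j ≤ ρLo⁻¹ * (s₀.ρ j * s₀.dx j) := by
      rw [← div_eq_inv_mul, le_div_iff₀ h.rho_pos, mul_comm]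
      exact mul_le_mul_of_nonneg_right (h.adm.ρ_mem j).1 (d0 j).le
    have h5 : (S t).ρ j * (S t).dx j ≤ b * (S t).dx j :=
      mul_le_mul_of_nonneg_right (hb.dens_upper j) (hb.dx_pos j).le
    have hr := inv_pos.2 h.rho_pos
    rw [← h.mass_eq ht j] at h4
    rw [h.mass_eq ht i] at h1
    calc (S t).dx i ≤ b * (s₀.ρ i * s₀.dx i) := h1
      _ ≤ b * (|ρHi| * (|κ| * (ρLo⁻¹ * (b * (S t).dx j)))) := by
          refine mul_le_mul_of_nonneg_left (h2.trans (mul_le_mul_of_nonneg_left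
            (h3.trans (mul_le_mul_of_nonneg_left (h4.trans (mul_le_mul_of_nonneg_left h5 hr.le))
              (abs_nonneg _))) (abs_nonneg _))) hb0.le
      _ = _ := by ring
  exact fun j => ⟨key _ _ (hκ j).1, key _ _ (hκ j).2⟩

/-- The bounds that hold uniformly for all flows up to time `T`. -/
structure HasUniformBounds (p : ℝ → ℝ → ℝ) (μ : ℝ → ℝ) (T b C : ℝ) (S : ℝ → MeshState J) :
    Prop where
  bounded : ∀ t ∈ Icc 0 T, (S t).IsBounded p μ b
  diss_le : ∀ t ∈ Icc 0 T, (S t).diss μ ≤ C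
  u_sq_le : ∀ t ∈ Icc 0 T, ∀ j, (S t).u j ^ 2 ≤ C
  accSq_le : ∀ t ∈ Icc 0 T, t * (S t).accSq p μ ≤ C
  lintegral_accSq_le : ∀ t ∈ Icc 0 T,
    ∫⁻ τ in Ioo 0 t, ENNReal.ofReal ((S τ).accSq p μ) ≤ ENNReal.ofReal C
  lintegral_accDiss_le : ∀ t ∈ Icc 0 T,
    ∫⁻ τ in Ioo 0 t, ENNReal.ofReal (τ * (S τ).accDiss p μ) ≤ ENNReal.ofReal C

theorem exists_hasUniformBounds (laws : ConstitutiveLaws p μ cLo cHi) (hρ : 0 < ρLo)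
    (ρHi K : ℝ) {T : ℝ} (hT : 0 ≤ T) :
    ∃ b C : ℝ, 0 < b ∧ 0 ≤ C ∧ ∀ (J : ℕ) (s₀ : MeshState J) (S : ℝ → MeshState J),
      IsFlow p μ cLo cHi ρLo ρHi K s₀ S → HasUniformBounds p μ T b C S := by
  obtain ⟨b, hb1, hb⟩ := exists_isBounded laws hρ ρHi K T
  obtain ⟨C, hC0, hC⟩ := exists_acceleration_bounds laws hρ ρHi K hT
  have hb0 : 0 < b := by linarith
  set C' := C + (2 * b * b + b * C)
  have hCC' : C ≤ C' := by
    have : 0 ≤ 2 * b * b + b * C := by positivity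
    linarith
  refine ⟨b, C', hb0, hC0.trans hCC', fun J s₀ S h => ⟨fun t ht => ((hb J s₀ S h).2 t ht).1,
    fun t ht => (hC J s₀ S h t ht).1.trans hCC', fun t ht j => ?_,
    fun t ht => (hC J s₀ S h t ht).2.1.trans hCC',
    fun t ht => (hC J s₀ S h t ht).2.2.1.trans (ENNReal.ofReal_le_ofReal hCC'),
    fun t ht => (hC J s₀ S h t ht).2.2.2.trans (ENNReal.ofReal_le_ofReal hCC')⟩⟩
  obtain ⟨h1, -, h2⟩ := (hb J s₀ S h).2 t ht
  have h3 := mul_le_mul_of_nonneg_left h2 (by positivity : 0 ≤ 2 * b)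
  have h4 := mul_le_mul_of_nonneg_left (hC J s₀ S h t ht).1 hb0.le
  have := h1.u_sq_le j
  linarith

/-- The common form of the time-integrated estimates: `accSq`, `τ * accDiss` and a constant are the
only densities needed. -/
theorem lintegral_combination_le (h : IsFlow p μ cLo cHi ρLo ρHi K s₀ S) {T : ℝ}
    (hu : HasUniformBounds p μ T b C S) (hC : 0 ≤ C) {c₁ c₂ c₃ : ℝ} (h₁ : 0 ≤ c₁) (h₂ : 0 ≤ c₂)
    (h₃ : 0 ≤ c₃) (ht : t ∈ Icc 0 T) :
    ∫⁻ τ in Ioo 0 t, ENNReal.ofReal (c₁ * (S τ).accSq p μ + c₂ * (τ * (S τ).accDiss p μ) + c₃)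
      ≤ ENNReal.ofReal (c₁ * C + c₂ * C + c₃ * T) := by
  have hT : 0 ≤ T := ht.1.trans ht.2
  have hsub : Ioo 0 t ⊆ Ici 0 := fun τ hτ => hτ.1.le
  have m1 : AEMeasurable (fun τ => ENNReal.ofReal (c₁ * (S τ).accSq p μ))
      (volume.restrict (Ioo 0 t)) :=
    ((h.continuousOn_accSq.mono hsub).aemeasurable measurableSet_Ioo).const_mul c₁ |>.ennreal_ofReal
  have e : ∀ τ ∈ Ioo 0 t,
      ENNReal.ofReal (c₁ * (S τ).accSq p μ + c₂ * (τ * (S τ).accDiss p μ) + c₃)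
      = ENNReal.ofReal (c₁ * (S τ).accSq p μ) + ENNReal.ofReal (c₂ * (τ * (S τ).accDiss p μ))
        + ENNReal.ofReal c₃ := fun τ hτ => by
    have hb := hu.bounded τ ⟨hτ.1.le, hτ.2.le.trans ht.2⟩
    have hA := hb.accSq_nonneg
    have hB := hb.accDiss_nonneg
    have hτ0 := hτ.1.le
    rw [ENNReal.ofReal_add (by positivity) h₃, ENNReal.ofReal_add (by positivity) (by positivity)]
  rw [setLIntegral_congr_fun measurableSet_Ioo e, lintegral_add_right _ measurable_const,
    lintegral_add_left' m1, setLIntegral_const, Real.volume_Ioo, sub_zero,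
    ENNReal.ofReal_add (by positivity) (by positivity),
    ENNReal.ofReal_add (by positivity) (by positivity)]
  simp only [ENNReal.ofReal_mul h₁, ENNReal.ofReal_mul h₂, ENNReal.ofReal_mul h₃]
  rw [lintegral_const_mul' _ _ ENNReal.ofReal_ne_top, lintegral_const_mul' _ _ ENNReal.ofReal_ne_top]
  refine add_le_add (add_le_add ?_ ?_) ?_
  · exact mul_le_mul_right (hu.lintegral_accSq_le t ht) _
  · exact mul_le_mul_right (hu.lintegral_accDiss_le t ht) _
  · exact mul_le_mul_right (ENNReal.ofReal_le_ofReal ht.2) _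

theorem exists_velocity_bound (laws : ConstitutiveLaws p μ cLo cHi) (hρ : 0 < ρLo)
    (ρHi K : ℝ) {T : ℝ} (hT : 0 ≤ T) :
    ∃ C : ℝ, ∀ t ∈ Icc 0 T, ∀ (J : ℕ) (s₀ : MeshState J) (S : ℝ → MeshState J),
      IsFlow p μ cLo cHi ρLo ρHi K s₀ S →
        L2SpaceTime t (partialX fun t x => (S t).uHat x)
          + L2SpaceTime t (partialT fun t x => (S t).uHat x)
          + ENNReal.ofReal (min 1 t) * L2Space (partialT (fun t x => (S t).uHat x) t)
        ≤ ENNReal.ofReal C := by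
  obtain ⟨b, C, hb0, hC0, hb⟩ := exists_hasUniformBounds laws hρ ρHi K hT
  set D := 4 * C * b * C with hD
  have hD0 : 0 ≤ D := by positivity
  set X₁ := 0 * C + 0 * C + b * C * T
  set X₂ := 4 * b * C + 0 * C + D * T
  set X₃ := 4 * b * C + D * T
  refine ⟨√(max X₁ 0) + √(max X₂ 0) + √(max X₃ 0), fun t ht J s₀ S h => ?_⟩
  have hu := hb J s₀ S h
  have h1 : L2SpaceTime t (partialX fun t x => (S t).uHat x) ≤ ENNReal.ofReal √(max X₁ 0) := by
    refine L2SpaceTime_le (le_trans (setLIntegral_mono_ae' measurableSet_Ioo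
      (ae_of_all _ fun τ hτ => ?_)) (h.lintegral_combination_le hu hC0 le_rfl le_rfl
        (by positivity : 0 ≤ b * C) ht))
    have hτ' : τ ∈ Icc 0 T := ⟨hτ.1.le, hτ.2.le.trans ht.2⟩
    refine (hu.bounded τ hτ').lintegral_deriv_uHat_le.trans (ENNReal.ofReal_le_ofReal ?_)
    have := mul_le_mul_of_nonneg_left (hu.diss_le τ hτ') hb0.le
    linarith
  have hT' : ∀ τ ∈ Ioc 0 T, ∫⁻ y in Ioo (0 : ℝ) 1,
      ENNReal.ofReal (partialT (fun t y => (S t).uHat y) τ y ^ 2)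
      ≤ ENNReal.ofReal (4 * b * (S τ).accSq p μ + D) := fun τ hτ => by
    have hτ' : τ ∈ Icc 0 T := ⟨hτ.1.le, hτ.2⟩
    refine (h.lintegral_partialT_uHat_le hτ.1 (hu.bounded τ hτ') hC0 (hu.u_sq_le τ hτ')).trans
      (ENNReal.ofReal_le_ofReal ?_)
    have := mul_le_mul_of_nonneg_left (hu.diss_le τ hτ') (by positivity : 0 ≤ 4 * C * b)
    linarith
  have h2 : L2SpaceTime t (partialT fun t x => (S t).uHat x) ≤ ENNReal.ofReal √(max X₂ 0) := by
    refine L2SpaceTime_le (le_trans (setLIntegral_mono_ae' measurableSet_Ioo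
      (ae_of_all _ fun τ hτ => ?_)) (h.lintegral_combination_le hu hC0
        (by positivity : 0 ≤ 4 * b) le_rfl hD0 ht))
    refine (hT' τ ⟨hτ.1, hτ.2.le.trans ht.2⟩).trans (ENNReal.ofReal_le_ofReal ?_)
    linarith
  have h3 : ENNReal.ofReal (min 1 t) * L2Space (partialT (fun t x => (S t).uHat x) t)
      ≤ ENNReal.ofReal √(max X₃ 0) := by
    -- At time zero the weight vanishes, so the value of the time derivative there is irrelevant.
    rcases ht.1.eq_or_lt with rfl | ht0
    · simp
    have hA := (hu.bounded t ht).accSq_nonneg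
    have h4 : L2Space (partialT (fun t x => (S t).uHat x) t)
        ≤ ENNReal.ofReal √(max (4 * b * (S t).accSq p μ + D) 0) :=
      eLpNorm_two_le (hT' t ⟨ht0, ht.2⟩)
    refine (mul_le_mul_right h4 _).trans ?_
    have hm0 : 0 ≤ min 1 t := le_min zero_le_one ht.1
    rw [← ENNReal.ofReal_mul hm0]
    refine ENNReal.ofReal_le_ofReal ?_
    rw [max_eq_left (by positivity)]
    refine Real.le_sqrt_of_sq_le ?_
    rw [mul_pow, Real.sq_sqrt (by positivity)]
    refine le_max_of_le_left ?_
    -- Squaring the norm squares the weight, and `t` times `accSq` is what is bounded.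
    have h5 : min 1 t ^ 2 ≤ t := by
      have := min_le_left 1 t
      have := min_le_right 1 t
      nlinarith
    have h6 := mul_le_mul_of_nonneg_right h5 (by positivity : 0 ≤ 4 * b * (S t).accSq p μ + D)
    have h7 := mul_le_mul_of_nonneg_left (hu.accSq_le t ht) (by positivity : 0 ≤ 4 * b)
    have h8 := mul_le_mul_of_nonneg_left ht.2 hD0
    linarith
  refine (add_le_add (add_le_add h1 h2) h3).trans ?_
  rw [← ENNReal.ofReal_add (by positivity) (by positivity),
    ← ENNReal.ofReal_add (by positivity) (by positivity)]

theorem exists_flux_bound (laws : ConstitutiveLaws p μ cLo cHi) (hρ : 0 < ρLo)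
    (ρHi K : ℝ) {r : ℝ} (hr0 : 0 < r) (hr : r < 4 / 3) {T : ℝ} (hT : 0 ≤ T) :
    ∃ C : ℝ, ∀ t ∈ Icc 0 T, ∀ (J : ℕ) (s₀ : MeshState J) (S : ℝ → MeshState J),
      IsFlow p μ cLo cHi ρLo ρHi K s₀ S →
        (∫⁻ τ in Ioo (0 : ℝ) t, ∫⁻ x in Ioo (0 : ℝ) 1,
              ENNReal.ofReal (|partialX (fun t x => (S t).zHat p μ x) τ x| ^ 2))
            + ENNReal.ofReal (min 1 t) * (∫⁻ x in Ioo (0 : ℝ) 1,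
                ENNReal.ofReal (|partialX (fun t x => (S t).zHat p μ x) t x| ^ 2))
            + (∫⁻ τ in Ioo (0 : ℝ) t,
                (⨆ x ∈ Icc (0 : ℝ) 1,
                  ENNReal.ofReal |partialX (fun t x => (S t).zHat p μ x) τ x|) ^ r)
        ≤ ENNReal.ofReal C := by
  obtain ⟨b, C, hb0, hC0, hb⟩ := exists_hasUniformBounds laws hρ ρHi K hT
  set θ := r / 2 with hθ
  have hθ0 : 0 < θ := by positivity
  have hθ1 : θ < 1 := by linarith
  -- With `θ = r / 2` this is exactly the condition `r < 4 / 3`.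
  have hq : θ / (1 - θ) < 2 := by rw [div_lt_iff₀ (by linarith)]; linarith
  have hq0 : 0 ≤ θ / (1 - θ) := div_nonneg hθ0.le (by linarith)
  obtain ⟨W, hW0, hW⟩ := exists_lintegral_weight_le (pow_nonneg hb0.le 3) hq0 hq hT
  set X₁ := b ^ 3 * C + 0 * C + 0 * T
  set X₃ := 1 * C + 1 * C + 0 * T
  have hX₁ : 0 ≤ X₁ := by positivity
  have hX₃ : 0 ≤ X₃ := by positivity
  refine ⟨X₁ + b ^ 3 * C + (X₃ + W), fun t ht J s₀ S h => ?_⟩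
  have hu := hb J s₀ S h
  have h1 : ∫⁻ τ in Ioo (0 : ℝ) t, ∫⁻ x in Ioo (0 : ℝ) 1,
      ENNReal.ofReal (|partialX (fun t x => (S t).zHat p μ x) τ x| ^ 2) ≤ ENNReal.ofReal X₁ := by
    refine le_trans (setLIntegral_mono_ae' measurableSet_Ioo
      (ae_of_all _ fun τ hτ => ?_)) (h.lintegral_combination_le hu hC0
        (pow_nonneg hb0.le 3) le_rfl le_rfl ht)
    refine (hu.bounded τ ⟨hτ.1.le, hτ.2.le.trans ht.2⟩).lintegral_deriv_zHat_le.trans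
      (ENNReal.ofReal_le_ofReal ?_)
    linarith
  have h2 : ENNReal.ofReal (min 1 t) * (∫⁻ x in Ioo (0 : ℝ) 1,
      ENNReal.ofReal (|partialX (fun t x => (S t).zHat p μ x) t x| ^ 2))
      ≤ ENNReal.ofReal (b ^ 3 * C) := by
    refine (mul_le_mul_right (hu.bounded t ht).lintegral_deriv_zHat_le _).trans ?_
    rw [← ENNReal.ofReal_mul (le_min zero_le_one ht.1)]
    refine ENNReal.ofReal_le_ofReal ?_
    have hA := (hu.bounded t ht).accSq_nonneg
    have h3 := mul_le_mul_of_nonneg_right (min_le_right 1 t)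
      (by positivity : 0 ≤ b ^ 3 * (S t).accSq p μ)
    have h4 := mul_le_mul_of_nonneg_left (hu.accSq_le t ht) (pow_nonneg hb0.le 3)
    linarith
  have h3 : ∫⁻ τ in Ioo (0 : ℝ) t, (⨆ x ∈ Icc (0 : ℝ) 1,
      ENNReal.ofReal |partialX (fun t x => (S t).zHat p μ x) τ x|) ^ r
      ≤ ENNReal.ofReal (X₃ + W) := by
    have hmeas : Measurable fun τ : ℝ =>
        ENNReal.ofReal ((b ^ 3 * (1 + τ ^ (-(1 / 2 : ℝ)))) ^ (θ / (1 - θ))) := by fun_prop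
    calc _ ≤ ∫⁻ τ in Ioo (0 : ℝ) t,
          (ENNReal.ofReal (1 * (S τ).accSq p μ + 1 * (τ * (S τ).accDiss p μ) + 0)
            + ENNReal.ofReal ((b ^ 3 * (1 + τ ^ (-(1 / 2 : ℝ)))) ^ (θ / (1 - θ)))) := by
          refine setLIntegral_mono_ae' measurableSet_Ioo (ae_of_all _ fun τ hτ => ?_)
          have hbd := hu.bounded τ ⟨hτ.1.le, hτ.2.le.trans ht.2⟩
          have hτ0 : 0 < τ := hτ.1
          have hA := hbd.accSq_nonneg
          have hB := hbd.accDiss_nonneg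
          -- This choice gives `l⁻¹ = l * τ`, so `accDiss` acquires the weight `τ` under which its
          -- time integral is bounded.
          set l := τ ^ (-(1 / 2 : ℝ)) with hl
          have hl0 : 0 < l := by positivity
          have hlinv : l⁻¹ = l * τ := by
            have e : l * l * τ = 1 := by
              rw [hl, ← Real.rpow_add hτ0]
              norm_num [Real.rpow_neg_one, hτ0.ne']
            field_simp
            linarith
          set X := (S τ).accSq p μ + τ * (S τ).accDiss p μ with hX
          have hX0 : 0 ≤ X := by positivity
          have hsup : (⨆ x ∈ Icc (0 : ℝ) 1,
              ENNReal.ofReal |partialX (fun t x => (S t).zHat p μ x) τ x|)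
              ≤ ENNReal.ofReal ((b ^ 3 * (1 + l) * X) ^ (1 / 2 : ℝ)) := by
            refine iSup₂_le fun x _ => ENNReal.ofReal_le_ofReal ?_
            rw [← Real.sqrt_eq_rpow]
            refine Real.le_sqrt_of_sq_le ((hbd.abs_deriv_zHat_sq_le hl0 x).trans ?_)
            rw [hlinv, mul_assoc (b ^ 3), hX]
            refine mul_le_mul_of_nonneg_left ?_ (pow_nonneg hb0.le 3)
            have : 0 ≤ τ * (S τ).accDiss p μ := by positivity
            linarith
          refine (ENNReal.rpow_le_rpow hsup hr0.le).trans ?_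
          rw [ENNReal.ofReal_rpow_of_nonneg (by positivity) hr0.le,
            ← Real.rpow_mul (by positivity), ← ENNReal.ofReal_add (by positivity) (by positivity)]
          refine ENNReal.ofReal_le_ofReal ?_
          have := mul_rpow_le_add hX0 (by positivity : 0 ≤ b ^ 3 * (1 + l)) hθ0 hθ1
          rw [show 1 / 2 * r = θ by rw [hθ]; ring]
          linarith
      _ ≤ _ := by
          rw [lintegral_add_right _ hmeas, ENNReal.ofReal_add hX₃ hW0]
          exact add_le_add (h.lintegral_combination_le hu hC0 zero_le_one zero_le_one le_rfl ht)
            (hW t ht)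
  refine (add_le_add (add_le_add h1 h2) h3).trans ?_
  rw [← ENNReal.ofReal_add (by positivity) (by positivity),
    ← ENNReal.ofReal_add (by positivity) (by positivity)]

theorem exists_flux_time_bound (laws : ConstitutiveLaws p μ cLo cHi) (hρ : 0 < ρLo)
    (ρHi K κ : ℝ) {T : ℝ} (hT : 0 ≤ T) :
    ∃ C : ℝ, ∀ t ∈ Icc 0 T, ∀ (J : ℕ) (s₀ : MeshState J) (S : ℝ → MeshState J),
      IsFlow p μ cLo cHi ρLo ρHi K s₀ S → s₀.MeshRatioLE κ →
        ∫⁻ τ in Ioo (0 : ℝ) t, ∫⁻ x in Ioo (0 : ℝ) 1,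
          ENNReal.ofReal (min 1 τ * |partialT (fun t x => (S t).zHat p μ x) τ x| ^ 2)
        ≤ ENNReal.ofReal C := by
  obtain ⟨b, C, hb0, hC0, hb⟩ := exists_hasUniformBounds laws hρ ρHi K hT
  set k := b ^ 2 * (|ρHi| * |κ| * ρLo⁻¹)
  have hk : 0 ≤ k := by positivity
  set n := 4 * (1 + k) * (3 * b ^ 3) with hn
  have hn0 : 0 ≤ n := by positivity
  set c₁ := n * (10 * b ^ 4 * C) + 4 * C * b ^ 3 with hc₁
  set c₃ := n * ((10 * b ^ 4 * (1 + C) + 1) * C) with hc₃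
  have hc₁0 : 0 ≤ c₁ := by positivity
  have hc₃0 : 0 ≤ c₃ := by positivity
  refine ⟨c₁ * C + n * C + c₃ * T, fun t ht J s₀ S h hκ => ?_⟩
  have hu := hb J s₀ S h
  refine le_trans (setLIntegral_mono_ae' measurableSet_Ioo
    (ae_of_all _ fun τ hτ => ?_)) (h.lintegral_combination_le hu hC0 hc₁0 hn0 hc₃0 ht)
  have hτ' : τ ∈ Icc 0 T := ⟨hτ.1.le, hτ.2.le.trans ht.2⟩
  have hbd := hu.bounded τ hτ'
  have hA := hbd.accSq_nonneg
  have hB := hbd.accDiss_nonneg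
  have hD := hbd.diss_nonneg
  have hm0 : 0 ≤ min 1 τ := le_min zero_le_one hτ.1.le
  simp only [sq_abs, ENNReal.ofReal_mul hm0]
  rw [lintegral_const_mul' _ _ ENNReal.ofReal_ne_top]
  refine (mul_le_mul_right (h.lintegral_partialT_zHat_le hτ.1 hbd hC0 (hu.u_sq_le τ hτ')
    (h.meshRatioLE hτ.1.le hbd hκ)) _).trans ?_
  rw [← ENNReal.ofReal_mul hm0]
  refine ENNReal.ofReal_le_ofReal ?_
  have h1 : 4 * (1 + k) * ∑ j ∈ Finset.range J, (S τ).dx (j : ℤ) * (S τ).fluxDot p μ j ^ 2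
        + 4 * C * (b ^ 3 * (S τ).accSq p μ)
      ≤ c₁ * (S τ).accSq p μ + n * (S τ).accDiss p μ + c₃ := by
    have h2 := mul_le_mul_of_nonneg_left hbd.sum_fluxDot_sq_le (by positivity : 0 ≤ 4 * (1 + k))
    have hdl := hu.diss_le τ hτ'
    have h3 : (10 * b ^ 4 * (1 + (S τ).diss μ + (S τ).accSq p μ) + 1) * (S τ).diss μ
        ≤ (10 * b ^ 4 * (1 + C + (S τ).accSq p μ) + 1) * C := by gcongr
    have h4 := mul_le_mul_of_nonneg_left h3 hn0
    rw [hc₁, hc₃]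
    rw [hn] at h4 ⊢
    linarith
  -- The weight is bounded by `τ` in front of `accDiss` and by one elsewhere.
  have h5 : min 1 τ * (c₁ * (S τ).accSq p μ + n * (S τ).accDiss p μ + c₃)
      ≤ c₁ * (S τ).accSq p μ + n * (τ * (S τ).accDiss p μ) + c₃ := by
    have h6 := mul_le_mul_of_nonneg_right (min_le_left 1 τ)
      (by positivity : 0 ≤ c₁ * (S τ).accSq p μ + c₃)
    have h7 := mul_le_mul_of_nonneg_right (min_le_right 1 τ)
      (by positivity : 0 ≤ n * (S τ).accDiss p μ)
    linarith
  exact (mul_le_mul_of_nonneg_left h1 hm0).trans h5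

theorem exists_rhoHat_bound (laws : ConstitutiveLaws p μ cLo cHi) (hρ : 0 < ρLo) (ρHi K T : ℝ) :
    ∃ C : ℝ, ∀ t ∈ Icc 0 T, 0 < C ∧ ∀ (J : ℕ) (s₀ : MeshState J) (S : ℝ → MeshState J),
      IsFlow p μ cLo cHi ρLo ρHi K s₀ S → ∀ y,
        1 / C ≤ (S t).rhoHat y ∧ (S t).rhoHat y ≤ C := by
  obtain ⟨b, hb1, hb⟩ := exists_isBounded laws hρ ρHi K T
  refine ⟨b, fun t ht => ⟨by linarith, fun J s₀ S h y => ?_⟩⟩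
  have := ((hb J s₀ S h).2 t ht).1
  rw [one_div]
  exact ⟨this.dens_lower _, this.dens_upper _⟩

end IsFlow

end SemiDiscrete

/-! ### Passage to bound functions of time -/

theorem mainTheorem5 (p : ℝ → ℝ → ℝ) (μ : ℝ → ℝ) (cLo cHi : ℝ)
    (laws : SemiDiscrete.ConstitutiveLaws p μ cLo cHi)
    (ρLo ρHi K : ℝ) (hρLo : 0 < ρLo) :
    ∃ (C₁ C₂ : ℝ → ℝ) (C₃ C₄ : ℝ → ℝ → ℝ),
      SemiDiscrete.IsBoundFunction C₁ ∧ SemiDiscrete.IsBoundFunction C₂ ∧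
      (∀ r : ℝ, SemiDiscrete.IsBoundFunction (C₃ r)) ∧
      (∀ κ : ℝ, SemiDiscrete.IsBoundFunction (C₄ κ)) ∧
      ∀ (J : ℕ), 1 ≤ J →
      ∀ (s₀ : SemiDiscrete.MeshState J), s₀.Admissible cLo cHi ρLo ρHi K →
      ∀ (S : ℝ → SemiDiscrete.MeshState J), SemiDiscrete.IsGlobalSolution p μ s₀ S →
      ∀ (cHat rhoHat uHat zHat : ℝ → ℝ → ℝ),
        (cHat = fun t x => (S t).cHat x) →
        (rhoHat = fun t x => (S t).rhoHat x) →
        (uHat = fun t x => (S t).uHat x) →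
        (zHat = fun t x => (S t).zHat p μ x) →
      -- the derivatives below exist almost everywhere
      (∀ t : ℝ, 0 < t → ∀ᵐ x : ℝ,
        SemiDiscrete.HasPartials uHat t x ∧ SemiDiscrete.HasPartials zHat t x) ∧
      ∀ t : ℝ, 0 ≤ t →
        -- maximum principle
        (∀ x : ℝ, (⨅ j : Fin J, s₀.c ((j : ℕ) : ℤ)) ≤ cHat t x ∧
          cHat t x ≤ ⨆ j : Fin J, s₀.c ((j : ℕ) : ℤ)) ∧
        -- density bounds
        (∀ x : ℝ, 1 / C₁ t ≤ rhoHat t x ∧ rhoHat t x ≤ C₁ t) ∧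
        -- energy inequality
        (∀ H : ℝ → ℝ → ℝ, SemiDiscrete.IsInternalEnergy p cLo cHi H →
          (∀ x : ℝ, 0 ≤ H (rhoHat t x) (cHat t x)) →
          (∫⁻ x in Ioo (0 : ℝ) 1, ENNReal.ofReal (rhoHat t x * |uHat t x| ^ 2))
            + (∫⁻ x in Ioo (0 : ℝ) 1, ENNReal.ofReal (H (rhoHat t x) (cHat t x)))
            + (∫⁻ τ in Ioo (0 : ℝ) t, ∫⁻ x in Ioo (0 : ℝ) 1,
                ENNReal.ofReal (μ (cHat τ x) * |SemiDiscrete.partialX uHat τ x| ^ 2))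
            ≤ ENNReal.ofReal (2 * s₀.energy H)) ∧
        -- bounds on the derivatives of the velocity
        SemiDiscrete.L2SpaceTime t (SemiDiscrete.partialX uHat)
            + SemiDiscrete.L2SpaceTime t (SemiDiscrete.partialT uHat)
            + ENNReal.ofReal (min 1 t)
              * SemiDiscrete.L2Space (SemiDiscrete.partialT uHat t)
          ≤ ENNReal.ofReal (C₂ t) ∧
        -- bounds on the space derivative of the effective flux
        (∀ r : ℝ, 0 < r → r < 4 / 3 →
          (∫⁻ τ in Ioo (0 : ℝ) t, ∫⁻ x in Ioo (0 : ℝ) 1,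
              ENNReal.ofReal (|SemiDiscrete.partialX zHat τ x| ^ 2))
            + ENNReal.ofReal (min 1 t) * (∫⁻ x in Ioo (0 : ℝ) 1,
                ENNReal.ofReal (|SemiDiscrete.partialX zHat t x| ^ 2))
            + (∫⁻ τ in Ioo (0 : ℝ) t,
                (⨆ x ∈ Icc (0 : ℝ) 1,
                  ENNReal.ofReal |SemiDiscrete.partialX zHat τ x|) ^ r)
            ≤ ENNReal.ofReal (C₃ r t)) ∧
        -- weighted bound on the time derivative of the effective flux
        (∀ κ : ℝ, s₀.MeshRatioLE κ →
          (∫⁻ τ in Ioo (0 : ℝ) t, ∫⁻ x in Ioo (0 : ℝ) 1,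
              ENNReal.ofReal (min 1 τ * |SemiDiscrete.partialT zHat τ x| ^ 2))
            ≤ ENNReal.ofReal (C₄ κ t)) := by
  -- Positivity of `C` belongs to the predicate because `1 / C` decreases in `C` only for positive
  -- `C`, and the predicate has to be monotone.
  obtain ⟨C₁, hC₁, h₁⟩ := SemiDiscrete.exists_isBoundFunction (P := fun t C => 0 < C ∧
      ∀ (J : ℕ) (s₀ : SemiDiscrete.MeshState J) (S : ℝ → SemiDiscrete.MeshState J),
        SemiDiscrete.IsFlow p μ cLo cHi ρLo ρHi K s₀ S → ∀ y, 1 / C ≤ (S t).rhoHat y ∧ (S t).rhoHat y ≤ C)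
    (fun t c c' hc h => ⟨h.1.trans_le hc, fun J s₀ S hS y =>
      ⟨(one_div_le_one_div_of_le h.1 hc).trans (h.2 J s₀ S hS y).1,
        (h.2 J s₀ S hS y).2.trans hc⟩⟩)
    (fun T _ => SemiDiscrete.IsFlow.exists_rhoHat_bound laws hρLo ρHi K T)
  obtain ⟨C₂, hC₂, h₂⟩ := SemiDiscrete.exists_isBoundFunction
    (fun t c c' hc h J s₀ S hS => (h J s₀ S hS).trans (ENNReal.ofReal_le_ofReal hc))
    (fun T hT => SemiDiscrete.IsFlow.exists_velocity_bound laws hρLo ρHi K hT)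
  have hC₃ : ∀ r : ℝ, ∃ C : ℝ → ℝ, SemiDiscrete.IsBoundFunction C ∧
      ∀ t : ℝ, 0 ≤ t → 0 < r → r < 4 / 3 → _ := fun r => by
    by_cases hr : 0 < r ∧ r < 4 / 3
    · obtain ⟨C, hC, h⟩ := SemiDiscrete.exists_isBoundFunction
        (fun t c c' hc h J s₀ S hS => (h J s₀ S hS).trans (ENNReal.ofReal_le_ofReal hc))
        (fun T hT => SemiDiscrete.IsFlow.exists_flux_bound laws hρLo ρHi K hr.1 hr.2 hT)
      exact ⟨C, hC, fun t ht _ _ => h t ht⟩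
    -- Outside `0 < r < 4 / 3` nothing is claimed, so any bound function serves as a default.
    · exact ⟨C₁, hC₁, fun t _ h1 h2 => absurd ⟨h1, h2⟩ hr⟩
  choose C₃ hC₃ h₃ using hC₃
  choose C₄ hC₄ h₄ using fun κ : ℝ => SemiDiscrete.exists_isBoundFunction
    (fun t c c' hc h J s₀ S hS hκ => (h J s₀ S hS hκ).trans (ENNReal.ofReal_le_ofReal hc))
    (fun T hT => SemiDiscrete.IsFlow.exists_flux_time_bound laws hρLo ρHi K κ hT)
  refine ⟨C₁, C₂, C₃, C₄, hC₁, hC₂, hC₃, hC₄, ?_⟩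
  rintro J hJ s₀ adm S sol _ _ _ _ rfl rfl rfl rfl
  have h : SemiDiscrete.IsFlow p μ cLo cHi ρLo ρHi K s₀ S := ⟨laws, hρLo, hJ, adm, sol⟩
  exact ⟨fun t ht => h.ae_hasPartials ht, fun t ht => ⟨h.iInf_le_cHat ht, (h₁ t ht).2 J s₀ S h,
    fun H hH hH0 => h.energy_inequality ht hH hH0, h₂ t ht J s₀ S h,
    fun r hr0 hr => h₃ r t ht hr0 hr J s₀ S h, fun κ hκ => h₄ κ t ht J s₀ S h hκ⟩⟩
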